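/- Let $N\ge 1$ and $(k_1,k_2)=(1,9)$; put $\alpha=\frac{k_1+k_2}{2}=5$ and $\beta=\frac{k_2-k_1}{2}=4$. Let $\mathcal Z$ be the real skew-symmetric $(2N+2)\times(2N+2)$ matrix with, for $1\le i<j\le 2N$, $\mathcal Z_{ij}=\beta$ if $j-i$ is even and $\mathcal Z_{ij}=-\alpha$ if $j-i$ is odd; for $1\le i\le 2N$, $\mathcal Z_{i,2N+1}=-1$ and $\mathcal Z_{i,2N+2}=(-1)^{i+1}$; and $\mathcal Z_{2N+1,2N+2}=0$. Indices $1,\dots,2N$ are read modulo $2N$, and $\mathcal Z^{-1}_r:=(\mathcal Z^{-1})_{i(i+r)}$, which does not depend on $i$. The $(1,9)$ edge theory with $2N$ impurities is a complex Hilbert space of dimension $D_N=\frac{8^N-2^N}{3}$ with unitary operators $U_1,\dots,U_{2N}$ such that $$U_iU_j=e^{2\pi i\,\mathcal Z^{-1}_{ij}}U_jU_i,\qquad U_i^{\beta}U_{i+1}^{-2\alpha}U_{i+2}^{\beta}=\mathbb I,$$ $$U_1U_2\cdots U_{2N}=e^{i\theta_1}\mathbb I,\qquad U_1^{-1}U_2U_3^{-1}\cdots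 U_{2N}=e^{i\theta_2}\mathbb I,\qquad \mathrm{Tr}(U_2U_4\cdots U_{2N})=0,$$ where $\theta_1=\pi\sum_{j=1}^{2N-1}(2N-j)\mathcal Z^{-1}_j+2N\phi$, $\theta_2=\pi\sum_{j=1}^{2N-1}(2N-j)(-1)^j\mathcal Z^{-1}_j$ and $\phi=8\pi\mathcal Z^{-1}_2-40\pi\mathcal Z^{-1}_1+2\pi$. With $\varphi_K=48\pi\mathcal Z^{-1}_1$ and $\varphi_L=\pi(4\mathcal Z^{-1}_2-20\mathcal Z^{-1}_1)$ define $$K_i=e^{i\varphi_K}U_i^4U_{i+1}^{-2}\ (1\le i\le 2N),\qquad L_i=e^{i\varphi_L}U_{2i-1}^2U_{2i}^{-5}U_{2i+1}^2\ (1\le i\le N),$$ $$H_{\rm gap}=-\tfrac12\sum_{i=1}^{2N}(K_i+K_i^\dagger)-\tfrac12\sum_{i=1}^{N}(L_i+L_i^\dagger).$$ Then, in every such edge theory: 1. All the operators $K_i,L_j$ commute with one another, and $K_i^2=K_{i-1}$, $K_{2N}^Q=\mathbb I$ and $L_i^2=\mathbb I$, where $Q=(4^N-1)/3$ is an integer.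 2. For all $m\in\{0,\dots,Q-1\}$ and $\sigma_1,\dots,\sigma_N\in\{\pm1\}$, the joint eigenspace $\{v: K_{2N}v=e^{2\pi i m/Q}v,\ L_iv=\sigma_iv\text{ for all } i\}$ is one-dimensional; unit vectors $|m;\sigma_1,\dots,\sigma_N\rangle$ in these spaces form an orthonormal basis; $K_{2N-n}|m;\sigma\rangle=e^{i2^n2\pi m/Q}|m;\sigma\rangle$ for $0\le n<2N$; and $H_{\rm gap}|m;\sigma\rangle=E(m,\sigma)|m;\sigma\rangle$ with $$E(m,\{\sigma_i\})=-\sum_{n=0}^{2N-1}\cos(2^n2\pi m/Q)-\sum_{i=1}^N\sigma_i .$$ The eigenvalues of $H_{\rm gap}$ are exactly the numbers $E(m,\{\sigma_i\})$. 3. The ground state of $H_{\rm gap}$ is unique: it is the state with $m=0$ and all $\sigma_i=+1$, and every other label has strictly larger energy. 4. Flipping a single $\sigma_i$ in the ground state costs energy $\Delta_{\rm flip}=2$. The clock excitations cost $\Delta_{\rm clock}(m)=E(m,\{\sigma_i=1\})-E(0,\{\sigma_i=1\})=\sum_{n=0}^{2N-1}(1-\cos(2^n2\pi m/Q))$, and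 $\Delta_{\rm clock}(1)\le\Delta_{\rm clock}(m)$ for $1\le m<Q$. The energy gap of $H_{\rm gap}$ (the smallest eigenvalue above the ground state energy, minus the ground state energy) equals $2$ for every $N\ge1$, and $\min(\Delta_{\rm flip},\Delta_{\rm clock}(1))=2$ for $N\ge2$ (for $N=1$ there are no clock excitations). In particular the gap is $2$ in the thermodynamic limit. 5. As $N\to\infty$, $\Delta_{\rm clock}(1)\to\sum_{n=0}^\infty(1-\cos(3\pi2^{-n}))$, a convergent series with value $5.55$ to within $0.005$. -/

import Mathlib

open Complex (exp I)
open scoped Topology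

/-!  Finite dimensional edge theories of the `(k₁, k₂)` impurity model with `2N` impurities, and the
gapping Hamiltonian of the `(1, 9)` edge theory.  The impurities `1, …, 2N` are indexed cyclically by
`ZMod (2 * N)`; the impurity `2N` is the element `0`. -/

namespace ImpurityEdge

noncomputable section

/-- The representative in `{1, …, 2N}` of a site of the cyclic chain. -/
def siteLabel (N : ℕ) (i : ZMod (2 * N)) : ℕ := (i - 1).val + 1

/-- The commutator matrix `𝒵 = (1 / 2πi) [C_i, C_j]` of size `2N + 2`. The summand `ZMod (2 * N)`
indexes the impurities `1, …, 2N`, the summand `Fin 2` the rows and columns `2N + 1`, `2N + 2`.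
With `α = (k₁ + k₂) / 2` and `β = (k₂ - k₁) / 2`, the entry at two impurities `i < j` is `β` if
`j - i` is even and `-α` if `j - i` is odd. -/
def commutatorMatrix (k₁ k₂ N : ℕ) :
    Matrix (ZMod (2 * N) ⊕ Fin 2) (ZMod (2 * N) ⊕ Fin 2) ℝ :=
  let A : Matrix (ZMod (2 * N)) (ZMod (2 * N)) ℝ := Matrix.of fun i j =>
    (Int.sign ((siteLabel N j : ℤ) - (siteLabel N i : ℤ)) : ℝ) *
      (if Even (siteLabel N i + siteLabel N j) then ((k₂ : ℝ) - k₁) / 2 else -(((k₁ : ℝ) + k₂) / 2))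
  let B : Matrix (ZMod (2 * N)) (Fin 2) ℝ := Matrix.of fun i =>
    ![-1, if Odd (siteLabel N i) then 1 else -1]
  Matrix.fromBlocks A B (-B.transpose) 0

variable (k₁ k₂ N : ℕ) [NeZero N]

/-- The entries of `𝒵⁻¹` at two impurities. -/
def zInv (i j : ZMod (2 * N)) : ℝ :=
  (commutatorMatrix k₁ k₂ N)⁻¹ (Sum.inl i) (Sum.inl j)

/-- The abbreviation `𝒵⁻¹_r = 𝒵⁻¹_{i (i + r)}`, read off at `i = 1`. -/
def zInvRel (r : ZMod (2 * N)) : ℝ := zInv k₁ k₂ N 1 (1 + r)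

/-- The phase `φ` in `U_i = e^{i Γ_i + i φ}`. -/
def phaseU : ℝ :=
  Real.pi / (8 * k₁) * ((k₂ : ℝ) - k₁) ^ 2 * zInvRel k₁ k₂ N 2
    - Real.pi * ((k₂ : ℝ) ^ 2 - (k₁ : ℝ) ^ 2) / (2 * k₁) * zInvRel k₁ k₂ N 1
    + Real.pi * ((k₂ : ℝ) - k₁) / (4 * k₁)

/-- The boundary phase `θ₁`. -/
def theta₁ : ℝ :=
  Real.pi * ∑ j ∈ Finset.Icc 1 (2 * N - 1), (2 * (N : ℝ) - j) * zInvRel k₁ k₂ N (j : ZMod (2 * N))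
    + 2 * N * phaseU k₁ k₂ N

/-- The boundary phase `θ₂`. -/
def theta₂ : ℝ :=
  Real.pi * ∑ j ∈ Finset.Icc 1 (2 * N - 1),
    (2 * (N : ℝ) - j) * (-1) ^ j * zInvRel k₁ k₂ N (j : ZMod (2 * N))

/-- The ground state degeneracy `D_N` of the impurity model. -/
def degeneracy (k₁ k₂ N : ℕ) : ℝ :=
  ((((k₁ : ℝ) + k₂) / 2 + √((k₁ : ℝ) * k₂)) ^ N - (((k₁ : ℝ) + k₂) / 2 - √((k₁ : ℝ) * k₂)) ^ N) /
    √((k₁ : ℝ) * k₂)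

/-- The `(k₁, k₂)` edge theory (`k₁, k₂` odd) with `2N` impurities on the Hilbert space `V`: a
`D_N`-dimensional unitary representation of the defining operator algebra of the `U_i`. -/
structure EdgeTheory (V : Type*) [NormedAddCommGroup V] [InnerProductSpace ℂ V]
    [FiniteDimensional ℂ V] where
  /-- The basic local operators; they are unitary, `U_i⁻¹ = U_i†`. -/
  U : ZMod (2 * N) → unitary (Module.End ℂ V)
  /-- The Hilbert space has dimension `D_N`. -/
  finrank_eq : (Module.finrank ℂ V : ℝ) = degeneracy k₁ k₂ N
  /-- `U_i U_j = e^{2πi 𝒵⁻¹_{ij}} U_j U_i`. -/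
  U_mul_U : ∀ i j, (U i * U j : Module.End ℂ V) =
    exp (2 * Real.pi * I * zInv k₁ k₂ N i j) • (U j * U i : Module.End ℂ V)
  /-- `U_i^β U_{i+1}^{-2α} U_{i+2}^β = 𝕀`, where `2α = k₁ + k₂` and `β = (k₂ - k₁) / 2`. -/
  U_relation : ∀ i, U i ^ (((k₂ : ℤ) - k₁) / 2) * U (i + 1) ^ (-((k₁ : ℤ) + k₂)) *
    U (i + 2) ^ (((k₂ : ℤ) - k₁) / 2) = 1
  /-- `U_1 U_2 ⋯ U_{2N} = e^{i θ₁} 𝕀`. -/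
  prod_U : (((List.range (2 * N)).map fun l : ℕ => U ((l + 1 : ℕ) : ZMod (2 * N))).prod :
    Module.End ℂ V) = exp (I * theta₁ k₁ k₂ N) • (1 : Module.End ℂ V)
  /-- `U_1⁻¹ U_2 U_3⁻¹ ⋯ U_{2N} = e^{i θ₂} 𝕀`. -/
  prod_U_alternating :
    (((List.range (2 * N)).map fun l : ℕ => U ((l + 1 : ℕ) : ZMod (2 * N)) ^ ((-1 : ℤ) ^ (l + 1))).prod :
    Module.End ℂ V) = exp (I * theta₂ k₁ k₂ N) • (1 : Module.End ℂ V)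
  /-- `Tr (U_2 U_4 ⋯ U_{2N}) = 0`. -/
  trace_prod_even : LinearMap.trace ℂ V
    (((List.range N).map fun l : ℕ => U ((2 * (l + 1) : ℕ) : ZMod (2 * N))).prod : Module.End ℂ V) = 0

/-- The phase `φ_K` for `(k₁, k₂) = (1, 9)`. -/
def phaseK : ℝ := 48 * Real.pi * zInvRel 1 9 N 1

/-- The phase `φ_L` for `(k₁, k₂) = (1, 9)`. -/
def phaseL : ℝ := Real.pi * (4 * zInvRel 1 9 N 2 - 20 * zInvRel 1 9 N 1)

/-- `Q = (4^N - 1) / 3` (the division is exact). -/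
def clockOrder (N : ℕ) : ℕ := (4 ^ N - 1) / 3

/-- `E(m, {σ_i}) = - ∑_{n=0}^{2N-1} cos (2^n 2πm / Q) - ∑_i σ_i`. -/
def energy (N m : ℕ) (σ : Fin N → ℤˣ) : ℝ :=
  - ∑ n ∈ Finset.range (2 * N), Real.cos (2 ^ n * (2 * Real.pi * m) / clockOrder N)
    - ∑ i, (((σ i : ℤˣ) : ℤ) : ℝ)

/-- The clock excitation energy `Δ_clock(m) = E(m, {σ_i = 1}) - E(0, {σ_i = 1})`. -/
def clockGap (N m : ℕ) : ℝ := energy N m 1 - energy N 0 1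

namespace EdgeTheory

variable {N : ℕ} [NeZero N] {V : Type*} [NormedAddCommGroup V] [InnerProductSpace ℂ V]
  [FiniteDimensional ℂ V] (𝓔 : EdgeTheory 1 9 N V)

/-- `K_i = e^{i φ_K} U_i^4 U_{i+1}^{-2}`. -/
def K (i : ZMod (2 * N)) : Module.End ℂ V :=
  exp (I * phaseK N) • ((𝓔.U i ^ (4 : ℤ) * 𝓔.U (i + 1) ^ (-2 : ℤ) : unitary (Module.End ℂ V)) :
    Module.End ℂ V)

/-- `L_i = e^{i φ_L} U_{2i-1}^2 U_{2i}^{-5} U_{2i+1}^2`, where `j : Fin N` stands for `i = j + 1`. -/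
def L (j : Fin N) : Module.End ℂ V :=
  exp (I * phaseL N) • ((𝓔.U ((2 * (j : ℕ) + 1 : ℕ) : ZMod (2 * N)) ^ (2 : ℤ) *
      𝓔.U ((2 * (j : ℕ) + 2 : ℕ) : ZMod (2 * N)) ^ (-5 : ℤ) *
      𝓔.U ((2 * (j : ℕ) + 3 : ℕ) : ZMod (2 * N)) ^ (2 : ℤ) : unitary (Module.End ℂ V)) :
    Module.End ℂ V)

/-- `H_gap = - (1/2) ∑_{i=1}^{2N} (K_i + h.c.) - (1/2) ∑_{i=1}^{N} (L_i + h.c.)`. -/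
def H : Module.End ℂ V :=
  -((1 / 2 : ℂ) • ∑ i, (𝓔.K i + star (𝓔.K i))) - (1 / 2 : ℂ) • ∑ j, (𝓔.L j + star (𝓔.L j))

/-- The joint eigenspace of `K_{2N}, L_1, …, L_N` labelled by `(m, σ_1, …, σ_N)`. -/
def jointEigenspace (m : ℕ) (σ : Fin N → ℤˣ) : Submodule ℂ V :=
  (𝓔.K ((2 * N : ℕ) : ZMod (2 * N))).eigenspace (exp (2 * Real.pi * I * m / clockOrder N)) ⊓
    ⨅ j, (𝓔.L j).eigenspace (((σ j : ℤˣ) : ℤ) : ℂ)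

end EdgeTheory

end

end ImpurityEdge

open ImpurityEdge

namespace ImpurityEdge

/-! ### The inverse of the commutator matrix: recurrence, translation invariance, skewness -/

noncomputable section Commutator

variable {N : ℕ} [NeZero N]

/-! Operators. Up to phases the `U_i` generate a projective representation `T` of the lattice of
integer vectors on the cycle, with cocycle `e^{iπ B(a,b)}`, where `B` has Gram matrix `𝒵⁻¹`.
Everything known about `𝒵⁻¹` comes from one identity: the vector `c_i` with entries `4, -10, 4` at
`i, i+1, i+2` satisfies `B(c_i, b) = b_i - b_{i+2}` (`intForm_relation`). The prescribed phases are
those for which `T(c_i)`, `T(1, 1, …)` and `T(-1, 1, -1, …)` are the identity, and for which `K_i =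
T(k_i)` with `k_i = 4e_i - 2e_{i+1}`, and `L_j = T(c_i / 2)` with `i = 2j - 1`. The algebra is then
lattice arithmetic: `k_{i-1} = c_{i-1} + 2k_i` gives `K_i² = K_{i-1}`, and the alternating sum of
the `k_i` is six times the alternating vector, which gives `K_{2N}^Q = 1`.

Multiplicities. The monomials `K_{2N}^q ∏ L_j^{x_j}` represent the abelian group `ℤ/Q × (ℤ/2)^N`,
whose order is the dimension `D_N = Q 2^N`. If all nontrivial monomials are traceless
(`trace_clock_spin`), averaging over the group shows that each character occurs exactly once. A
monomial that commutes with some `T(b)` only up to a nontrivial phase is traceless. The one case not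
settled so is `∏ L_j`, a phase times `U_2 U_4 ⋯ U_{2N}`, whose trace vanishes by assumption.

Gap. A flip costs 2, so clock excitations must be shown to cost at least 2. The distance of `2^n m /
Q` to the nearest integer follows the tent map, equivalently `s ↦ 4s(1-s)` for `s = sin²`, and the
energy of the orbit is the sum of `2s`. A cubic potential whose increments telescope charges `3/2`
to every visit above `1/4` (a peak). Since `2^{2N} ≡ 1` modulo the odd number `Q`, the number of
peaks is even, and it is not zero; so the cost is at least 3.

Minimality of `m = 1`. Four peaks already cost 6, and `Δ_clock(1) ≤ 6`. An orbit with exactly two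
peaks is governed by a factorization `(3u+1)(3u'+1) = 4^N` into powers of two; it either passes
through 1, so has the energy of `m = 1`, or climbs slowly enough before both peaks to cost 6
(`energy_of_two_peaks`). Read from the largest angle downwards, `Δ_clock(1)` converges by dominated
convergence. -/

lemma siteLabel_pos (i : ZMod (2 * N)) : 1 ≤ siteLabel N i := by simp [siteLabel]

lemma siteLabel_le (i : ZMod (2 * N)) : siteLabel N i ≤ 2 * N := ZMod.val_lt (i - 1)

lemma siteLabel_injective : Function.Injective (siteLabel N) := by
  intro i j h
  have : (i - 1).val = (j - 1).val := by simpa [siteLabel] using h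
  simpa using ZMod.val_injective _ this

lemma siteLabel_add_one (i : ZMod (2 * N)) :
    siteLabel N (i + 1) = if siteLabel N i = 2 * N then 1 else siteLabel N i + 1 := by
  have hN : 0 < N := Nat.pos_of_ne_zero (NeZero.ne N)
  have h : i.val = ((i - 1).val + 1) % (2 * N) := by
    conv_lhs => rw [← sub_add_cancel i 1, ZMod.val_add, ZMod.val_one_eq_one_mod, Nat.add_mod_mod]
  have hl := siteLabel_le i
  have hi : siteLabel N i = (i - 1).val + 1 := rfl
  have hi1 : siteLabel N (i + 1) = i.val + 1 := by rw [siteLabel, add_sub_cancel_right]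
  rw [hi1, h, ← hi]
  split_ifs with h'
  · rw [h', Nat.mod_self]
  · rw [Nat.mod_eq_of_lt (by omega)]

/-- The alternating sign of a site: `-1` at odd impurities, `1` at even ones. -/
def siteSign (i : ZMod (2 * N)) : ℤ := (-1) ^ siteLabel N i

lemma siteSign_add_one (i : ZMod (2 * N)) : siteSign (i + 1) = -siteSign i := by
  simp only [siteSign, siteLabel_add_one]
  split_ifs with h
  · rw [h]; simp
  · rw [pow_succ]; ring

/-- The last term is the wrap-around: passing from site `2N` to site `1` raises every sign by 2, up
to the two diagonal corrections. -/
lemma sign_step (i j : ZMod (2 * N)) :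
    Int.sign ((siteLabel N j : ℤ) - siteLabel N (i + 1)) - Int.sign ((siteLabel N j : ℤ) - siteLabel N i)
      = -((if j = i then 1 else 0) + if j = i + 1 then 1 else 0)
        + 2 * if siteLabel N i = 2 * N then 1 else 0 := by
  have h1 := siteLabel_add_one i
  have e1 : j = i ↔ siteLabel N j = siteLabel N i := siteLabel_injective.eq_iff.symm
  have e2 : j = i + 1 ↔ siteLabel N j = siteLabel N (i + 1) := siteLabel_injective.eq_iff.symm
  have hi := siteLabel_pos i
  have hj := siteLabel_pos j
  have hi' := siteLabel_le i
  have hj' := siteLabel_le j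
  have hN : 0 < N := Nat.pos_of_ne_zero (NeZero.ne N)
  simp only [e1, e2]
  generalize siteLabel N (i + 1) = a at *
  generalize siteLabel N i = b at *
  generalize siteLabel N j = c at *
  have key : ∀ x : ℤ, (x < 0 ∧ x.sign = -1) ∨ (x = 0 ∧ x.sign = 0) ∨ (0 < x ∧ x.sign = 1) := by
    intro x
    rcases lt_trichotomy x 0 with h | h | h
    · exact Or.inl ⟨h, Int.sign_eq_neg_one_of_neg h⟩
    · exact Or.inr (Or.inl ⟨h, by simp [h]⟩)
    · exact Or.inr (Or.inr ⟨h, Int.sign_eq_one_of_pos h⟩)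
  have k1 := key ((c : ℤ) - a)
  have k2 := key ((c : ℤ) - b)
  generalize ((c : ℤ) - a).sign = s at *
  generalize ((c : ℤ) - b).sign = t at *
  split_ifs at * <;> omega

/-- The coefficient `β` or `-α` of the commutator matrix, as a function of the parities. -/
def parityCoeff (i j : ZMod (2 * N)) : ℝ := -1 / 2 + 9 / 2 * (siteSign i * siteSign j)

lemma siteSign_eq_ite (i : ZMod (2 * N)) :
    (siteSign i : ℝ) = if Odd (siteLabel N i) then -1 else 1 := by
  split_ifs with h
  · simp [siteSign, h.neg_one_pow]
  · simp [siteSign, (Nat.not_odd_iff_even.1 h).neg_one_pow]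

lemma siteSign_mul_self (i : ZMod (2 * N)) : siteSign i * siteSign i = 1 := by
  rw [siteSign, ← pow_add]; exact Even.neg_one_pow ⟨_, rfl⟩

lemma siteSign_mul_self_real (i : ZMod (2 * N)) : (siteSign i : ℝ) * siteSign i = 1 := by
  exact_mod_cast siteSign_mul_self i

lemma commutatorMatrix_inl_inl (i j : ZMod (2 * N)) :
    commutatorMatrix 1 9 N (Sum.inl i) (Sum.inl j)
      = (Int.sign ((siteLabel N j : ℤ) - siteLabel N i) : ℝ) * parityCoeff i j := by
  simp only [commutatorMatrix, Matrix.fromBlocks_apply₁₁, Matrix.of_apply, parityCoeff,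
    siteSign_eq_ite]
  congr 1
  simp only [Nat.even_add, ← Nat.not_even_iff_odd]
  by_cases hi : Even (siteLabel N i) <;> by_cases hj : Even (siteLabel N j) <;>
  simp only [hi, hj, iff_true, iff_false, not_true, not_false_iff, if_true, if_false] <;> norm_num

/-- The two hypotheses are what the last two rows of `𝒵` impose. `parityCoeff` is a combination of
the constant and the alternating form, so they annihilate the wrap-around terms and only the local
contributions at `i`, `i + 1`, `i + 2` survive. -/
lemma sum_commutatorMatrix_sub {v : ZMod (2 * N) → ℝ} (h0 : ∑ j, v j = 0)
    (h1 : ∑ j, (siteSign j : ℝ) * v j = 0) (i : ZMod (2 * N)) :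
    (∑ j, commutatorMatrix 1 9 N (Sum.inl (i + 2)) (Sum.inl j) * v j) -
      ∑ j, commutatorMatrix 1 9 N (Sum.inl i) (Sum.inl j) * v j
      = -4 * v i + 10 * v (i + 1) - 4 * v (i + 2) := by
  have h2 : ∑ j, parityCoeff i j * v j = 0 := by
    have : ∀ j, parityCoeff i j * v j =
        -1 / 2 * v j + 9 / 2 * siteSign i * (siteSign j * v j) := by
      intro j; rw [parityCoeff]; ring
    simp_rw [this, Finset.sum_add_distrib, ← Finset.mul_sum, h0, h1]
    ring
  have hi2 : i + 2 = i + 1 + 1 := by ring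
  have hc : ∀ j, parityCoeff (i + 2) j = parityCoeff i j := by
    intro j
    rw [parityCoeff, hi2, siteSign_add_one, siteSign_add_one, neg_neg, parityCoeff]
  have hs : ∀ j, commutatorMatrix 1 9 N (Sum.inl (i + 2)) (Sum.inl j) * v j -
      commutatorMatrix 1 9 N (Sum.inl i) (Sum.inl j) * v j =
      -(if j = i then parityCoeff i j * v j else 0)
       - 2 * (if j = i + 1 then parityCoeff i j * v j else 0)
       - (if j = i + 2 then parityCoeff i j * v j else 0)
       + 2 * ((if siteLabel N i = 2 * N then 1 else 0) +
          (if siteLabel N (i + 1) = 2 * N then 1 else 0)) * (parityCoeff i j * v j) := by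
    intro j
    rw [commutatorMatrix_inl_inl, commutatorMatrix_inl_inl, hc]
    have s1 := congrArg (Int.cast : ℤ → ℝ) (sign_step i j)
    have s2 := congrArg (Int.cast : ℤ → ℝ) (sign_step (i + 1) j)
    rw [← hi2] at s2
    push_cast at s1 s2
    have := congrArg₂ (· + ·) s1 s2
    calc _ = ((Int.sign ((siteLabel N j : ℤ) - siteLabel N (i + 1)) : ℝ) -
        Int.sign ((siteLabel N j : ℤ) - siteLabel N i) +
        (Int.sign ((siteLabel N j : ℤ) - siteLabel N (i + 2)) -
          Int.sign ((siteLabel N j : ℤ) - siteLabel N (i + 1)))) * (parityCoeff i j * v j) := by ring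
      _ = _ := by
        rw [s1, s2]
        simp only [← ite_zero_mul]
        split_ifs <;> ring
  rw [← Finset.sum_sub_distrib, Finset.sum_congr rfl fun j _ => hs j]
  simp only [Finset.sum_add_distrib, Finset.sum_sub_distrib, Finset.sum_neg_distrib,
    ← Finset.mul_sum, Finset.sum_ite_eq', Finset.mem_univ, if_true, h2]
  have c0 : parityCoeff i i = 4 := by
    rw [parityCoeff, siteSign_mul_self_real]; norm_num
  have c1 : parityCoeff i (i + 1) = -5 := by
    rw [parityCoeff, siteSign_add_one, Int.cast_neg, mul_neg, siteSign_mul_self_real]; norm_num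
  have c2 : parityCoeff i (i + 2) = 4 := by
    rw [parityCoeff, hi2, siteSign_add_one, siteSign_add_one, neg_neg, siteSign_mul_self_real]
    norm_num
  rw [c0, c1, c2]; ring

lemma commutatorMatrix_mulVec_inr_zero (x : ZMod (2 * N) ⊕ Fin 2 → ℝ) :
    (commutatorMatrix 1 9 N).mulVec x (Sum.inr 0) = ∑ j, x (Sum.inl j) := by
  simp [commutatorMatrix, Matrix.mulVec, dotProduct]

lemma commutatorMatrix_mulVec_inr_one (x : ZMod (2 * N) ⊕ Fin 2 → ℝ) :
    (commutatorMatrix 1 9 N).mulVec x (Sum.inr 1) = ∑ j, (siteSign j : ℝ) * x (Sum.inl j) := by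
  simp only [siteSign_eq_ite, commutatorMatrix, Matrix.mulVec, dotProduct, Fintype.sum_sum_type,
    Matrix.fromBlocks_apply₂₁, Matrix.fromBlocks_apply₂₂, Matrix.neg_apply, Matrix.transpose_apply,
    Matrix.of_apply, Matrix.cons_val_one, Matrix.cons_val_zero, Matrix.zero_apply, zero_mul,
    Finset.sum_const_zero, add_zero]
  refine Finset.sum_congr rfl fun j _ => ?_
  split_ifs <;> simp

lemma commutatorMatrix_inl_inr (i : ZMod (2 * N)) :
    commutatorMatrix 1 9 N (Sum.inl i) (Sum.inr 0) = -1 ∧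
    commutatorMatrix 1 9 N (Sum.inl i) (Sum.inr 1) = -siteSign i := by
  simp only [commutatorMatrix, siteSign_eq_ite, Matrix.fromBlocks_apply₁₂, Matrix.of_apply]
  constructor
  · simp
  · simp; split_ifs <;> simp

lemma commutatorMatrix_mulVec_inl (x : ZMod (2 * N) ⊕ Fin 2 → ℝ) (i : ZMod (2 * N)) :
    (commutatorMatrix 1 9 N).mulVec x (Sum.inl i) =
      (∑ j, commutatorMatrix 1 9 N (Sum.inl i) (Sum.inl j) * x (Sum.inl j))
        - x (Sum.inr 0) - siteSign i * x (Sum.inr 1) := by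
  simp only [Matrix.mulVec, dotProduct, Fintype.sum_sum_type, Fin.sum_univ_two,
    commutatorMatrix_inl_inr]
  ring

/-- The three-term recurrence satisfied by solutions of a linear system in `𝒵`. -/
lemma recurrence_of_mulVec {x y : ZMod (2 * N) ⊕ Fin 2 → ℝ}
    (h : (commutatorMatrix 1 9 N).mulVec x = y) (h0 : y (Sum.inr 0) = 0) (h1 : y (Sum.inr 1) = 0)
    (i : ZMod (2 * N)) :
    -4 * x (Sum.inl i) + 10 * x (Sum.inl (i + 1)) - 4 * x (Sum.inl (i + 2)) =
      y (Sum.inl (i + 2)) - y (Sum.inl i) := by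
  have e0 := commutatorMatrix_mulVec_inr_zero x
  have e1 := commutatorMatrix_mulVec_inr_one x
  rw [h, h0] at e0
  rw [h, h1] at e1
  rw [← sum_commutatorMatrix_sub (v := fun j => x (Sum.inl j)) e0.symm e1.symm, ← h,
    commutatorMatrix_mulVec_inl, commutatorMatrix_mulVec_inl]
  have : i + 2 = i + 1 + 1 := by ring
  rw [this, siteSign_add_one, siteSign_add_one, neg_neg]
  ring

/-- The homogeneous recurrence has only the zero solution, by the maximum principle. -/
lemma eq_zero_of_recurrence {v : ZMod (2 * N) → ℝ}
    (h : ∀ i, -4 * v i + 10 * v (i + 1) - 4 * v (i + 2) = 0) (i : ZMod (2 * N)) : v i = 0 := by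
  obtain ⟨m, hm⟩ := Finite.exists_max fun i => |v i|
  -- The recurrence centred at a maximum of `|v|` gives `10 |v m| ≤ 8 |v m|`.
  have e := h (m - 1)
  rw [sub_add_cancel] at e
  have a1 := abs_le.1 (hm (m - 1))
  have a2 := abs_le.1 (hm (m - 1 + 2))
  have : |v m| ≤ 0 := by
    rcases abs_cases (v m) with ⟨h1, h2⟩ | ⟨h1, h2⟩ <;> rw [h1] at a1 a2 ⊢ <;> linarith
  have hi := hm i
  exact abs_eq_zero.1 (le_antisymm (hi.trans this) (abs_nonneg _))

/-- The recurrence kills the impurity components of a kernel vector. Two neighbouring rows, which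
carry opposite alternating signs, then kill the two remaining ones. -/
lemma isUnit_det_commutatorMatrix : IsUnit (commutatorMatrix 1 9 N).det := by
  rw [isUnit_iff_ne_zero]
  intro hdet
  obtain ⟨x, hx, hx0⟩ := Matrix.exists_mulVec_eq_zero_iff.2 hdet
  have hv := eq_zero_of_recurrence (v := fun i => x (Sum.inl i)) fun i => by
    simpa using recurrence_of_mulVec hx0 rfl rfl i
  have e := fun i => commutatorMatrix_mulVec_inl x i
  simp only [hx0, hv, Pi.zero_apply, mul_zero, Finset.sum_const_zero, zero_sub] at e
  have e0 := e 0
  have e1 := e (0 + 1)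
  rw [siteSign_add_one] at e1
  push_cast at e1
  have hs := siteSign_mul_self_real (0 : ZMod (2 * N))
  have r0 : x (Sum.inr 0) = 0 := by linarith
  have r1 : x (Sum.inr 1) = 0 := by
    have : (siteSign (0 : ZMod (2 * N)) : ℝ) * x (Sum.inr 1) = 0 := by linarith
    calc x (Sum.inr 1) = (siteSign (0 : ZMod (2 * N)) : ℝ) * (siteSign (0 : ZMod (2 * N)) * x (Sum.inr 1)) := by
          rw [← mul_assoc, hs, one_mul]
      _ = 0 := by rw [this, mul_zero]
  apply hx
  funext k
  rcases k with i | k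
  · exact hv i
  · fin_cases k
    · exact r0
    · exact r1

lemma commutatorMatrix_mulVec_inv (j : ZMod (2 * N)) :
    (commutatorMatrix 1 9 N).mulVec (fun k => (commutatorMatrix 1 9 N)⁻¹ k (Sum.inl j)) =
      Pi.single (Sum.inl j) 1 := by
  funext k
  have := congrFun (congrFun (Matrix.mul_nonsing_inv _ (isUnit_det_commutatorMatrix (N := N))) k)
    (Sum.inl j)
  rw [Matrix.mul_apply] at this
  rw [Matrix.mulVec, dotProduct, this, Matrix.one_apply, Pi.single_apply]

lemma zInv_recurrence (i j : ZMod (2 * N)) :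
    4 * zInv 1 9 N i j - 10 * zInv 1 9 N (i + 1) j + 4 * zInv 1 9 N (i + 2) j
      = (if i = j then 1 else 0) - if i + 2 = j then 1 else 0 := by
  have := recurrence_of_mulVec (commutatorMatrix_mulVec_inv j) (by simp) (by simp) i
  simp only [Pi.single_apply, Sum.inl.injEq] at this
  simp only [zInv]
  linarith

/-- `𝒵` itself is not circulant, because signs flip at the wrap-around. But the recurrence for a
column of the inverse is translation invariant and has a unique solution. -/
lemma zInv_add_one_add_one (i j : ZMod (2 * N)) : zInv 1 9 N (i + 1) (j + 1) = zInv 1 9 N i j := by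
  have := eq_zero_of_recurrence (v := fun i => zInv 1 9 N (i + 1) (j + 1) - zInv 1 9 N i j)
    (fun i => by
      have h1 := zInv_recurrence (i + 1) (j + 1)
      have h2 := zInv_recurrence i j
      have e : i + 1 + 2 = i + 2 + 1 := by ring
      rw [e] at h1
      simp only [add_left_inj] at h1
      linarith) i
  linarith

lemma zInv_add_add (i j : ZMod (2 * N)) (k : ℕ) :
    zInv 1 9 N (i + k) (j + k) = zInv 1 9 N i j := by
  induction k with
  | zero => simp
  | succ k ih => rw [Nat.cast_succ, ← add_assoc, ← add_assoc, zInv_add_one_add_one, ih]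

lemma zInv_eq_zInvRel (i j : ZMod (2 * N)) : zInv 1 9 N i j = zInvRel 1 9 N (j - i) := by
  rw [zInvRel, ← zInv_add_add 1 (1 + (j - i)) (i - 1).val, ZMod.natCast_zmod_val]
  congr 1 <;> ring

lemma zInv_skew (i j : ZMod (2 * N)) : zInv 1 9 N j i = -zInv 1 9 N i j := by
  have hT : (commutatorMatrix 1 9 N).transpose = -commutatorMatrix 1 9 N := by
    funext a b
    rw [Matrix.transpose_apply, Matrix.neg_apply]
    rcases a with a | a <;> rcases b with b | b
    · rw [commutatorMatrix_inl_inl, commutatorMatrix_inl_inl, ← neg_sub (siteLabel N b : ℤ),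
        Int.sign_neg, parityCoeff, parityCoeff]
      push_cast; ring
    · simp [commutatorMatrix]
    · simp [commutatorMatrix]
    · simp [commutatorMatrix]
  have hinv : (-commutatorMatrix 1 9 N)⁻¹ = -(commutatorMatrix 1 9 N)⁻¹ :=
    Matrix.inv_eq_left_inv (by
      rw [neg_mul_neg, Matrix.nonsing_inv_mul _ isUnit_det_commutatorMatrix])
  have := Matrix.transpose_nonsing_inv (commutatorMatrix 1 9 N)
  rw [hT, hinv] at this
  exact congrFun (congrFun this (Sum.inl i)) (Sum.inl j)

end Commutator

/-! ### Weyl operators for a skew cocycle, over an arbitrary group with central phases -/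

noncomputable section Weyl

/-- A one-parameter family of central elements of a group. -/
structure CentralPhase (G : Type*) [Group G] where
  toFun : ℝ → G
  map_add : ∀ s t, toFun (s + t) = toFun s * toFun t
  comm : ∀ t g, toFun t * g = g * toFun t

variable {G : Type*} [Group G]

namespace CentralPhase

variable (z : CentralPhase G)

lemma map_zero : z.toFun 0 = 1 := by simpa using z.map_add 0 0

lemma map_neg (t : ℝ) : z.toFun (-t) = (z.toFun t)⁻¹ := by
  rw [eq_inv_iff_mul_eq_one, ← z.map_add, neg_add_cancel, z.map_zero]

lemma mul_eq {s t : ℝ} {x y x' y' : G} (hx : x = z.toFun s * x') (hy : y = z.toFun t * y') :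
    x * y = z.toFun (s + t) * (x' * y') := by
  rw [hx, hy, z.map_add, mul_assoc, mul_assoc, ← mul_assoc x', ← z.comm t x', mul_assoc]

lemma trans_eq {s t : ℝ} {x y w : G} (hx : x = z.toFun s * y) (hy : y = z.toFun t * w) :
    x = z.toFun (s + t) * w := by rw [hx, hy, z.map_add, mul_assoc]

lemma symm_eq {s : ℝ} {x y : G} (hx : x = z.toFun s * y) : y = z.toFun (-s) * x := by
  rw [hx, z.map_neg, inv_mul_cancel_left]

lemma map_mul_int (t : ℝ) (n : ℤ) : z.toFun (n * t) = z.toFun t ^ n := by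
  induction n using Int.induction_on with
  | zero => simp [z.map_zero]
  | succ n ih => rw [zpow_add_one, ← ih, ← z.map_add]; congr 1; push_cast; ring
  | pred n ih => rw [zpow_sub_one, ← ih, ← z.map_neg, ← z.map_add]; congr 1; push_cast; ring

lemma zpow_eq {s : ℝ} {x y : G} (hx : x = z.toFun s * y) (n : ℤ) :
    x ^ n = z.toFun (n * s) * y ^ n := by
  rw [hx, (show Commute (z.toFun s) y from z.comm s y).mul_zpow, z.map_mul_int]

lemma zpow_mul_zpow {s : ℝ} {x y : G} (h : x * y = z.toFun s * (y * x)) (m n : ℤ) :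
    x ^ m * y ^ n = z.toFun (m * n * s) * (y ^ n * x ^ m) := by
  have h1 : ∀ {s : ℝ} {x y : G}, x * y = z.toFun s * (y * x) → ∀ m : ℤ,
      x ^ m * y = z.toFun (m * s) * (y * x ^ m) := by
    intro s x y h m
    have e : y⁻¹ * x * y = z.toFun s * x := by
      rw [mul_assoc, h, ← mul_assoc, ← z.comm, mul_assoc, inv_mul_cancel_left]
    have e' := z.zpow_eq e m
    have e'' : (y⁻¹ * x * y) ^ m = y⁻¹ * x ^ m * y := by
      simpa using conj_zpow (a := y⁻¹) (b := x) (i := m)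
    rw [e''] at e'
    rw [← mul_assoc, z.comm, mul_assoc, ← e']
    group
  have h2 := z.symm_eq (h1 h m)
  have h3 := z.symm_eq (h1 h2 n)
  rw [h3]
  congr 2; ring

end CentralPhase

variable {ι : Type*} [Fintype ι]

/-- The bilinear form on integer vectors with Gram matrix `W`. -/
def intForm (W : ι → ι → ℝ) (a b : ι → ℤ) : ℝ := ∑ i, ∑ j, a i * W i j * b j

section Form

variable (W : ι → ι → ℝ)

lemma intForm_add_left (a a' b : ι → ℤ) :
    intForm W (a + a') b = intForm W a b + intForm W a' b := by
  simp only [intForm, ← Finset.sum_add_distrib, Pi.add_apply]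
  exact Finset.sum_congr rfl fun i _ => Finset.sum_congr rfl fun j _ => by push_cast; ring

lemma intForm_smul_left (n : ℤ) (a b : ι → ℤ) : intForm W (n • a) b = n * intForm W a b := by
  simp only [intForm, Finset.mul_sum, Pi.smul_apply, smul_eq_mul]
  exact Finset.sum_congr rfl fun i _ => Finset.sum_congr rfl fun j _ => by push_cast; ring

variable {W} in
lemma intForm_skew (hW : ∀ i j, W j i = -W i j) (a b : ι → ℤ) :
    intForm W b a = -intForm W a b := by
  simp only [intForm, ← Finset.sum_neg_distrib]
  rw [Finset.sum_comm]
  exact Finset.sum_congr rfl fun i _ => Finset.sum_congr rfl fun j _ => by rw [hW i j]; ring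

lemma intForm_zero_left (b : ι → ℤ) : intForm W 0 b = 0 := by simp [intForm]

lemma intForm_neg_left (a b : ι → ℤ) : intForm W (-a) b = -intForm W a b := by
  rw [← neg_one_smul ℤ, intForm_smul_left]; simp

lemma intForm_sum_left {κ : Type*} (s : Finset κ) (a : κ → ι → ℤ) (b : ι → ℤ) :
    intForm W (∑ k ∈ s, a k) b = ∑ k ∈ s, intForm W (a k) b := by
  classical
  induction s using Finset.induction_on with
  | empty => simp [intForm_zero_left]
  | insert k s hk ih => rw [Finset.sum_insert hk, Finset.sum_insert hk, intForm_add_left, ih]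

lemma intForm_single_left [DecidableEq ι] (i : ι) (n : ℤ) (b : ι → ℤ) :
    intForm W (Pi.single i n) b = n * ∑ j, W i j * b j := by
  rw [intForm, Finset.sum_eq_single i]
  · rw [Finset.mul_sum]; simp [mul_assoc]
  · intro k _ hk; simp [hk]
  · simp

lemma intForm_single_single [DecidableEq ι] (i j : ι) (m n : ℤ) :
    intForm W (Pi.single i m) (Pi.single j n) = m * n * W i j := by
  rw [intForm_single_left, Finset.sum_eq_single j]
  · simp; ring
  · intro k _ hk; simp [hk]
  · simp

end Form

/-- A projective representation `T` of the integer vectors with cocycle given by `intForm W`. -/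
structure WeylSystem (z : CentralPhase G) (W : ι → ι → ℝ) where
  T : (ι → ℤ) → G
  skew : ∀ i j, W j i = -W i j
  mul : ∀ a b, T a * T b = z.toFun (intForm W a b) * T (a + b)

/-- Generators are adjoined one at a time: `T` is multiplied by `U k ^ a k` and a phase that makes
the cocycle skew, half the commutator exponent. The last clause covers generators not yet adjoined
as well; it is what allows `U k` to be moved past `T` in the induction step. -/
lemma exists_weyl_aux [DecidableEq ι] (z : CentralPhase G) {W : ι → ι → ℝ} {U : ι → G}
    (hW : ∀ i j, W j i = -W i j) (hU : ∀ i j, U i * U j = z.toFun (2 * W i j) * (U j * U i))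
    (s : Finset ι) :
    ∃ T : (ι → ℤ) → G,
      (∀ a b, T a * T b = z.toFun (∑ i ∈ s, ∑ j ∈ s, a i * W i j * b j) * T (a + b)) ∧
      (∀ i ∈ s, ∀ n, T (Pi.single i n) = U i ^ n) ∧ (∀ i ∉ s, ∀ n, T (Pi.single i n) = 1) ∧
      (∀ a k (m : ℤ), T a * U k ^ m =
        z.toFun (2 * m * ∑ i ∈ s, a i * W i k) * (U k ^ m * T a)) := by
  induction s using Finset.induction_on with
  | empty => exact ⟨fun _ => 1, by simp [z.map_zero], by simp, by simp, by simp [z.map_zero]⟩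
  | insert k s hk ih =>
    obtain ⟨T, h1, h2, h3, h4⟩ := ih
    have hkk : W k k = 0 := by have := hW k k; linarith
    have hsk : ∀ a : ι → ℤ, ∑ j ∈ s, W k j * a j = -∑ j ∈ s, a j * W j k := by
      intro a
      rw [← Finset.sum_neg_distrib]
      exact Finset.sum_congr rfl fun j _ => by rw [hW j k]; ring
    refine ⟨fun a => z.toFun (-(a k * ∑ j ∈ s, W k j * a j)) * (U k ^ a k * T a), ?_, ?_, ?_, ?_⟩
    · intro a b
      have e1 : U k ^ a k * T a * (U k ^ b k * T b) =
          z.toFun (2 * b k * ∑ i ∈ s, a i * W i k + ∑ i ∈ s, ∑ j ∈ s, a i * W i j * b j) *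
            (U k ^ (a + b) k * T (a + b)) := by
        calc _ = U k ^ a k * (T a * U k ^ b k) * T b := by group
          _ = U k ^ a k * (z.toFun (2 * b k * ∑ i ∈ s, a i * W i k) * (U k ^ b k * T a)) * T b := by
            rw [h4]
          _ = z.toFun (2 * b k * ∑ i ∈ s, a i * W i k) * (U k ^ a k * U k ^ b k * (T a * T b)) := by
            rw [← mul_assoc (U k ^ a k), ← z.comm]; group
          _ = z.toFun (2 * b k * ∑ i ∈ s, a i * W i k) * (z.toFun (∑ i ∈ s, ∑ j ∈ s, a i * W i j * b j)
            * (U k ^ a k * U k ^ b k * T (a + b))) := by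
            rw [h1, ← mul_assoc (U k ^ a k * U k ^ b k), ← z.comm, mul_assoc (z.toFun _)]
          _ = _ := by rw [← mul_assoc, ← z.map_add, ← zpow_add]; rfl
      have e2 := z.trans_eq (z.mul_eq (rfl : _ = z.toFun (-(a k * ∑ j ∈ s, W k j * a j)) * _)
        (rfl : _ = z.toFun (-(b k * ∑ j ∈ s, W k j * b j)) * _)) e1
      have e3 := z.trans_eq e2 (z.symm_eq
        (rfl : z.toFun (-((a + b) k * ∑ j ∈ s, W k j * (a + b) j)) * _ = _))
      refine e3.trans ?_
      congr 2
      simp only [Finset.sum_insert hk, Pi.add_apply, Finset.sum_add_distrib]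
      have q1 : ∑ j ∈ s, W k j * ((a j + b j : ℤ) : ℝ) =
          ∑ j ∈ s, W k j * a j + ∑ j ∈ s, W k j * b j := by
        rw [← Finset.sum_add_distrib]
        exact Finset.sum_congr rfl fun j _ => by push_cast; ring
      have q2 : ∑ j ∈ s, (a k : ℝ) * W k j * b j = a k * ∑ j ∈ s, W k j * b j := by
        rw [Finset.mul_sum]; exact Finset.sum_congr rfl fun j _ => by ring
      have q3 : ∑ j ∈ s, (a j : ℝ) * W j k * b k = b k * ∑ j ∈ s, a j * W j k := by
        rw [Finset.mul_sum]; exact Finset.sum_congr rfl fun j _ => by ring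
      rw [q1, q2, q3, hsk, hkk]
      push_cast; ring
    · intro i hi n
      have hz : ∀ j ∈ s, W k j * ((Pi.single i n : ι → ℤ) j : ℝ) * ((Pi.single i n : ι → ℤ) k : ℝ) = 0 := by
        intro j hj
        have : j ≠ k := fun h => hk (h ▸ hj)
        by_cases h : j = i
        · have : k ≠ i := fun h' => this (h.trans h'.symm)
          simp [this]
        · simp [h]
      have hs : -(((Pi.single i n : ι → ℤ) k : ℝ) * ∑ j ∈ s, W k j * ((Pi.single i n : ι → ℤ) j : ℝ)) = 0 := by
        rw [mul_comm, Finset.sum_mul, Finset.sum_eq_zero hz, neg_zero]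
      beta_reduce
      rw [hs, z.map_zero, one_mul]
      by_cases h : i = k
      · subst h; simp [h3 i hk]
      · have hi' : i ∈ s := (Finset.mem_insert.1 hi).resolve_left h
        simp [h2 i hi', Pi.single_eq_of_ne (Ne.symm h)]
    · intro i hi n
      rw [Finset.mem_insert, not_or] at hi
      simp [h3 i hi.2, Pi.single_eq_of_ne (Ne.symm hi.1), z.map_zero]
    · intro a l m
      have e1 : U k ^ a k * T a * U l ^ m =
          z.toFun (2 * m * ∑ i ∈ s, a i * W i l + a k * m * (2 * W k l)) *
            (U l ^ m * (U k ^ a k * T a)) := by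
        rw [mul_assoc, h4, ← mul_assoc, ← z.comm, mul_assoc, ← mul_assoc (U k ^ a k),
          z.zpow_mul_zpow (hU k l), z.map_add]
        group
      beta_reduce
      rw [Finset.sum_insert hk]
      generalize U k ^ a k * T a = X at e1 ⊢
      rw [mul_assoc, e1, ← mul_assoc (U l ^ m), ← z.comm _ (U l ^ m), mul_assoc (z.toFun _) (U l ^ m),
        ← mul_assoc, ← z.map_add, ← mul_assoc (z.toFun _) (z.toFun _), ← z.map_add]
      congr 2; ring

theorem exists_weylSystem [DecidableEq ι] (z : CentralPhase G) {W : ι → ι → ℝ} {U : ι → G}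
    (hW : ∀ i j, W j i = -W i j) (hU : ∀ i j, U i * U j = z.toFun (2 * W i j) * (U j * U i)) :
    ∃ S : WeylSystem z W, ∀ i n, S.T (Pi.single i n) = U i ^ n := by
  obtain ⟨T, h1, h2, -, -⟩ := exists_weyl_aux z hW hU Finset.univ
  exact ⟨⟨T, hW, h1⟩, fun i => h2 i (Finset.mem_univ i)⟩

namespace WeylSystem

variable {z : CentralPhase G} {W : ι → ι → ℝ} (S : WeylSystem z W)

lemma form_self {z : CentralPhase G} {W : ι → ι → ℝ} (S : WeylSystem z W) (a : ι → ℤ) : intForm W a a = 0 := by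
  have := intForm_skew S.skew a a
  linarith

lemma T_zero : S.T 0 = 1 := by
  simpa [intForm_zero_left, z.map_zero] using S.mul 0 0

lemma T_add (a b : ι → ℤ) : S.T (a + b) = z.toFun (-intForm W a b) * (S.T a * S.T b) :=
  z.symm_eq (S.mul a b)

lemma mul_comm_phase (a b : ι → ℤ) :
    S.T a * S.T b = z.toFun (2 * intForm W a b) * (S.T b * S.T a) := by
  rw [S.mul b a, S.mul a b, add_comm b a, ← mul_assoc, ← z.map_add, intForm_skew S.skew a b]
  congr 2; ring

lemma T_neg (a : ι → ℤ) : S.T (-a) = (S.T a)⁻¹ := by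
  rw [eq_inv_iff_mul_eq_one, S.mul, intForm_neg_left, S.form_self, neg_zero, z.map_zero, one_mul,
    neg_add_cancel, S.T_zero]

/-- A skew form vanishes on pairs of multiples of one vector, so no phase appears. This is the
advantage of the symmetric ordering over ordered products. -/
lemma T_zsmul (a : ι → ℤ) (n : ℤ) : S.T (n • a) = S.T a ^ n := by
  induction n using Int.induction_on with
  | zero => simp [S.T_zero]
  | succ n ih =>
    rw [zpow_add_one, ← ih, S.mul, intForm_smul_left, S.form_self, mul_zero, z.map_zero, one_mul,
      add_smul, one_smul]
  | pred n ih =>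
    rw [zpow_sub_one, ← ih, ← S.T_neg, S.mul, intForm_smul_left, intForm_skew S.skew (-a),
      intForm_neg_left, S.form_self, neg_zero, neg_zero, mul_zero, z.map_zero, one_mul,
      sub_smul, one_smul, sub_eq_add_neg]

lemma list_prod (v : ℕ → ι → ℤ) (n : ℕ) :
    ((List.range n).map fun l => S.T (v l)).prod =
      z.toFun (∑ q ∈ Finset.range n, ∑ p ∈ Finset.range q, intForm W (v p) (v q)) *
        S.T (∑ l ∈ Finset.range n, v l) := by
  induction n with
  | zero => simp [z.map_zero, S.T_zero]
  | succ n ih =>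
    rw [List.range_succ, List.map_append, List.prod_append, ih, List.map_singleton,
      List.prod_singleton, mul_assoc, S.mul, ← mul_assoc, ← z.map_add, intForm_sum_left,
      Finset.sum_range_succ, Finset.sum_range_succ]

end WeylSystem

end Weyl

/-! ### Scalar phases `e^{iπt}` and the form `𝒵⁻¹` on the vectors of `K` and `L` -/

noncomputable section Edge

/-- The scalar unitaries `e^{iπt}`. -/
def phase (V : Type*) [NormedAddCommGroup V] [InnerProductSpace ℂ V] [FiniteDimensional ℂ V] :
    CentralPhase (unitary (Module.End ℂ V)) where
  toFun t := ⟨exp (Real.pi * t * I) • 1, by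
    have h : star (exp (Real.pi * t * I)) * exp (Real.pi * t * I) = 1 := by
      rw [Complex.star_def, ← Complex.exp_conj, ← Complex.exp_add]
      simp
    rw [Unitary.mem_iff, star_smul, star_one]
    simp only [smul_mul_smul_comm, mul_one, h, one_smul, true_and]
    rw [mul_comm, h, one_smul]⟩
  map_add s t := by
    ext1
    simp only [Submonoid.coe_mul, smul_mul_smul_comm, mul_one, ← Complex.exp_add]
    congr 2; push_cast; ring
  comm t g := by ext1; simp

variable {N : ℕ} [NeZero N] {V : Type*} [NormedAddCommGroup V] [InnerProductSpace ℂ V]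
  [FiniteDimensional ℂ V]

lemma coe_phase (t : ℝ) : (((phase V).toFun t : unitary (Module.End ℂ V)) : Module.End ℂ V)
    = exp (Real.pi * t * I) • 1 := rfl

lemma coe_phase_mul (t : ℝ) (g : unitary (Module.End ℂ V)) :
    (((phase V).toFun t * g : unitary (Module.End ℂ V)) : Module.End ℂ V)
    = exp (Real.pi * t * I) • (g : Module.End ℂ V) := by
  rw [Submonoid.coe_mul, coe_phase, smul_mul_assoc, one_mul]

lemma phase_two_mul_int (n : ℤ) : (phase V).toFun (2 * n) = 1 := by
  ext1
  rw [coe_phase]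
  have : (Real.pi * ((2 * n : ℝ) : ℂ) * I : ℂ) = n * (2 * Real.pi * I) := by push_cast; ring
  rw [this, Complex.exp_int_mul_two_pi_mul_I, one_smul]; rfl

lemma phase_eq_one {t : ℝ} (n : ℤ) (h : t = 2 * n) : (phase V).toFun t = 1 := by
  rw [h, phase_two_mul_int]

lemma zInv_succ (i : ZMod (2 * N)) : zInv 1 9 N i (i + 1) = zInvRel 1 9 N 1 := by
  rw [zInv_eq_zInvRel]; congr 1; ring

lemma zInv_succ_succ (i : ZMod (2 * N)) : zInv 1 9 N (i + 1) (i + 2) = zInvRel 1 9 N 1 := by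
  rw [zInv_eq_zInvRel]; congr 1; ring

lemma zInv_add_two (i : ZMod (2 * N)) : zInv 1 9 N i (i + 2) = zInvRel 1 9 N 2 := by
  rw [zInv_eq_zInvRel]; congr 1; ring

/-- `n₀ e_i + n₁ e_{i+1} + n₂ e_{i+2}`. -/
def triple (n₀ n₁ n₂ : ℤ) (i : ZMod (2 * N)) : ZMod (2 * N) → ℤ :=
  Pi.single i n₀ + Pi.single (i + 1) n₁ + Pi.single (i + 2) n₂

lemma intForm_triple_left (n₀ n₁ n₂ : ℤ) (i : ZMod (2 * N)) (b : ZMod (2 * N) → ℤ) :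
    intForm (zInv 1 9 N) (triple n₀ n₁ n₂ i) b =
      n₀ * ∑ j, zInv 1 9 N i j * b j + n₁ * ∑ j, zInv 1 9 N (i + 1) j * b j
        + n₂ * ∑ j, zInv 1 9 N (i + 2) j * b j := by
  simp only [triple, intForm_add_left, intForm_single_left]

lemma sum_zInv_recurrence (i : ZMod (2 * N)) (b : ZMod (2 * N) → ℤ) :
    4 * ∑ j, zInv 1 9 N i j * b j - 10 * ∑ j, zInv 1 9 N (i + 1) j * b j
      + 4 * ∑ j, zInv 1 9 N (i + 2) j * b j = b i - b (i + 2) := by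
  have h : ∀ j, 4 * (zInv 1 9 N i j * b j) - 10 * (zInv 1 9 N (i + 1) j * b j)
      + 4 * (zInv 1 9 N (i + 2) j * b j) = (if i = j then (b j : ℝ) else 0)
        - if i + 2 = j then (b j : ℝ) else 0 := by
    intro j
    have := congrArg (· * (b j : ℝ)) (zInv_recurrence i j)
    simp only [sub_mul, add_mul, ite_mul, one_mul, zero_mul, mul_assoc] at this
    exact this
  simp only [Finset.mul_sum, ← Finset.sum_sub_distrib, ← Finset.sum_add_distrib, h]
  simp

/-- The relation `c_i = (4, -10, 4)` pairs with `b` to `b_i - b_{i+2}`. -/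
lemma intForm_relation (i : ZMod (2 * N)) (b : ZMod (2 * N) → ℤ) :
    intForm (zInv 1 9 N) (triple 4 (-10) 4 i) b = b i - b (i + 2) := by
  rw [intForm_triple_left, ← sum_zInv_recurrence]; push_cast; ring

lemma intForm_spin (i : ZMod (2 * N)) (b : ZMod (2 * N) → ℤ) :
    intForm (zInv 1 9 N) (triple 2 (-5) 2 i) b = (b i - b (i + 2)) / 2 := by
  rw [intForm_triple_left, ← sum_zInv_recurrence]; push_cast; ring

/-- In terms of the shift `x`, `4 - 10x + 4x² = (4 - 2x)(1 - 2x)`: the relation vector is a clock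
vector minus twice the next one. -/
lemma intForm_clock_step (i : ZMod (2 * N)) (b : ZMod (2 * N) → ℤ) :
    intForm (zInv 1 9 N) (triple 4 (-2) 0 i) b - 2 * intForm (zInv 1 9 N) (triple 4 (-2) 0 (i + 1)) b
      = b i - b (i + 2) := by
  have h : i + 1 + 1 = i + 2 := by ring
  rw [intForm_triple_left, intForm_triple_left, ← sum_zInv_recurrence, h]; push_cast; ring

/-- By translation invariance the four terms collapse to `-2` times the recurrence at `i - 1`. The
value is an even integer, so products of clock operators acquire no sign. -/
lemma intForm_clock_clock (i j : ZMod (2 * N)) :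
    intForm (zInv 1 9 N) (triple 4 (-2) 0 i) (triple 4 (-2) 0 j) =
      -2 * ((if i - 1 = j then 1 else 0) - if i - 1 + 2 = j then 1 else 0) := by
  have h1 : ∀ k : ZMod (2 * N), ∑ l, zInv 1 9 N k l * (triple 4 (-2) 0 j l : ℤ) =
      4 * zInv 1 9 N k j - 2 * zInv 1 9 N k (j + 1) := by
    intro k
    have := intForm_single_left (zInv 1 9 N) k 1 (triple 4 (-2) 0 j)
    rw [Int.cast_one, one_mul] at this
    rw [← this, intForm_skew (fun a b => zInv_skew (N := N) a b), intForm_triple_left]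
    simp only [Pi.single_apply, Int.cast_ite, Int.cast_one, Int.cast_zero, mul_ite, mul_one,
      mul_zero, Finset.sum_ite_eq', Finset.mem_univ, if_true]
    rw [zInv_skew k j, zInv_skew k (j + 1)]
    push_cast; ring
  rw [intForm_triple_left, h1, h1, h1]
  have r := zInv_recurrence (i - 1) j
  have e1 : i - 1 + 2 = i + 1 := by ring
  have e2 : zInv 1 9 N i (j + 1) = zInv 1 9 N (i - 1) j := by
    rw [← zInv_add_one_add_one (i - 1), sub_add_cancel]
  rw [sub_add_cancel] at r
  rw [← r, zInv_add_one_add_one, e2, e1]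
  push_cast; ring

lemma siteSign_natCast (n : ℕ) : siteSign (n : ZMod (2 * N)) = (-1) ^ n := by
  induction n with
  | zero =>
    have h := siteSign_add_one (N := N) (-1)
    rw [neg_add_cancel] at h
    have h0 : siteLabel N 0 = 2 * N := by
      have := siteLabel_add_one (N := N) 0
      rw [zero_add] at this
      have h1 : siteLabel N 1 = 1 := by simp [siteLabel]
      rw [h1] at this
      have hp := siteLabel_pos (N := N) 0
      split_ifs at this <;> omega
    simp [siteSign, h0]
  | succ n ih => rw [Nat.cast_succ, siteSign_add_one, ih, pow_succ]; ring

/-- Sums over a full period of the chain. -/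
lemma sum_range_zmod {M : Type*} [AddCommMonoid M] (f : ZMod (2 * N) → M) :
    ∑ l ∈ Finset.range (2 * N), f (l : ℕ) = ∑ i, f i := by
  refine Finset.sum_bij (fun l _ => (l : ZMod (2 * N))) (fun _ _ => Finset.mem_univ _) ?_ ?_
    (fun _ _ => rfl)
  · intro a ha b hb h
    rw [ZMod.natCast_eq_natCast_iff', Nat.mod_eq_of_lt (Finset.mem_range.1 ha),
      Nat.mod_eq_of_lt (Finset.mem_range.1 hb)] at h
    exact h
  · intro i _
    exact ⟨i.val, Finset.mem_range.2 (ZMod.val_lt i), by simp⟩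

lemma sum_range_zmod_succ {M : Type*} [AddCommMonoid M] (f : ZMod (2 * N) → M) :
    ∑ l ∈ Finset.range (2 * N), f (l + 1 : ℕ) = ∑ i, f i := by
  simp only [Nat.cast_succ]
  rw [sum_range_zmod fun i => f (i + 1)]
  exact Equiv.sum_comp (Equiv.addRight (1 : ZMod (2 * N))) f

lemma sum_single_zmod (b : ZMod (2 * N) → ℤ) :
    ∑ l ∈ Finset.range (2 * N), Pi.single ((l + 1 : ℕ) : ZMod (2 * N)) (b (l + 1 : ℕ)) = b := by
  rw [sum_range_zmod_succ fun i => (Pi.single i (b i) : ZMod (2 * N) → ℤ)]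
  exact Finset.univ_sum_single b

/-- Exactly `n - j` pairs have difference `j`; this is the origin of the weights `2N - j` in
`theta₁` and `theta₂`. -/
lemma sum_range_sub (f : ℕ → ℝ) (n : ℕ) :
    ∑ q ∈ Finset.range n, ∑ p ∈ Finset.range q, f (q - p) =
      ∑ j ∈ Finset.Icc 1 (n - 1), ((n : ℝ) - j) * f j := by
  have h : ∀ q : ℕ, ∑ p ∈ Finset.range q, f (q - p) = ∑ j ∈ Finset.Icc 1 q, f j := by
    intro q
    refine Finset.sum_nbij' (fun p => q - p) (fun j => q - j) ?_ ?_ ?_ ?_ ?_ <;>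
      simp only [Finset.mem_range, Finset.mem_Icc, implies_true] <;> intros <;> omega
  induction n with
  | zero => simp
  | succ n ih =>
    rw [Finset.sum_range_succ, ih, h, Nat.add_sub_cancel]
    have e : ∑ j ∈ Finset.Icc 1 (n - 1), ((n : ℝ) - j) * f j =
        ∑ j ∈ Finset.Icc 1 n, ((n : ℝ) - j) * f j := by
      rcases n with _ | n
      · simp
      · rw [Finset.sum_Icc_succ_top (by omega), Nat.add_sub_cancel]; simp
    rw [e, ← Finset.sum_add_distrib]
    exact Finset.sum_congr rfl fun j _ => by push_cast; ring

end Edge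

/-! ### The edge theory in terms of Weyl operators: all prescribed phases cancel -/

noncomputable section Gauge

namespace EdgeTheory

variable {N : ℕ} [NeZero N] {V : Type*} [NormedAddCommGroup V] [InnerProductSpace ℂ V]
  [FiniteDimensional ℂ V] (𝓔 : EdgeTheory 1 9 N V)

lemma exists_gauge : ∃ S : WeylSystem (phase V) (zInv 1 9 N), ∀ i n,
    S.T (Pi.single i n) = ((phase V).toFun (-(phaseU 1 9 N / Real.pi)) * 𝓔.U i) ^ n := by
  refine exists_weylSystem (phase V) zInv_skew fun i j => ?_
  have h : 𝓔.U i * 𝓔.U j = (phase V).toFun (2 * zInv 1 9 N i j) * (𝓔.U j * 𝓔.U i) := by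
    ext1
    rw [coe_phase_mul, Submonoid.coe_mul, Submonoid.coe_mul, 𝓔.U_mul_U]
    congr 2; push_cast; ring
  have h1 := (phase V).mul_eq (rfl : _ = (phase V).toFun (-(phaseU 1 9 N / Real.pi)) * 𝓔.U i)
    (rfl : _ = (phase V).toFun (-(phaseU 1 9 N / Real.pi)) * 𝓔.U j)
  have h2 := (phase V).mul_eq (rfl : _ = (phase V).toFun (-(phaseU 1 9 N / Real.pi)) * 𝓔.U j)
    (rfl : _ = (phase V).toFun (-(phaseU 1 9 N / Real.pi)) * 𝓔.U i)
  refine ((phase V).trans_eq ((phase V).trans_eq h1 h) ((phase V).symm_eq h2)).trans ?_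
  congr 2; ring

/-- The operators `e^{i a · Γ}`, where `U_i = e^{i Γ_i + i φ}`. -/
def weyl : WeylSystem (phase V) (zInv 1 9 N) := 𝓔.exists_gauge.choose

lemma U_zpow (i : ZMod (2 * N)) (n : ℤ) :
    𝓔.U i ^ n = (phase V).toFun (n * (phaseU 1 9 N / Real.pi)) * 𝓔.weyl.T (Pi.single i n) := by
  have h : 𝓔.U i = (phase V).toFun (phaseU 1 9 N / Real.pi) *
      ((phase V).toFun (-(phaseU 1 9 N / Real.pi)) * 𝓔.U i) := by
    rw [← mul_assoc, ← (phase V).map_add, add_neg_cancel, (phase V).map_zero, one_mul]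
  rw [weyl, 𝓔.exists_gauge.choose_spec, ← (phase V).zpow_eq h]

lemma triple_prod (i : ZMod (2 * N)) (n₀ n₁ n₂ : ℤ) :
    𝓔.U i ^ n₀ * 𝓔.U (i + 1) ^ n₁ * 𝓔.U (i + 2) ^ n₂ =
      (phase V).toFun ((n₀ + n₁ + n₂) * (phaseU 1 9 N / Real.pi) +
        (n₀ * n₁ + n₁ * n₂) * zInvRel 1 9 N 1 + n₀ * n₂ * zInvRel 1 9 N 2) *
        𝓔.weyl.T (triple n₀ n₁ n₂ i) := by
  have h1 := (phase V).trans_eq ((phase V).mul_eq (𝓔.U_zpow i n₀) (𝓔.U_zpow (i + 1) n₁))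
    (𝓔.weyl.mul _ _)
  have h2 := (phase V).trans_eq ((phase V).mul_eq h1 (𝓔.U_zpow (i + 2) n₂)) (𝓔.weyl.mul _ _)
  rw [h2, triple, intForm_add_left, intForm_single_single, intForm_single_single,
    intForm_single_single, zInv_succ, zInv_succ_succ, zInv_add_two]
  congr 2; ring

lemma phaseU_div_pi : phaseU 1 9 N / Real.pi = 8 * zInvRel 1 9 N 2 - 40 * zInvRel 1 9 N 1 + 2 := by
  have := Real.pi_ne_zero
  rw [phaseU]; field_simp; norm_num; ring

lemma weyl_relation (i : ZMod (2 * N)) : 𝓔.weyl.T (triple 4 (-10) 4 i) = 1 := by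
  have h := 𝓔.triple_prod i 4 (-10) 4
  have h' := 𝓔.U_relation i
  rw [show (((9 : ℕ) : ℤ) - (1 : ℕ)) / 2 = 4 by norm_num,
    show -(((1 : ℕ) : ℤ) + (9 : ℕ)) = -10 by norm_num] at h'
  -- The exponent is `-2(8w₂ - 40w₁ + 2) - 80w₁ + 16w₂ = -4`, where `w_r = 𝒵⁻¹_r`.
  rw [h', phaseU_div_pi, phase_eq_one (-2) (by push_cast; ring), one_mul] at h
  exact h.symm

lemma K_eq (i : ZMod (2 * N)) : 𝓔.K i = (𝓔.weyl.T (triple 4 (-2) 0 i) : Module.End ℂ V) := by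
  have h := 𝓔.triple_prod i 4 (-2) 0
  rw [zpow_zero, mul_one] at h
  have e : exp (I * phaseK N) = exp (Real.pi * ((48 * zInvRel 1 9 N 1 : ℝ) : ℂ) * I) := by
    rw [phaseK]; congr 1; push_cast; ring
  have r := zInv_recurrence (0 : ZMod (2 * N)) (0 + 2)
  have r0 : zInv 1 9 N (0 + 2) (0 + 2) = 0 := by
    have := zInv_skew (N := N) (0 + 2) (0 + 2); linarith
  have r1 : zInv 1 9 N (0 + 1) (0 + 2) = zInvRel 1 9 N 1 := zInv_succ_succ 0
  rw [zInv_add_two, r0, r1, if_pos rfl] at r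
  rw [K, h, e, ← coe_phase_mul, ← mul_assoc, ← (phase V).map_add, phaseU_div_pi]
  -- The exponent is `16w₂ - 40w₁ + 4`. The recurrence gives `4w₂ - 10w₁ = -1`, except when `2 = 0`
  -- on the cycle (`N = 1`), where it gives `0`; the exponent is then `4`, which is still a trivial
  -- phase.
  split_ifs at r
  · rw [phase_eq_one 2 (by push_cast; linarith), one_mul]
  · rw [phase_eq_one 0 (by push_cast; linarith), one_mul]

lemma L_eq (j : Fin N) : 𝓔.L j =
    (𝓔.weyl.T (triple 2 (-5) 2 ((2 * (j : ℕ) + 1 : ℕ) : ZMod (2 * N))) : Module.End ℂ V) := by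
  have h := 𝓔.triple_prod ((2 * (j : ℕ) + 1 : ℕ) : ZMod (2 * N)) 2 (-5) 2
  have e : exp (I * phaseL N) = exp (Real.pi * ((4 * zInvRel 1 9 N 2 - 20 * zInvRel 1 9 N 1 : ℝ) : ℂ) * I) := by
    rw [phaseL]; congr 1; push_cast; ring
  have e1 : ((2 * (j : ℕ) + 2 : ℕ) : ZMod (2 * N)) = ((2 * (j : ℕ) + 1 : ℕ) : ZMod (2 * N)) + 1 := by
    push_cast; ring
  have e2 : ((2 * (j : ℕ) + 3 : ℕ) : ZMod (2 * N)) = ((2 * (j : ℕ) + 1 : ℕ) : ZMod (2 * N)) + 2 := by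
    push_cast; ring
  -- All `𝒵⁻¹` terms cancel and the exponent `-2` remains.
  rw [L, e1, e2, h, e, ← coe_phase_mul, ← mul_assoc, ← (phase V).map_add, phaseU_div_pi,
    phase_eq_one (-1) (by push_cast; ring), one_mul]

lemma list_prod_U (s : ℕ → ZMod (2 * N)) (c : ℕ → ℤ) (n : ℕ) :
    ((List.range n).map fun l => 𝓔.U (s l) ^ c l).prod =
      (phase V).toFun ((∑ l ∈ Finset.range n, (c l : ℝ)) * (phaseU 1 9 N / Real.pi) +
        ∑ q ∈ Finset.range n, ∑ p ∈ Finset.range q, c p * c q * zInv 1 9 N (s p) (s q)) *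
        𝓔.weyl.T (∑ l ∈ Finset.range n, Pi.single (s l) (c l)) := by
  induction n with
  | zero => simp [(phase V).map_zero, WeylSystem.T_zero]
  | succ n ih =>
    rw [List.range_succ, List.map_append, List.prod_append, List.map_singleton, List.prod_singleton,
      (phase V).trans_eq ((phase V).mul_eq ih (𝓔.U_zpow (s n) (c n))) (𝓔.weyl.mul _ _),
      intForm_sum_left]
    simp only [Finset.sum_range_succ, intForm_single_single]
    congr 2; ring

/-- A full product of the `U_i` with exponents `b_i`, where `b` has constant correlations. -/
lemma weyl_eq_one {b : ZMod (2 * N) → ℤ} {r : ℕ → ℝ} {θ t : ℝ}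
    (hb : ∀ q, ∀ p < q, (b (p + 1 : ℕ) * b (q + 1 : ℕ) : ℝ) = r (q - p)) (hs : (∑ i, (b i : ℝ)) = t)
    (h : ((((List.range (2 * N)).map fun l : ℕ => 𝓔.U ((l + 1 : ℕ) : ZMod (2 * N)) ^ b (l + 1 : ℕ)).prod
      : unitary (Module.End ℂ V)) : Module.End ℂ V) = exp (I * θ) • 1)
    (hθ : θ = Real.pi * (∑ j ∈ Finset.Icc 1 (2 * N - 1),
      (2 * (N : ℝ) - j) * (r j * zInvRel 1 9 N (j : ZMod (2 * N)))) + t * phaseU 1 9 N) :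
    𝓔.weyl.T b = 1 := by
  have h' : ((List.range (2 * N)).map fun l : ℕ =>
      𝓔.U ((l + 1 : ℕ) : ZMod (2 * N)) ^ b (l + 1 : ℕ)).prod = (phase V).toFun (θ / Real.pi) := by
    ext1
    rw [h, coe_phase]
    congr 2
    have : (Real.pi : ℂ) ≠ 0 := by exact_mod_cast Real.pi_ne_zero
    push_cast; field_simp
  rw [𝓔.list_prod_U (fun l => ((l + 1 : ℕ) : ZMod (2 * N))) (fun l => b (l + 1 : ℕ)),
    sum_single_zmod, sum_range_zmod_succ (fun i => (b i : ℝ)), hs] at h'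
  have e : ∑ q ∈ Finset.range (2 * N), ∑ p ∈ Finset.range q, (b (p + 1 : ℕ) : ℝ) * b (q + 1 : ℕ) *
      zInv 1 9 N (p + 1 : ℕ) (q + 1 : ℕ) =
      ∑ q ∈ Finset.range (2 * N), ∑ p ∈ Finset.range q,
        (fun j : ℕ => r j * zInvRel 1 9 N (j : ZMod (2 * N))) (q - p) := by
    refine Finset.sum_congr rfl fun q _ => Finset.sum_congr rfl fun p hp => ?_
    have hp' := Finset.mem_range.1 hp
    rw [hb q p hp', zInv_eq_zInvRel]
    congr 2
    rw [Nat.cast_sub hp'.le]; push_cast; ring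
  have e' : t * (phaseU 1 9 N / Real.pi) + ∑ q ∈ Finset.range (2 * N), ∑ p ∈ Finset.range q,
      (b (p + 1 : ℕ) : ℝ) * b (q + 1 : ℕ) * zInv 1 9 N (p + 1 : ℕ) (q + 1 : ℕ) = θ / Real.pi := by
    have := Real.pi_ne_zero
    rw [e, sum_range_sub (fun j : ℕ => r j * zInvRel 1 9 N (j : ZMod (2 * N))), hθ]
    push_cast; field_simp; ring
  rw [e'] at h'
  exact mul_eq_left.1 h'

/-- `theta₁` is precisely the phase between the ordered product and the Weyl operator of the
constant vector. The same holds for `theta₂` and the alternating vector, where `φ` drops out because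
the signs sum to zero. -/
lemma weyl_one : 𝓔.weyl.T 1 = 1 := by
  refine 𝓔.weyl_eq_one (r := fun _ => 1) (t := 2 * N) (θ := theta₁ 1 9 N) (by simp) (by simp) ?_ ?_
  · simpa using 𝓔.prod_U
  · simp [theta₁]

lemma sum_siteSign : ∑ i : ZMod (2 * N), siteSign i = 0 := by
  have h := Equiv.sum_comp (Equiv.addRight (1 : ZMod (2 * N))) siteSign
  simp only [Equiv.coe_addRight, siteSign_add_one, Finset.sum_neg_distrib] at h
  omega

lemma weyl_siteSign : 𝓔.weyl.T siteSign = 1 := by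
  refine 𝓔.weyl_eq_one (r := fun j => (-1) ^ j) (t := 0) (θ := theta₂ 1 9 N) ?_
    (by exact_mod_cast sum_siteSign) ?_ ?_
  · intro q p hpq
    obtain ⟨d, rfl⟩ := Nat.exists_eq_add_of_lt hpq
    rw [siteSign_natCast, siteSign_natCast, show p + d + 1 - p = d + 1 by omega]
    push_cast
    rw [← pow_add, show p + 1 + (p + d + 1 + 1) = 2 * (p + 1) + (d + 1) by ring, pow_add, pow_mul]
    simp
  · simpa only [siteSign_natCast] using 𝓔.prod_U_alternating
  · simp [theta₂, mul_assoc]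

end EdgeTheory

end Gauge

/-! ### Commutation relations and orders of the clock and spin operators -/

lemma three_mul_clockOrder (N : ℕ) : 3 * clockOrder N = 4 ^ N - 1 := by
  rw [clockOrder]
  have h : 4 ^ N % 3 = 1 := by rw [Nat.pow_mod]; simp
  have := Nat.div_add_mod (4 ^ N) 3
  omega

lemma three_mul_clockOrder_add_one (N : ℕ) : 3 * clockOrder N + 1 = 4 ^ N := by
  have := three_mul_clockOrder N
  have : 1 ≤ 4 ^ N := Nat.one_le_pow _ _ (by norm_num)
  omega

noncomputable section Clock

variable {N : ℕ} [NeZero N]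

lemma clockOrder_pos : 0 < clockOrder N := by
  have := three_mul_clockOrder_add_one N
  have : 4 ^ 1 ≤ 4 ^ N := Nat.pow_le_pow_right (by norm_num) (Nat.pos_of_ne_zero (NeZero.ne N))
  omega

lemma siteSign_add (i j : ZMod (2 * N)) : siteSign (i + j) = siteSign i * siteSign j := by
  rw [← ZMod.natCast_zmod_val i, ← ZMod.natCast_zmod_val j, ← Nat.cast_add]
  simp only [siteSign_natCast, pow_add]

lemma siteSign_neg (i : ZMod (2 * N)) : siteSign (-i) = siteSign i := by
  have h := siteSign_add i (-i)
  have h0 := siteSign_natCast (N := N) 0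
  rw [Nat.cast_zero, pow_zero] at h0
  rw [add_neg_cancel, h0] at h
  calc siteSign (-i) = siteSign i * siteSign i * siteSign (-i) := by rw [siteSign_mul_self, one_mul]
    _ = siteSign i := by rw [mul_assoc, ← h, mul_one]

/-- Each site receives its sign four times from its own clock vector and twice from its
predecessor's, whose sign is opposite and whose entry there is `-2`. -/
lemma sum_siteSign_smul_clock :
    ∑ n ∈ Finset.range (2 * N), siteSign ((n : ℕ) : ZMod (2 * N)) • triple 4 (-2) 0 (-(n : ZMod (2 * N)))
      = (6 : ℤ) • siteSign := by
  rw [sum_range_zmod fun i => siteSign i • triple 4 (-2) 0 (-i),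
    ← Equiv.sum_comp (Equiv.neg (ZMod (2 * N)))]
  have h : ∀ i : ZMod (2 * N), siteSign (-i) • triple 4 (-2) 0 (- -i) =
      Pi.single i (4 * siteSign i) + Pi.single (i + 1) (2 * siteSign (i + 1)) := by
    intro i
    rw [siteSign_neg, neg_neg, triple, Pi.single_zero, add_zero, siteSign_add_one, smul_add,
      ← Pi.single_smul, ← Pi.single_smul]
    congr 2 <;> simp only [smul_eq_mul] <;> ring
  simp only [Equiv.neg_apply, h, Finset.sum_add_distrib]
  have h2 := Equiv.sum_comp (Equiv.addRight (1 : ZMod (2 * N)))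
    fun i => (Pi.single i (2 * siteSign i) : ZMod (2 * N) → ℤ)
  simp only [Equiv.coe_addRight] at h2
  rw [h2, Finset.univ_sum_single fun i : ZMod (2 * N) => 4 * siteSign i,
    Finset.univ_sum_single fun i : ZMod (2 * N) => 2 * siteSign i]
  funext i
  simp only [Pi.add_apply, Pi.smul_apply, smul_eq_mul]
  ring

lemma sum_neg_two_pow (N : ℕ) : ∑ n ∈ Finset.range (2 * N), (-2 : ℤ) ^ n = -clockOrder N := by
  have h := geom_sum_mul (-2 : ℤ) (2 * N)
  rw [pow_mul] at h
  norm_num at h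
  have : (3 * clockOrder N + 1 : ℤ) = 4 ^ N := by exact_mod_cast three_mul_clockOrder_add_one N
  linarith

lemma even_clock_apply (i k : ZMod (2 * N)) : ∃ n : ℤ, triple 4 (-2) 0 i k = 2 * n := by
  refine ⟨triple 2 (-1) 0 i k, ?_⟩
  simp only [triple, Pi.add_apply, Pi.single_apply]
  split_ifs <;> rfl

variable {V : Type*} [NormedAddCommGroup V] [InnerProductSpace ℂ V] [FiniteDimensional ℂ V]

lemma phase_eq_one_of_mem {t : ℝ} (h : t ∈ AddSubgroup.zmultiples (2 : ℝ)) :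
    (phase V).toFun t = 1 := by
  obtain ⟨n, rfl⟩ := AddSubgroup.mem_zmultiples_iff.1 h
  exact phase_eq_one n (by rw [zsmul_eq_mul, mul_comm])

lemma WeylSystem.commute_of_form {W : ZMod (2 * N) → ZMod (2 * N) → ℝ}
    (S : WeylSystem (phase V) W) {a b : ZMod (2 * N) → ℤ} (n : ℤ)
    (h : intForm W a b = n) : Commute (S.T a) (S.T b) := by
  have := S.mul_comm_phase a b
  rwa [phase_eq_one n (by rw [h]), one_mul] at this

namespace EdgeTheory

variable (𝓔 : EdgeTheory 1 9 N V)

/-- The unitary `K_i`. -/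
def clock (i : ZMod (2 * N)) : unitary (Module.End ℂ V) := 𝓔.weyl.T (triple 4 (-2) 0 i)

/-- The unitary `e^{i φ_L} U_i^2 U_{i+1}^{-5} U_{i+2}^2`. -/
def spin (i : ZMod (2 * N)) : unitary (Module.End ℂ V) := 𝓔.weyl.T (triple 2 (-5) 2 i)

lemma intForm_clock_clock_int (i j : ZMod (2 * N)) : ∃ n : ℤ,
    intForm (zInv 1 9 N) (triple 4 (-2) 0 i) (triple 4 (-2) 0 j) = 2 * n := by
  refine ⟨-((if i - 1 = j then 1 else 0) - if i - 1 + 2 = j then 1 else 0), ?_⟩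
  rw [intForm_clock_clock]; push_cast; ring

lemma clock_commute (i j : ZMod (2 * N)) : Commute (𝓔.clock i) (𝓔.clock j) := by
  obtain ⟨n, hn⟩ := intForm_clock_clock_int i j
  exact 𝓔.weyl.commute_of_form (2 * n) (by rw [hn]; push_cast; ring)

lemma spin_commute_clock (i j : ZMod (2 * N)) : Commute (𝓔.spin i) (𝓔.clock j) := by
  obtain ⟨m, hm⟩ := even_clock_apply j i
  obtain ⟨n, hn⟩ := even_clock_apply j (i + 2)
  refine 𝓔.weyl.commute_of_form (m - n) ?_
  rw [intForm_spin, hm, hn]; push_cast; ring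

/-- The form reads off half a difference of entries at sites of the parity of `j`, where the spin
vector has only even entries; its `-5` sits on the other parity. -/
lemma spin_commute_spin {i j : ZMod (2 * N)} (h : siteSign i = siteSign j) :
    Commute (𝓔.spin i) (𝓔.spin j) := by
  have key : ∀ k : ZMod (2 * N), siteSign k = siteSign j →
      triple 2 (-5) 2 j k = 2 * triple 1 0 1 j k := by
    intro k hk
    have hne : k ≠ j + 1 := by
      rintro rfl
      rw [siteSign_add_one] at hk
      have := siteSign_mul_self j
      have h0 : siteSign j = 0 := by omega
      simp [h0] at this
    simp only [triple, Pi.add_apply, Pi.single_apply, if_neg hne]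
    split_ifs <;> rfl
  refine 𝓔.weyl.commute_of_form (triple 1 0 1 j i - triple 1 0 1 j (i + 2)) ?_
  have h2 : siteSign (i + 2) = siteSign j := by
    rw [← h, show i + 2 = i + 1 + 1 by ring, siteSign_add_one, siteSign_add_one, neg_neg]
  rw [intForm_spin, key _ h, key _ h2]; push_cast; ring

lemma spin_sq (i : ZMod (2 * N)) : 𝓔.spin i ^ 2 = 1 := by
  rw [spin, ← zpow_natCast, ← WeylSystem.T_zsmul, ← 𝓔.weyl_relation i]
  congr 1
  simp only [triple, smul_add, ← Pi.single_smul]; rfl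

/-- The clock vector at `i - 1` is a trivial relation vector plus twice the one at `i`. The cocycle
is a difference of multiples of 4, hence trivial. -/
lemma clock_sq (i : ZMod (2 * N)) : 𝓔.clock i ^ 2 = 𝓔.clock (i - 1) := by
  have e : triple 4 (-2) 0 (i - 1) = triple 4 (-10) 4 (i - 1) + (2 : ℤ) • triple 4 (-2) 0 i := by
    funext k
    have h1 : i - 1 + 2 = i + 1 := by ring
    simp only [triple, sub_add_cancel, h1, Pi.add_apply, Pi.smul_apply, Pi.single_apply]
    split_ifs <;> rfl
  rw [clock, clock, e, WeylSystem.T_add, weyl_relation, one_mul, intForm_relation,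
    WeylSystem.T_zsmul]
  obtain ⟨m, hm⟩ := even_clock_apply i (i - 1)
  obtain ⟨n, hn⟩ := even_clock_apply i (i - 1 + 2)
  rw [phase_eq_one (2 * (n - m))]
  · rw [one_mul]; rfl
  · simp only [Pi.smul_apply, hm, hn]
    push_cast [smul_eq_mul]; ring

lemma clock_neg (n : ℕ) : 𝓔.clock (-(n : ZMod (2 * N))) = 𝓔.clock 0 ^ (2 ^ n) := by
  induction n with
  | zero => simp
  | succ n ih => rw [Nat.cast_succ, neg_add, ← sub_eq_add_neg, ← clock_sq, ih, ← pow_mul, pow_succ]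

/-- The alternating product of the `K_{-n}` is computed twice: as a power of the trivial operator of
the alternating vector, and, since `K_{-n} = K_0^{2^n}`, as `K_0` to the power `∑ (-2)^n = -Q`. -/
lemma clock_pow_clockOrder : 𝓔.clock 0 ^ clockOrder N = 1 := by
  have h := 𝓔.weyl.list_prod
    (fun n => siteSign ((n : ℕ) : ZMod (2 * N)) • triple 4 (-2) 0 (-(n : ZMod (2 * N)))) (2 * N)
  rw [sum_siteSign_smul_clock, WeylSystem.T_zsmul, weyl_siteSign, one_zpow, mul_one,
    phase_eq_one_of_mem] at h
  · have e : (fun n : ℕ => 𝓔.weyl.T (siteSign ((n : ℕ) : ZMod (2 * N)) •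
        triple 4 (-2) 0 (-(n : ZMod (2 * N))))) = fun n : ℕ => 𝓔.clock 0 ^ ((-2 : ℤ) ^ n) := by
      funext n
      rw [WeylSystem.T_zsmul, siteSign_natCast]
      change 𝓔.clock _ ^ _ = _
      rw [clock_neg, ← zpow_natCast, ← zpow_mul]
      congr 1
      push_cast
      rw [← mul_pow]; norm_num
    rw [e] at h
    have hp : ∀ m : ℕ, ((List.range m).map fun n : ℕ => 𝓔.clock 0 ^ ((-2 : ℤ) ^ n)).prod =
        𝓔.clock 0 ^ (∑ n ∈ Finset.range m, (-2 : ℤ) ^ n) := by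
      intro m
      induction m with
      | zero => simp
      | succ m ih =>
        rw [List.range_succ, List.map_append, List.prod_append, ih, List.map_singleton,
          List.prod_singleton, Finset.sum_range_succ, zpow_add]
    rw [hp, sum_neg_two_pow, zpow_neg, inv_eq_one, zpow_natCast] at h
    exact h
  · refine sum_mem fun q _ => sum_mem fun p _ => ?_
    obtain ⟨n, hn⟩ := intForm_clock_clock_int (-(q : ZMod (2 * N))) (-(p : ZMod (2 * N)))
    refine AddSubgroup.mem_zmultiples_iff.2
      ⟨-(siteSign (p : ZMod (2 * N)) * siteSign (q : ZMod (2 * N)) * n), ?_⟩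
    rw [intForm_smul_left, intForm_skew (fun a b => zInv_skew (N := N) a b) (siteSign _ • _),
      intForm_smul_left, hn, zsmul_eq_mul]
    push_cast; ring

lemma intForm_clock_single (i j : ZMod (2 * N)) :
    intForm (zInv 1 9 N) (triple 4 (-2) 0 i) (Pi.single j 1) =
      4 * zInv 1 9 N i j - 2 * zInv 1 9 N (i + 1) j := by
  rw [intForm_triple_left]
  simp only [Pi.single_apply, Int.cast_ite, Int.cast_one, Int.cast_zero, mul_ite, mul_one,
    mul_zero, Finset.sum_ite_eq', Finset.mem_univ, if_true]
  push_cast; ring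

/-- `B(k_0, e_2) = -1 / Q`. -/
lemma intForm_clock_two (hN : 2 ≤ N) :
    intForm (zInv 1 9 N) (triple 4 (-2) 0 0) (Pi.single 2 1) * clockOrder N = -1 := by
  set h : ZMod (2 * N) → ℝ := fun j => intForm (zInv 1 9 N) (triple 4 (-2) 0 0) (Pi.single j 1)
    with hh
  -- A first-order recursion in the second argument. Once around the cycle it reads `h 2 = 4^N * h 2
  -- + 3`: doubling everywhere, with `+1` on leaving `-1` and `-1` on leaving `1`. For `N ≥ 2` the
  -- sites `-1, 0, 1` are distinct.
  have step : ∀ j, h (j + 1) = 2 * h j + ((if j = -1 then 1 else 0) - if j = 1 then 1 else 0) := by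
    intro j
    have e := intForm_clock_step (-1 : ZMod (2 * N)) (Pi.single j 1)
    have e1 : intForm (zInv 1 9 N) (triple 4 (-2) 0 (-1)) (Pi.single j 1) = h (j + 1) := by
      rw [hh]
      simp only [intForm_clock_single]
      rw [zInv_add_one_add_one, ← zInv_add_one_add_one (-1) j, neg_add_cancel]
    have e2 : (-1 + 2 : ZMod (2 * N)) = 1 := by ring
    rw [e1, neg_add_cancel, e2] at e
    simp only [Pi.single_apply, eq_comm (b := j)] at e
    push_cast at e
    linarith
  have ne : ∀ a b : ℕ, a < 2 * N → b < 2 * N → a ≠ b → (a : ZMod (2 * N)) ≠ b := by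
    intro a b ha hb hab hc
    rw [ZMod.natCast_eq_natCast_iff', Nat.mod_eq_of_lt ha, Nat.mod_eq_of_lt hb] at hc
    exact hab hc
  have hm1 : (-1 : ZMod (2 * N)) = ((2 * N - 1 : ℕ) : ZMod (2 * N)) := by
    rw [Nat.cast_sub (by omega), ZMod.natCast_self]; simp
  have h1 : (1 : ZMod (2 * N)) = ((1 : ℕ) : ZMod (2 * N)) := by simp
  have h0 : (0 : ZMod (2 * N)) = ((0 : ℕ) : ZMod (2 * N)) := by simp
  have run : ∀ n : ℕ, n + 3 ≤ 2 * N → h ((2 + n : ℕ) : ZMod (2 * N)) = 2 ^ n * h 2 := by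
    intro n hn
    induction n with
    | zero => simp
    | succ n ih =>
      rw [← add_assoc, Nat.cast_succ, step, ih (by omega), hm1, h1,
        if_neg (ne _ _ (by omega) (by omega) (by omega)),
        if_neg (ne _ _ (by omega) (by omega) (by omega)), pow_succ]
      ring
  have r1 := run (2 * N - 3) (by omega)
  rw [show 2 + (2 * N - 3) = 2 * N - 1 by omega, ← hm1] at r1
  have r2 := step (-1)
  have r3 := step 0
  have r4 := step 1
  have n1 : (-1 : ZMod (2 * N)) ≠ 1 := by
    rw [hm1, h1]; exact ne _ _ (by omega) (by omega) (by omega)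
  have n2 : (0 : ZMod (2 * N)) ≠ -1 := by
    rw [hm1, h0]; exact ne _ _ (by omega) (by omega) (by omega)
  have n3 : (0 : ZMod (2 * N)) ≠ 1 := by
    rw [h1, h0]; exact ne _ _ (by omega) (by omega) (by omega)
  rw [if_pos rfl, if_neg n1, neg_add_cancel] at r2
  rw [if_neg n2, if_neg n3, zero_add] at r3
  rw [if_neg n1.symm, if_pos rfl, one_add_one_eq_two] at r4
  have hp : (8 : ℝ) * 2 ^ (2 * N - 3) = 4 ^ N := by
    rw [show (8 : ℝ) = 2 ^ 3 by norm_num, ← pow_add, show 3 + (2 * N - 3) = 2 * N by omega, pow_mul]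
    norm_num
  have hQ : (3 * clockOrder N + 1 : ℝ) = 4 ^ N := by exact_mod_cast three_mul_clockOrder_add_one N
  have hx : (4 ^ N : ℝ) * h 2 = 8 * (2 ^ (2 * N - 3) * h 2) := by rw [← hp]; ring
  rw [← r1, ← hQ] at hx
  change h 2 * _ = _
  linarith

end EdgeTheory

end Clock

/-! ### Multiplicities from vanishing traces -/

noncomputable section Multiplicity

section Character

variable {V : Type*} [AddCommGroup V] [Module ℂ V] [FiniteDimensional ℂ V]

/-- The group average projects onto the invariants, so its trace is their dimension; only the
identity contributes to it. -/
lemma card_mul_finrank_invariants {Γ : Type*} [Group Γ] [Fintype Γ] (ρ : Representation ℂ Γ V)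
    (h : ∀ g ≠ 1, LinearMap.trace ℂ V (ρ g) = 0) :
    Fintype.card Γ * Module.finrank ℂ ρ.invariants = Module.finrank ℂ V := by
  have hc : (Fintype.card Γ : ℂ) ≠ 0 := by exact_mod_cast Fintype.card_ne_zero
  let _ : Invertible (Fintype.card Γ : ℂ) := invertibleOfNonzero hc
  have h1 := (Representation.isProj_averageMap ρ).trace
  have h2 : ρ.averageMap = (Fintype.card Γ : ℂ)⁻¹ • ∑ g, ρ g := by
    simp [Representation.averageMap, GroupAlgebra.average, map_sum]
  rw [h2, map_smul, map_sum, Finset.sum_eq_single 1 (fun g _ hg => h g hg) (by simp), map_one,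
    LinearMap.trace_one, smul_eq_mul] at h1
  have h3 : (Fintype.card Γ : ℂ) * Module.finrank ℂ ρ.invariants = Module.finrank ℂ V := by
    rw [← h1]; field_simp
  exact_mod_cast h3

/-- Multiplicity of the common fixed space of commuting elements of finite order, when all the
nontrivial monomials in them have trace zero. -/
lemma finrank_common_fixed {G : Type*} [Group G] (e : G →* Module.End ℂ V) {Q N : ℕ} [NeZero Q]
    {κ : G} {s : Fin N → G} (hκs : ∀ j, Commute κ (s j)) (hss : ∀ i j, Commute (s i) (s j))
    (hκ : κ ^ Q = 1) (hs : ∀ j, s j ^ 2 = 1)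
    (htr : ∀ (q : ℕ) (x : Fin N → ℕ), q < Q → (∀ j, x j < 2) → ¬ (q = 0 ∧ ∀ j, x j = 0) →
      LinearMap.trace ℂ V (e (κ ^ q * ((List.finRange N).map fun j => s j ^ x j).prod)) = 0)
    (p : Submodule ℂ V) (hp : ∀ v, v ∈ p ↔ e κ v = v ∧ ∀ j, e (s j) v = v) :
    Q * 2 ^ N * Module.finrank ℂ p = Module.finrank ℂ V := by
  -- The homomorphism out of `ZMod Q × (Fin N → ZMod 2)` needs a commutative target; the subgroup
  -- generated by the commuting elements provides one.
  let A : Subgroup G := Subgroup.closure (insert κ (Set.range s))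
  have hA : IsMulCommutative A := Subgroup.isMulCommutative_closure (by
    rintro x (rfl | ⟨i, rfl⟩) y (rfl | ⟨j, rfl⟩)
    · rfl
    · exact hκs j
    · exact (hκs i).symm
    · exact hss i j)
  let _ : CommGroup A := { (inferInstance : Group A) with mul_comm := hA.is_comm.comm }
  let κ' : A := ⟨κ, Subgroup.subset_closure (Set.mem_insert _ _)⟩
  let s' : Fin N → A := fun j => ⟨s j, Subgroup.subset_closure (Set.mem_insert_of_mem _ ⟨j, rfl⟩)⟩
  have hκ' : κ' ^ Q = 1 := Subtype.ext hκ
  have hs' : ∀ j, s' j ^ 2 = 1 := fun j => Subtype.ext (hs j)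
  let f1 : ZMod Q →+ Additive A := ZMod.lift Q ⟨zmultiplesHom _ (Additive.ofMul κ'), by
    simpa using congrArg Additive.ofMul hκ'⟩
  let f2 : Fin N → ZMod 2 →+ Additive A := fun j =>
    ZMod.lift 2 ⟨zmultiplesHom _ (Additive.ofMul (s' j)), by
      simpa [← natCast_zsmul] using congrArg Additive.ofMul (hs' j)⟩
  let f : ZMod Q × (Fin N → ZMod 2) →+ Additive A :=
    { toFun := fun p => f1 p.1 + ∑ j, f2 j (p.2 j)
      map_zero' := by simp
      map_add' := fun a b => by
        simp only [Prod.fst_add, Prod.snd_add, Pi.add_apply, map_add, Finset.sum_add_distrib]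
        exact add_add_add_comm _ _ _ _ }
  let F : Multiplicative (ZMod Q × (Fin N → ZMod 2)) →* A := AddMonoidHom.toMultiplicativeLeft f
  let ρ : Representation ℂ (Multiplicative (ZMod Q × (Fin N → ZMod 2))) V :=
    e.comp (A.subtype.comp F)
  have hf1 : ∀ q : ZMod Q, f1 q = Additive.ofMul (κ' ^ q.val) := by
    intro q
    conv_lhs => rw [← ZMod.natCast_zmod_val q, ← Int.cast_natCast]
    simp only [f1]
    rw [ZMod.lift_coe, zmultiplesHom_apply, natCast_zsmul]; rfl
  have hf2 : ∀ j (x : ZMod 2), f2 j x = Additive.ofMul (s' j ^ x.val) := by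
    intro j x
    conv_lhs => rw [← ZMod.natCast_zmod_val x, ← Int.cast_natCast]
    simp only [f2]
    rw [ZMod.lift_coe, zmultiplesHom_apply, natCast_zsmul]; rfl
  have hF : ∀ (q : ZMod Q) (x : Fin N → ZMod 2), F (Multiplicative.ofAdd (q, x)) =
      κ' ^ q.val * ∏ j, s' j ^ (x j).val := by
    intro q x
    have : f (q, x) = f1 q + ∑ j, f2 j (x j) := rfl
    change (f (q, x)).toMul = _
    rw [this, hf1]
    simp only [hf2]
    rfl
  have hF' : ∀ (q : ZMod Q) (x : Fin N → ZMod 2), (F (Multiplicative.ofAdd (q, x)) : G) =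
      κ ^ q.val * ((List.finRange N).map fun j => s j ^ (x j).val).prod := by
    intro q x
    rw [hF, Subgroup.coe_mul, Subgroup.coe_pow, Fin.prod_univ_def, Subgroup.val_list_prod,
      List.map_map]
    rfl
  have hcard := card_mul_finrank_invariants ρ (by
    intro g hg
    obtain ⟨q, x⟩ := g
    change LinearMap.trace ℂ V (e (F (Multiplicative.ofAdd (q, x)) : G)) = 0
    rw [hF']
    refine htr _ _ (ZMod.val_lt q) (fun j => ZMod.val_lt (x j)) ?_
    rintro ⟨h1, h2⟩
    apply hg
    have hq : q = 0 := (ZMod.val_eq_zero q).1 h1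
    have hx : x = 0 := funext fun j => (ZMod.val_eq_zero (x j)).1 (h2 j)
    subst hq hx
    rfl)
  have hinv : ρ.invariants = p := by
    ext v
    rw [Representation.mem_invariants, hp]
    constructor
    · intro h
      refine ⟨?_, fun j => ?_⟩
      -- For `Q = 1` the residue of `1` is `0`; the exponent matters only modulo the order of `κ'`,
      -- which divides `Q`.
      · have h1 : (F (Multiplicative.ofAdd (((1 : ℕ) : ZMod Q), 0)) : G) = κ := by
          rw [hF]
          simp only [Pi.zero_apply, ZMod.val_zero, pow_zero, Finset.prod_const_one, mul_one,
            ZMod.val_natCast]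
          rw [← pow_mod_orderOf, Nat.mod_mod_of_dvd _ (orderOf_dvd_of_pow_eq_one hκ'),
            pow_mod_orderOf, pow_one]
        have := h (Multiplicative.ofAdd (((1 : ℕ) : ZMod Q), 0))
        change e (F _ : G) v = v at this
        rwa [h1] at this
      · have h1 : (F (Multiplicative.ofAdd ((0 : ZMod Q), Pi.single j 1)) : G) = s j := by
          rw [hF, ZMod.val_zero, pow_zero, one_mul, Finset.prod_eq_single j]
          · rw [Pi.single_eq_same]; simp [s', ZMod.val_one]
          · intro b _ hb; simp [hb]
          · simp
        have := h (Multiplicative.ofAdd ((0 : ZMod Q), Pi.single j 1))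
        change e (F _ : G) v = v at this
        rwa [h1] at this
    · rintro ⟨h1, h2⟩ ⟨q, x⟩
      change e (F (Multiplicative.ofAdd (q, x)) : G) v = v
      rw [hF']
      have pw : ∀ {X : Module.End ℂ V} (_ : X v = v) (n : ℕ), (X ^ n) v = v := by
        intro X hX n
        induction n with
        | zero => rfl
        | succ n ih => rw [pow_succ, Module.End.mul_apply, hX, ih]
      have hl : ∀ l : List (Fin N), e ((l.map fun j => s j ^ (x j).val).prod) v = v := by
        intro l
        induction l with
        | nil => simp
        | cons a l ih =>
          rw [List.map_cons, List.prod_cons, map_mul, Module.End.mul_apply, ih, map_pow, pw (h2 a)]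
      rw [map_mul, Module.End.mul_apply, hl, map_pow, pw h1]
  rw [hinv] at hcard
  rw [← hcard]
  simp [ZMod.card]

end Character

end Multiplicity

/-! ### Traces of the monomials and dimension of the joint eigenspaces -/

noncomputable section JointEigenspaces

/-! Indicator vectors of the odd and even impurities. -/

section Parity

variable {N : ℕ} [NeZero N]

/-- The indicator vector of the odd impurities. -/
def oddVec (N : ℕ) : ZMod (2 * N) → ℤ :=
  ∑ j ∈ Finset.range N, Pi.single ((2 * j + 1 : ℕ) : ZMod (2 * N)) 1

/-- The indicator vector of the even impurities. -/
def evenVec (N : ℕ) : ZMod (2 * N) → ℤ :=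
  ∑ j ∈ Finset.range N, Pi.single ((2 * j + 2 : ℕ) : ZMod (2 * N)) 1

lemma sum_range_two_mul {M : Type*} [AddCommMonoid M] (f : ℕ → M) (n : ℕ) :
    ∑ l ∈ Finset.range (2 * n), f l =
      ∑ j ∈ Finset.range n, f (2 * j) + ∑ j ∈ Finset.range n, f (2 * j + 1) := by
  induction n with
  | zero => simp
  | succ n ih =>
    rw [mul_add, mul_one, Finset.sum_range_succ, Finset.sum_range_succ, ih,
      Finset.sum_range_succ, Finset.sum_range_succ]
    abel

lemma oddVec_add_evenVec : oddVec N + evenVec N = 1 := by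
  have h := sum_single_zmod (N := N) 1
  rw [sum_range_two_mul] at h
  exact h

lemma evenVec_sub_oddVec : evenVec N - oddVec N = siteSign := by
  have h := sum_single_zmod (N := N) siteSign
  rw [sum_range_two_mul] at h
  rw [← h, oddVec, evenVec, sub_eq_add_neg, ← Finset.sum_neg_distrib, add_comm]
  congr 1 <;> refine Finset.sum_congr rfl fun j _ => ?_
  · rw [siteSign_natCast, ← Pi.single_neg, pow_succ, pow_mul]; simp
  · rw [siteSign_natCast, show 2 * j + 1 + 1 = 2 * (j + 1) by ring, pow_mul]; simp

lemma sum_single_add_three :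
    ∑ j ∈ Finset.range N, (Pi.single ((2 * j + 3 : ℕ) : ZMod (2 * N)) 1 : ZMod (2 * N) → ℤ)
      = oddVec N := by
  have h := Finset.sum_range_sub
    (fun j : ℕ => (Pi.single ((2 * j + 1 : ℕ) : ZMod (2 * N)) 1 : ZMod (2 * N) → ℤ)) N
  have e : ((2 * N + 1 : ℕ) : ZMod (2 * N)) = ((2 * 0 + 1 : ℕ) : ZMod (2 * N)) := by
    rw [Nat.cast_add, ZMod.natCast_self]; simp
  rw [e, sub_self, Finset.sum_sub_distrib, sub_eq_zero] at h
  exact h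

/-- The sum is four times the odd minus five times the even indicator. Modulo the two vectors with
trivial Weyl operator it is `evenVec N`, so the product of all `L_j` is a phase times `U_2 U_4 ⋯
U_{2N}`. -/
lemma sum_spin_vec :
    ∑ j ∈ Finset.range N, triple 2 (-5) 2 ((2 * j + 1 : ℕ) : ZMod (2 * N)) =
      evenVec N - 1 - (5 : ℤ) • siteSign := by
  have h : ∀ j : ℕ, triple 2 (-5) 2 ((2 * j + 1 : ℕ) : ZMod (2 * N)) =
      (2 : ℤ) • Pi.single ((2 * j + 1 : ℕ) : ZMod (2 * N)) 1 +
      (-5 : ℤ) • Pi.single ((2 * j + 2 : ℕ) : ZMod (2 * N)) 1 +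
      (2 : ℤ) • Pi.single ((2 * j + 3 : ℕ) : ZMod (2 * N)) 1 := by
    intro j
    have e1 : ((2 * j + 2 : ℕ) : ZMod (2 * N)) = ((2 * j + 1 : ℕ) : ZMod (2 * N)) + 1 := by
      push_cast; ring
    have e2 : ((2 * j + 3 : ℕ) : ZMod (2 * N)) = ((2 * j + 1 : ℕ) : ZMod (2 * N)) + 2 := by
      push_cast; ring
    rw [e1, e2, triple]
    simp only [← Pi.single_smul, smul_eq_mul, mul_one]
  simp only [h, Finset.sum_add_distrib, ← Finset.smul_sum]
  rw [sum_single_add_three, ← evenVec_sub_oddVec, ← oddVec_add_evenVec, ← oddVec, ← evenVec]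
  module

end Parity

variable {N : ℕ} [NeZero N] {V : Type*} [NormedAddCommGroup V] [InnerProductSpace ℂ V]
  [FiniteDimensional ℂ V]

lemma smul_eq_iff_of_mul_eq_one {a b : ℂ} (h : a * b = 1) {x v : V} : a • x = v ↔ x = b • v := by
  constructor
  · rintro rfl
    rw [smul_smul, mul_comm, h, one_smul]
  · rintro rfl
    rw [smul_smul, h, one_smul]

lemma trace_phase_mul (t : ℝ) {g : unitary (Module.End ℂ V)}
    (h : LinearMap.trace ℂ V (g : Module.End ℂ V) = 0) :
    LinearMap.trace ℂ V (((phase V).toFun t * g : unitary (Module.End ℂ V)) : Module.End ℂ V) = 0 := by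
  rw [coe_phase_mul, map_smul, h, smul_zero]

/-- Conjugation by `S.T b` preserves the trace but multiplies `S.T a` by `e^{2πi B(a,b)} ≠ 1`. -/
lemma WeylSystem.trace_eq_zero {W : ZMod (2 * N) → ZMod (2 * N) → ℝ}
    (S : WeylSystem (phase V) W) {a b : ZMod (2 * N) → ℤ} (h : ∀ n : ℤ, intForm W a b ≠ n) :
    LinearMap.trace ℂ V (S.T a : Module.End ℂ V) = 0 := by
  have h1 : S.T a = (phase V).toFun (2 * intForm W a b) * (S.T b * S.T a * (S.T b)⁻¹) := by
    rw [← mul_assoc, ← S.mul_comm_phase, mul_inv_cancel_right]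
  have h2 := congrArg (fun g : unitary (Module.End ℂ V) =>
    LinearMap.trace ℂ V (g : Module.End ℂ V)) h1
  simp only [coe_phase_mul, map_smul, smul_eq_mul] at h2
  have h3 : LinearMap.trace ℂ V ((S.T b * S.T a * (S.T b)⁻¹ : unitary (Module.End ℂ V)) :
      Module.End ℂ V) = LinearMap.trace ℂ V (S.T a : Module.End ℂ V) := by
    rw [Submonoid.coe_mul, LinearMap.trace_mul_comm, ← Submonoid.coe_mul, ← mul_assoc,
      inv_mul_cancel, one_mul]
  rw [h3] at h2
  by_contra h0
  have h4 : exp (Real.pi * ((2 * intForm W a b : ℝ) : ℂ) * I) = 1 :=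
    mul_right_cancel₀ h0 (by rw [one_mul]; exact h2.symm)
  obtain ⟨n, hn⟩ := Complex.exp_eq_one_iff.1 h4
  apply h n
  have h5 : (2 * Real.pi * I : ℂ) ≠ 0 := Complex.two_pi_I_ne_zero
  have h6 : ((intForm W a b : ℝ) : ℂ) = n := by
    apply mul_right_cancel₀ h5
    rw [← hn]; push_cast; ring
  exact_mod_cast h6

lemma WeylSystem.list_prod_map {W : ZMod (2 * N) → ZMod (2 * N) → ℝ}
    (S : WeylSystem (phase V) W) {κ : Type*} (v : κ → ZMod (2 * N) → ℤ) (c : κ → ℝ) (x : κ → ℕ)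
    (l : List κ) :
    ∃ t : ℝ, (l.map fun j => ((phase V).toFun (c j) * S.T (v j)) ^ x j).prod =
      (phase V).toFun t * S.T ((l.map fun j => (x j : ℤ) • v j).sum) := by
  induction l with
  | nil => exact ⟨0, by simp [S.T_zero, (phase V).map_zero]⟩
  | cons a l ih =>
    obtain ⟨t, ht⟩ := ih
    have h1 := (phase V).zpow_eq (rfl : _ = (phase V).toFun (c a) * S.T (v a)) (x a)
    rw [← S.T_zsmul, zpow_natCast] at h1
    rw [List.map_cons, List.prod_cons, List.map_cons, List.sum_cons]
    exact ⟨_, (phase V).trans_eq ((phase V).mul_eq h1 ht) (S.mul _ _)⟩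

namespace EdgeTheory

variable (𝓔 : EdgeTheory 1 9 N V)

lemma trace_evenVec : LinearMap.trace ℂ V (𝓔.weyl.T (evenVec N) : Module.End ℂ V) = 0 := by
  have h := 𝓔.list_prod_U (fun l => ((2 * (l + 1) : ℕ) : ZMod (2 * N))) (fun _ => 1) N
  simp only [zpow_one] at h
  have e : 𝓔.weyl.T (evenVec N) = _ := (phase V).symm_eq h
  rw [e]
  exact trace_phase_mul _ 𝓔.trace_prod_even

/-- Three cases. If `q = 0` and all `x j` agree, they equal 1 and the monomial is a phase times `U_2
U_4 ⋯ U_{2N}`, traceless by assumption. If `q = 0` and `x` jumps somewhere, an odd impurity detects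
the jump with a half-integer form. If `q ≠ 0`, impurity 2 detects `-q / Q`. -/
lemma trace_clock_spin {q : ℕ} {x : Fin N → ℕ} (hq : q < clockOrder N) (hx : ∀ j, x j < 2)
    (h : ¬ (q = 0 ∧ ∀ j, x j = 0)) :
    LinearMap.trace ℂ V (𝓔.weyl.T ((q : ℤ) • triple 4 (-2) 0 0 +
      ∑ j, (x j : ℤ) • triple 2 (-5) 2 ((2 * (j : ℕ) + 1 : ℕ) : ZMod (2 * N))) : Module.End ℂ V)
      = 0 := by
  have hodd : ∀ j : ℕ, siteSign ((2 * j + 1 : ℕ) : ZMod (2 * N)) = -1 := by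
    intro j; rw [siteSign_natCast, pow_succ, pow_mul]; simp
  have hform : ∀ b : ZMod (2 * N) → ℤ, intForm (zInv 1 9 N)
      ((q : ℤ) • triple 4 (-2) 0 0 +
        ∑ j, (x j : ℤ) • triple 2 (-5) 2 ((2 * (j : ℕ) + 1 : ℕ) : ZMod (2 * N))) b =
      q * intForm (zInv 1 9 N) (triple 4 (-2) 0 0) b +
      ∑ j : Fin N, (x j : ℝ) * (((b ((2 * (j : ℕ) + 1 : ℕ) : ZMod (2 * N)) : ℝ) -
        (b ((2 * (j : ℕ) + 3 : ℕ) : ZMod (2 * N)) : ℝ)) / 2) := by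
    intro b
    rw [intForm_add_left, intForm_smul_left, intForm_sum_left]
    simp only [intForm_smul_left, intForm_spin]
    push_cast
    congr 1
    refine Finset.sum_congr rfl fun j _ => ?_
    rw [show (2 * (j : ℕ) + 1 + 2 : ZMod (2 * N)) = 2 * (j : ℕ) + 3 by ring]
  by_cases hq0 : q = 0
  · subst hq0
    by_cases hconst : ∀ j : ℕ, ∀ hj : j + 1 < N, x ⟨j + 1, hj⟩ = x ⟨j, by omega⟩
    · have hN : 0 < N := Nat.pos_of_ne_zero (NeZero.ne N)
      have hall : ∀ j : ℕ, ∀ hj : j < N, x ⟨j, hj⟩ = x ⟨0, hN⟩ := by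
        intro j
        induction j with
        | zero => intro _; rfl
        | succ j ih => intro hj; rw [hconst j hj, ih]
      have h1 : x ⟨0, hN⟩ = 1 := by
        have := hx ⟨0, hN⟩
        have h0 : x ⟨0, hN⟩ ≠ 0 := fun h0 => h ⟨rfl, fun j => by rw [← h0]; exact hall j j.2⟩
        omega
      have e : ∑ j : Fin N, (x j : ℤ) • triple 2 (-5) 2 ((2 * (j : ℕ) + 1 : ℕ) : ZMod (2 * N)) =
          -1 + ((-5 : ℤ) • siteSign + evenVec N) := by
        rw [Finset.sum_congr rfl fun j _ => by rw [hall j j.2, h1, Nat.cast_one, one_smul],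
          Fin.sum_univ_eq_sum_range fun j => triple 2 (-5) 2 ((2 * j + 1 : ℕ) : ZMod (2 * N)),
          sum_spin_vec]
        module
      rw [Nat.cast_zero, zero_smul, zero_add, e, WeylSystem.T_add, WeylSystem.T_neg, weyl_one,
        inv_one, one_mul, WeylSystem.T_add, WeylSystem.T_zsmul, weyl_siteSign, one_zpow, one_mul]
      exact trace_phase_mul _ (trace_phase_mul _ 𝓔.trace_evenVec)
    · push Not at hconst
      obtain ⟨j, hj, hne⟩ := hconst
      -- Site `2j + 3` is shared by the spin vectors number `j` and `j + 1`, so the form there is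
      -- half of `x_{j+1} - x_j = ±1`.
      refine 𝓔.weyl.trace_eq_zero (b := Pi.single ((2 * j + 3 : ℕ) : ZMod (2 * N)) 1) fun n => ?_
      have site : ∀ a b : ℕ, a < 2 * N → b < 2 * N →
          ((a : ZMod (2 * N)) = b ↔ a = b) := by
        intro a b ha hb
        rw [ZMod.natCast_eq_natCast_iff', Nat.mod_eq_of_lt ha, Nat.mod_eq_of_lt hb]
      have s1 : ∀ k : Fin N, (((2 * (k : ℕ) + 1 : ℕ) : ZMod (2 * N)) = ((2 * j + 3 : ℕ) : ZMod (2 * N))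
          ↔ k = ⟨j + 1, hj⟩) := by
        intro k
        rw [site _ _ (by omega) (by omega), Fin.ext_iff]
        constructor <;> intro _ <;> simp only at * <;> omega
      have s2 : ∀ k : Fin N, (((2 * (k : ℕ) + 3 : ℕ) : ZMod (2 * N)) = ((2 * j + 3 : ℕ) : ZMod (2 * N))
          ↔ k = ⟨j, by omega⟩) := by
        intro k
        have : ((2 * (k : ℕ) + 3 : ℕ) : ZMod (2 * N)) = ((2 * j + 3 : ℕ) : ZMod (2 * N)) ↔
            ((2 * (k : ℕ) + 1 : ℕ) : ZMod (2 * N)) = ((2 * j + 1 : ℕ) : ZMod (2 * N)) := by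
          rw [show 2 * (k : ℕ) + 3 = 2 * k + 1 + 2 by ring, show 2 * j + 3 = 2 * j + 1 + 2 by ring,
            Nat.cast_add, Nat.cast_add (2 * j + 1), add_left_inj]
        rw [this, site _ _ (by omega) (by omega), Fin.ext_iff]
        constructor <;> intro _ <;> simp only at * <;> omega
      rw [hform, Nat.cast_zero, zero_mul, zero_add]
      simp only [Pi.single_apply, s1, s2, Int.cast_ite, Int.cast_one, Int.cast_zero, sub_div,
        mul_sub, Finset.sum_sub_distrib, ite_div, zero_div, mul_ite, mul_zero, Finset.sum_ite_eq',
        Finset.mem_univ, if_true]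
      intro hn
      have hn' : ((x ⟨j + 1, hj⟩ : ℤ) - x ⟨j, by omega⟩ : ℝ) = 2 * n := by
        push_cast; linarith
      have hn'' : (x ⟨j + 1, hj⟩ : ℤ) - x ⟨j, by omega⟩ = 2 * n := by exact_mod_cast hn'
      have := hx ⟨j + 1, hj⟩
      have := hx ⟨j, by omega⟩
      omega
  · have hN : 2 ≤ N := by
      by_contra hlt
      have hN1 : N = 1 := by have := NeZero.ne N; omega
      have : clockOrder 1 = 1 := by decide
      rw [hN1, this] at hq
      omega
    -- Site 2 is even, so the spin vectors, based at odd sites, do not see it.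
    refine 𝓔.weyl.trace_eq_zero (b := Pi.single 2 1) fun n hn => ?_
    have hz : ∀ k : ZMod (2 * N), siteSign k = -1 → (Pi.single 2 1 : ZMod (2 * N) → ℤ) k = 0 := by
      intro k hk
      refine Pi.single_eq_of_ne ?_ _
      rintro rfl
      have := siteSign_natCast (N := N) 2
      rw [Nat.cast_ofNat, hk] at this
      norm_num at this
    rw [hform, Finset.sum_eq_zero, add_zero] at hn
    · have hQ := intForm_clock_two hN
      have e : (q : ℝ) = -(n * clockOrder N) := by
        rw [← hn]; linear_combination (q : ℝ) * hQ
      have e' : (q : ℤ) = -(n * clockOrder N) := by exact_mod_cast e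
      have hdvd : (clockOrder N : ℤ) ∣ q := ⟨-n, by rw [e']; ring⟩
      exact hq0 (Nat.eq_zero_of_dvd_of_lt (by exact_mod_cast hdvd) hq)
    · intro j _
      rw [hz _ (hodd j), hz _ (by
        rw [show 2 * (j : ℕ) + 3 = 2 * (j + 1) + 1 by ring]; exact hodd (j + 1))]
      simp

lemma finrank_eq_two_pow_mul (𝓔 : EdgeTheory 1 9 N V) : Module.finrank ℂ V = clockOrder N * 2 ^ N := by
  have h := 𝓔.finrank_eq
  have hs : √(((1 : ℕ) : ℝ) * ((9 : ℕ) : ℝ)) = 3 := by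
    rw [show ((1 : ℕ) : ℝ) * ((9 : ℕ) : ℝ) = 3 ^ 2 by norm_num]
    exact Real.sqrt_sq (by norm_num)
  have h8 : (8 : ℝ) ^ N = 4 ^ N * 2 ^ N := by rw [← mul_pow]; norm_num
  have hQ : (3 * clockOrder N + 1 : ℝ) = 4 ^ N := by exact_mod_cast three_mul_clockOrder_add_one N
  rw [degeneracy, hs] at h
  norm_num at h
  rw [h8, ← hQ] at h
  have : (Module.finrank ℂ V : ℝ) = clockOrder N * 2 ^ N := by rw [h]; ring
  exact_mod_cast this

lemma K_eq_clock (i : ZMod (2 * N)) : 𝓔.K i = (𝓔.clock i : Module.End ℂ V) := 𝓔.K_eq i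

lemma L_eq_spin (j : Fin N) :
    𝓔.L j = (𝓔.spin ((2 * (j : ℕ) + 1 : ℕ) : ZMod (2 * N)) : Module.End ℂ V) := 𝓔.L_eq j

lemma mem_jointEigenspace (m : ℕ) (σ : Fin N → ℤˣ) (v : V) :
    v ∈ 𝓔.jointEigenspace m σ ↔
      (𝓔.clock 0 : Module.End ℂ V) v = exp (2 * Real.pi * I * m / clockOrder N) • v ∧
      ∀ j : Fin N, (𝓔.spin ((2 * (j : ℕ) + 1 : ℕ) : ZMod (2 * N)) : Module.End ℂ V) v =
        (((σ j : ℤˣ) : ℤ) : ℂ) • v := by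
  rw [jointEigenspace, Submodule.mem_inf, Submodule.mem_iInf]
  simp only [Module.End.mem_eigenspace_iff, K_eq_clock, L_eq_spin, ZMod.natCast_self]

/-- Dividing `K_{2N}` and the `L_j` by the wanted eigenvalues turns the joint eigenspace into a
common fixed space. Orders and vanishing traces survive the rescaling, and `Q 2^N` is the whole
dimension. -/
theorem finrank_jointEigenspace (m : ℕ) (σ : Fin N → ℤˣ) :
    Module.finrank ℂ (𝓔.jointEigenspace m σ) = 1 := by
  have hQ : 0 < clockOrder N := clockOrder_pos
  have hQ' : (clockOrder N : ℝ) ≠ 0 := by exact_mod_cast hQ.ne'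
  have : NeZero (clockOrder N) := ⟨hQ.ne'⟩
  -- `e^{iπ c_j} = σ_j`, its own inverse.
  let c : Fin N → ℝ := fun j => if σ j = 1 then 0 else 1
  let site : Fin N → ZMod (2 * N) := fun j => ((2 * (j : ℕ) + 1 : ℕ) : ZMod (2 * N))
  let κ : unitary (Module.End ℂ V) := (phase V).toFun (-(2 * m / clockOrder N)) * 𝓔.clock 0
  let s : Fin N → unitary (Module.End ℂ V) := fun j => (phase V).toFun (c j) * 𝓔.spin (site j)
  have hsign : ∀ i j : Fin N, siteSign (site i) = siteSign (site j) := by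
    intro i j
    simp only [site, siteSign_natCast, pow_succ, pow_mul]; simp
  have hcomm : ∀ {a b : unitary (Module.End ℂ V)} (u t : ℝ), Commute a b →
      Commute ((phase V).toFun u * a) ((phase V).toFun t * b) := by
    intro a b u t hab
    have hz : ∀ u g, Commute ((phase V).toFun u) g := fun u g => (phase V).comm u g
    exact ((hz u _).mul_left (((hz t _).symm).mul_right hab))
  have key := finrank_common_fixed (unitary (Module.End ℂ V)).subtype (Q := clockOrder N) (κ := κ)
    (s := s) (fun j => hcomm _ _ (𝓔.spin_commute_clock _ _).symm)
    (fun i j => hcomm _ _ (𝓔.spin_commute_spin (hsign i j))) ?_ ?_ ?_ (𝓔.jointEigenspace m σ) ?_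
  · rw [𝓔.finrank_eq_two_pow_mul] at key
    exact Nat.eq_of_mul_eq_mul_left (by positivity) (key.trans (mul_one _).symm)
  · have h1 := (phase V).zpow_eq (rfl : _ = (phase V).toFun (-(2 * m / clockOrder N)) * 𝓔.clock 0)
      (clockOrder N)
    rw [zpow_natCast, zpow_natCast, clock_pow_clockOrder, mul_one] at h1
    exact h1.trans (phase_eq_one (-m) (by push_cast; field_simp))
  · intro j
    have h1 := (phase V).zpow_eq (rfl : _ = (phase V).toFun (c j) * 𝓔.spin (site j)) (2 : ℕ)
    rw [zpow_natCast, zpow_natCast, spin_sq, mul_one] at h1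
    simp only [s]
    rw [h1]
    by_cases hj : σ j = 1
    · exact phase_eq_one 0 (by simp [c, hj])
    · exact phase_eq_one 1 (by simp [c, hj])
  · intro q x hq hx h
    obtain ⟨t, ht⟩ := 𝓔.weyl.list_prod_map (fun j => triple 2 (-5) 2 (site j)) c x (List.finRange N)
    have h1 := (phase V).zpow_eq (rfl : κ = (phase V).toFun (-(2 * m / clockOrder N)) * 𝓔.clock 0) q
    rw [clock, ← WeylSystem.T_zsmul, zpow_natCast] at h1
    have h2 := (phase V).trans_eq ((phase V).mul_eq h1 ht) (𝓔.weyl.mul _ _)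
    rw [← Fin.sum_univ_def] at h2
    change LinearMap.trace ℂ V ((κ ^ q * _ : unitary (Module.End ℂ V)) : Module.End ℂ V) = 0
    simp only [s, spin]
    rw [h2]
    exact trace_phase_mul _ (𝓔.trace_clock_spin hq hx h)
  · intro v
    rw [mem_jointEigenspace]
    simp only [κ, s, Submonoid.subtype_apply, coe_phase_mul, LinearMap.smul_apply]
    refine and_congr ?_ (forall_congr' fun j => ?_)
    · have e1 : exp (Real.pi * ((-(2 * m / clockOrder N) : ℝ) : ℂ) * I) *
          exp (2 * Real.pi * I * m / clockOrder N) = 1 := by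
        rw [← Complex.exp_add, ← Complex.exp_zero]
        congr 1; push_cast; ring
      exact (smul_eq_iff_of_mul_eq_one (V := V) e1).symm
    · refine (smul_eq_iff_of_mul_eq_one (V := V) ?_).symm
      rcases Int.units_eq_one_or (σ j) with hj | hj
      · simp [c, hj]
      · simp [c, hj, show (-1 : ℤˣ) ≠ 1 by decide, Complex.exp_pi_mul_I]

end EdgeTheory

end JointEigenspaces

/-! ### Orthonormal eigenbasis and diagonalization of the Hamiltonian -/

noncomputable section Spectrum

section Unitary

variable {V : Type*} [NormedAddCommGroup V] [InnerProductSpace ℂ V] [FiniteDimensional ℂ V]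

lemma unitary_inner (X : unitary (Module.End ℂ V)) (v w : V) :
    inner ℂ ((X : Module.End ℂ V) v) ((X : Module.End ℂ V) w) = inner ℂ v w := by
  rw [← LinearMap.adjoint_inner_right, ← LinearMap.star_eq_adjoint, ← Module.End.mul_apply,
    Unitary.coe_star_mul_self, Module.End.one_apply]

lemma inner_eq_zero_of_unitary (X : unitary (Module.End ℂ V)) {v w : V} {a b : ℂ}
    (ha : star a * a = 1) (hab : a ≠ b) (hv : (X : Module.End ℂ V) v = a • v)
    (hw : (X : Module.End ℂ V) w = b • w) : inner ℂ v w = 0 := by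
  have h := unitary_inner X v w
  rw [hv, hw, inner_smul_left, inner_smul_right] at h
  by_contra h0
  have h1 : star a * b = 1 := mul_right_cancel₀ h0 (by rw [one_mul, mul_assoc]; exact h)
  have h2 : star a ≠ 0 := fun h => by rw [h, zero_mul] at ha; exact zero_ne_one ha
  exact hab (mul_left_cancel₀ h2 (ha.trans h1.symm))

lemma add_star_apply (X : unitary (Module.End ℂ V)) {v : V} {a : ℂ} (ha : star a * a = 1)
    (hv : (X : Module.End ℂ V) v = a • v) :
    ((X : Module.End ℂ V) + star (X : Module.End ℂ V)) v = (a + star a) • v := by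
  have h1 : star (X : Module.End ℂ V) ((X : Module.End ℂ V) v) = v := by
    rw [← Module.End.mul_apply, Unitary.coe_star_mul_self, Module.End.one_apply]
  have h2 : star (X : Module.End ℂ V) v = star a • v := by
    calc star (X : Module.End ℂ V) v = (star a * a) • star (X : Module.End ℂ V) v := by
          rw [ha, one_smul]
      _ = star a • star (X : Module.End ℂ V) (a • v) := by rw [map_smul, smul_smul]
      _ = star a • v := by rw [← hv, h1]
  rw [LinearMap.add_apply, hv, h2, add_smul]

lemma repr_apply_of_eigenbasis {κ : Type*} [Fintype κ] (b : OrthonormalBasis κ ℂ V)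
    {T : Module.End ℂ V} {E : κ → ℂ} (h : ∀ i, T (b i) = E i • b i) (v : V) (i : κ) :
    b.repr (T v) i = E i * b.repr v i := by
  classical
  have hv : T v = ∑ j, (E j * b.repr v j) • b j := by
    conv_lhs => rw [← b.sum_repr v]
    rw [map_sum]
    exact Finset.sum_congr rfl fun j _ => by rw [map_smul, h, smul_smul, mul_comm]
  rw [hv, map_sum, WithLp.ofLp_sum, Finset.sum_apply, Finset.sum_eq_single i]
  · simp
  · intro j _ hj
    simp [b.repr_self, hj.symm]
  · simp

lemma hasEigenvalue_iff_of_eigenbasis {κ : Type*} [Fintype κ] (b : OrthonormalBasis κ ℂ V)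
    {T : Module.End ℂ V} {E : κ → ℂ} (h : ∀ i, T (b i) = E i • b i) (μ : ℂ) :
    T.HasEigenvalue μ ↔ ∃ i, μ = E i := by
  constructor
  · intro hμ
    obtain ⟨v, hv⟩ := hμ.exists_hasEigenvector
    by_contra! hne
    apply hv.2
    apply b.repr.injective
    rw [map_zero]
    ext i
    have h1 := repr_apply_of_eigenbasis b h v i
    rw [hv.apply_eq_smul, map_smul] at h1
    have h2 : (μ - E i) * b.repr v i = 0 := by
      rw [sub_mul, ← h1]; simp
    exact (mul_eq_zero.1 h2).resolve_left (sub_ne_zero.2 (hne i))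
  · rintro ⟨i, rfl⟩
    refine Module.End.hasEigenvalue_of_hasEigenvector (x := b i) ⟨?_, ?_⟩
    · exact Module.End.mem_eigenspace_iff.2 (h i)
    · exact b.orthonormal.ne_zero i

lemma eigenspace_le_span_of_eigenbasis {κ : Type*} [Fintype κ] (b : OrthonormalBasis κ ℂ V)
    {T : Module.End ℂ V} {E : κ → ℂ} (h : ∀ i, T (b i) = E i • b i) {k : κ}
    (hk : ∀ i, i ≠ k → E i ≠ E k) {v : V} (hv : T v = E k • v) : v = b.repr v k • b k := by
  conv_lhs => rw [← b.sum_repr v]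
  refine Finset.sum_eq_single k (fun i _ hi => ?_) (by simp)
  have h1 := repr_apply_of_eigenbasis b h v i
  rw [hv, map_smul] at h1
  have h2 : (E k - E i) * b.repr v i = 0 := by
    rw [sub_mul, ← h1]; simp
  rw [(mul_eq_zero.1 h2).resolve_left (sub_ne_zero.2 (hk i hi).symm), zero_smul]

end Unitary

namespace EdgeTheory

variable {N : ℕ} [NeZero N] {V : Type*} [NormedAddCommGroup V] [InnerProductSpace ℂ V]
  [FiniteDimensional ℂ V] (𝓔 : EdgeTheory 1 9 N V)

lemma star_exp_mul_self (θ : ℝ) : star (exp (I * θ)) * exp (I * θ) = 1 := by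
  rw [Complex.star_def, ← Complex.exp_conj, ← Complex.exp_add]
  simp

lemma clock_apply {m : ℕ} {σ : Fin N → ℤˣ} {v : V} (hv : v ∈ 𝓔.jointEigenspace m σ) (n : ℕ) :
    (𝓔.clock (-(n : ZMod (2 * N))) : Module.End ℂ V) v =
      exp (I * ((2 ^ n * (2 * Real.pi * m) / clockOrder N : ℝ) : ℂ)) • v := by
  obtain ⟨h, -⟩ := (𝓔.mem_jointEigenspace m σ v).1 hv
  have hp : ∀ k : ℕ, ((𝓔.clock 0 : Module.End ℂ V) ^ k) v =
      exp (2 * Real.pi * I * m / clockOrder N) ^ k • v := by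
    intro k
    induction k with
    | zero => simp
    | succ k ih => rw [pow_succ', Module.End.mul_apply, ih, map_smul, h, smul_smul, pow_succ]
  rw [clock_neg, SubmonoidClass.coe_pow, hp, ← Complex.exp_nat_mul]
  congr 2; push_cast; ring

lemma H_apply {m : ℕ} {σ : Fin N → ℤˣ} {v : V} (hv : v ∈ 𝓔.jointEigenspace m σ) :
    𝓔.H v = (energy N m σ : ℂ) • v := by
  have h1 : ∀ n : ℕ, (𝓔.K (-(n : ZMod (2 * N))) + star (𝓔.K (-(n : ZMod (2 * N))))) v =
      (2 * Real.cos (2 ^ n * (2 * Real.pi * m) / clockOrder N) : ℂ) • v := by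
    intro n
    rw [K_eq_clock, add_star_apply _ (star_exp_mul_self _) (𝓔.clock_apply hv n)]
    congr 1
    rw [Complex.star_def, ← Complex.exp_conj, Complex.ofReal_cos, Complex.two_cos, map_mul,
      Complex.conj_I, Complex.conj_ofReal]
    congr 2 <;> ring
  have h2 : ∀ j : Fin N, (𝓔.L j + star (𝓔.L j)) v = (2 * ((σ j : ℤ) : ℂ)) • v := by
    intro j
    have hs : star (((σ j : ℤˣ) : ℤ) : ℂ) = ((σ j : ℤˣ) : ℤ) := by simp
    rw [L_eq_spin, add_star_apply _ _ (((𝓔.mem_jointEigenspace m σ v).1 hv).2 j), hs]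
    · congr 1; ring
    · rw [hs, ← Int.cast_mul, ← Units.val_mul, Int.units_mul_self]; simp
  have h3 : (∑ i, (𝓔.K i + star (𝓔.K i))) v = (∑ n ∈ Finset.range (2 * N),
      (2 * Real.cos (2 ^ n * (2 * Real.pi * m) / clockOrder N) : ℂ)) • v := by
    -- Sites are enumerated as `-n`, because the eigenvalue of `K_{-n}` is the `2^n`-th power of
    -- that of `K_{2N}`.
    rw [← Equiv.sum_comp (Equiv.neg (ZMod (2 * N)))]
    simp only [Equiv.neg_apply]
    rw [← sum_range_zmod fun i => 𝓔.K (-i) + star (𝓔.K (-i)), LinearMap.sum_apply, Finset.sum_smul]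
    exact Finset.sum_congr rfl fun n _ => h1 n
  have h4 : (∑ j, (𝓔.L j + star (𝓔.L j))) v = (∑ j : Fin N, (2 * ((σ j : ℤ) : ℂ))) • v := by
    rw [LinearMap.sum_apply, Finset.sum_smul]
    exact Finset.sum_congr rfl fun j _ => h2 j
  rw [H, LinearMap.sub_apply, LinearMap.neg_apply, LinearMap.smul_apply, LinearMap.smul_apply,
    h3, h4, smul_smul, smul_smul, ← neg_smul, ← sub_smul, energy]
  congr 1
  rw [← Finset.mul_sum, ← Finset.mul_sum]
  push_cast
  ring

lemma exp_ne_of_ne {Q m m' : ℕ} (hm : m < Q) (hm' : m' < Q) (h : m ≠ m') :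
    exp (2 * Real.pi * I * m / Q) ≠ exp (2 * Real.pi * I * m' / Q) := by
  intro he
  obtain ⟨n, hn⟩ := Complex.exp_eq_exp_iff_exists_int.1 he
  have hQ : (Q : ℂ) ≠ 0 := by
    have : Q ≠ 0 := by omega
    exact_mod_cast this
  have h2 : (m : ℂ) = m' + n * Q := by
    apply mul_left_cancel₀ Complex.two_pi_I_ne_zero
    field_simp at hn
    linear_combination (2 * Real.pi * I) * hn
  have h3 : (m : ℤ) = m' + n * Q := by exact_mod_cast h2
  have h4 : (m : ℤ) % Q = (m' : ℤ) % Q := by rw [h3, Int.add_mul_emod_self_right]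
  rw [Int.emod_eq_of_lt (by omega) (by omega), Int.emod_eq_of_lt (by omega) (by omega)] at h4
  exact h (by exact_mod_cast h4)

/-- Different labels differ in an eigenvalue of some unitary, so the unit vectors are orthogonal;
there are `Q 2^N` of them, the dimension of the space. -/
theorem exists_eigenbasis : ∃ b : OrthonormalBasis (Fin (clockOrder N) × (Fin N → ℤˣ)) ℂ V,
    ∀ (m : Fin (clockOrder N)) (σ : Fin N → ℤˣ), b (m, σ) ∈ 𝓔.jointEigenspace m σ := by
  have hex : ∀ p : Fin (clockOrder N) × (Fin N → ℤˣ),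
      ∃ v ∈ 𝓔.jointEigenspace p.1 p.2, ‖v‖ = 1 := by
    intro p
    obtain ⟨v, hv, h0⟩ := Submodule.exists_mem_ne_zero_of_ne_bot
      (p := 𝓔.jointEigenspace p.1 p.2) (fun hb => by
        have := 𝓔.finrank_jointEigenspace p.1 p.2
        rw [hb, finrank_bot] at this
        exact zero_ne_one this)
    exact ⟨((‖v‖⁻¹ : ℝ) : ℂ) • v, Submodule.smul_mem _ _ hv, by
      rw [norm_smul]; simp [h0]⟩
  choose u hu hn using hex
  have horth : Orthonormal ℂ u := by
    refine ⟨hn, fun p q hpq => ?_⟩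
    have hp := (𝓔.mem_jointEigenspace _ _ _).1 (hu p)
    have hq := (𝓔.mem_jointEigenspace _ _ _).1 (hu q)
    by_cases h1 : p.1 = q.1
    · have h2 : p.2 ≠ q.2 := fun h => hpq (Prod.ext h1 h)
      obtain ⟨j, hj⟩ := Function.ne_iff.1 h2
      refine inner_eq_zero_of_unitary _ ?_ ?_ (hp.2 j) (hq.2 j)
      · have hs : star (((p.2 j : ℤˣ) : ℤ) : ℂ) = ((p.2 j : ℤˣ) : ℤ) := by simp
        rw [hs, ← Int.cast_mul, ← Units.val_mul, Int.units_mul_self]; simp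
      · intro he
        exact hj (Units.ext (by exact_mod_cast he))
    · refine inner_eq_zero_of_unitary _ ?_
        (exp_ne_of_ne p.1.2 q.1.2 fun h => h1 (Fin.ext h)) hp.1 hq.1
      have e : (2 * Real.pi * I * (p.1 : ℕ) / clockOrder N : ℂ) =
          I * ((2 * Real.pi * (p.1 : ℕ) / clockOrder N : ℝ) : ℂ) := by push_cast; ring
      rw [e]
      exact star_exp_mul_self _
  obtain ⟨b, hb⟩ := Orthonormal.exists_orthonormalBasis_extension_of_card_eq (v := u)
    (s := Set.univ) (by
      rw [𝓔.finrank_eq_two_pow_mul]; simp) (by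
      exact horth.comp _ Subtype.val_injective)
  exact ⟨b, fun m σ => by rw [hb _ (Set.mem_univ _)]; exact hu (m, σ)⟩

end EdgeTheory

end Spectrum

/-! ### Tent map orbits: cost and parity of the peaks -/

noncomputable section Tent

/-- A potential for the logistic map. -/
def tentPotential (s : ℝ) : ℝ := 16 / 3 * s ^ 3 - 7 * s ^ 2 + 13 / 6 * s

/-- Equality at the logistic fixed point `s = 3/4` is forced for every potential by the constant
`3/2`, whence the square factor. The endpoints `1/2` and `1` are sharp too. -/
lemma potential_upper {s : ℝ} (h0 : 1 / 2 ≤ s) (h1 : s ≤ 1) :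
    3 / 2 + tentPotential s ≤ 2 * s + tentPotential (4 * s * (1 - s)) := by
  have e : 2 * s + tentPotential (4 * s * (1 - s)) - (3 / 2 + tentPotential s) =
      (s - 3 / 4) ^ 2 * (1 - s) * (2 * s - 1) * (8 + 512 * s ^ 2) / 3 := by
    simp only [tentPotential]; ring
  have : 0 ≤ 1 - s := by linarith
  have : 0 ≤ 2 * s - 1 := by linarith
  have : 0 ≤ 2 * s + tentPotential (4 * s * (1 - s)) - (3 / 2 + tentPotential s) := by
    rw [e]; positivity
  linarith

lemma potential_lower {s : ℝ} (h0 : 0 ≤ s) (h1 : s ≤ 1 / 2) :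
    tentPotential s ≤ 2 * s + tentPotential (4 * s * (1 - s)) := by
  have key : 0 ≤ 2 * s + tentPotential (4 * s * (1 - s)) - tentPotential s := by
    -- On each half of the interval the quotient by `s` is a quintic with nonnegative coefficients
    -- in the Bernstein basis of that half.
    rcases le_total s (1 / 4) with h | h
    · have hu : 0 ≤ 1 - 4 * s := by linarith
      have e : 2 * s + tentPotential (4 * s * (1 - s)) - tentPotential s =
          s * (17 / 2 * (1 - 4 * s) ^ 5 + 169 / 12 * (4 * s) ^ 1 * (1 - 4 * s) ^ 4 + 19 / 3 * (4 * s) ^ 2 * (1 - 4 * s) ^ 3 +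
            7 / 4 * (4 * s) ^ 3 * (1 - 4 * s) ^ 2 + 7 / 3 * (4 * s) ^ 4 * (1 - 4 * s) ^ 1 + 1 * (4 * s) ^ 5) := by
        simp only [tentPotential]; ring
      rw [e]; positivity
    · have hu : 0 ≤ 2 - 4 * s := by linarith
      have hv : 0 ≤ 4 * s - 1 := by linarith
      have e : 2 * s + tentPotential (4 * s * (1 - s)) - tentPotential s =
          s * (1 * (2 - 4 * s) ^ 5 + 23 / 3 * (4 * s - 1) ^ 1 * (2 - 4 * s) ^ 4 + 277 / 12 * (4 * s - 1) ^ 2 * (2 - 4 * s) ^ 3 +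
            169 / 6 * (4 * s - 1) ^ 3 * (2 - 4 * s) ^ 2 + 181 / 12 * (4 * s - 1) ^ 4 * (2 - 4 * s) ^ 1 + 3 * (4 * s - 1) ^ 5) := by
        simp only [tentPotential]; ring
      rw [e]; positivity
  linarith

/-- A positive periodic orbit of the tent map on the fractions `D / Q`. -/
structure IsTentOrbit (Q P : ℕ) (D : ℕ → ℕ) : Prop where
  pos : ∀ n, 0 < D n
  lt : ∀ n, 2 * D n < Q
  step : ∀ n, D (n + 1) = if 4 * D n < Q then 2 * D n else Q - 2 * D n
  periodic : ∀ n, D (n + P) = D n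

/-- The energy of an orbit. -/
def orbitEnergy (Q P : ℕ) (D : ℕ → ℕ) : ℝ :=
  ∑ n ∈ Finset.range P, (1 - Real.cos (2 * Real.pi * D n / Q))

/-- The times at which an orbit is above `1/4`. -/
def peaks (Q P : ℕ) (D : ℕ → ℕ) : Finset ℕ := (Finset.range P).filter fun n => Q ≤ 4 * D n

lemma sum_range_periodic {M : Type*} [AddCommGroup M] {P : ℕ} {g : ℕ → M}
    (hg : ∀ n, g (n + P) = g n) (k : ℕ) :
    ∑ n ∈ Finset.range P, g (n + k) = ∑ n ∈ Finset.range P, g n := by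
  induction k with
  | zero => rfl
  | succ k ih =>
    have h1 := Finset.sum_range_succ (fun n => g (n + k)) P
    have h2 := Finset.sum_range_succ' (fun n => g (n + k)) P
    rw [h1, ih, zero_add, add_comm P k, hg] at h2
    rw [add_right_cancel h2]
    exact Finset.sum_congr rfl fun n _ => by rw [add_right_comm, add_assoc]

namespace IsTentOrbit

variable {Q P : ℕ} {D : ℕ → ℕ} (h : IsTentOrbit Q P D)
include h

lemma Q_pos : (0 : ℝ) < Q := by
  have := h.lt 0
  have : 0 < Q := by omega
  exact_mod_cast this

lemma shift (k : ℕ) : IsTentOrbit Q P fun n => D (n + k) where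
  pos n := h.pos _
  lt n := h.lt _
  step n := by rw [← h.step, add_right_comm]
  periodic n := by rw [add_right_comm, h.periodic]

lemma orbitEnergy_shift (k : ℕ) : orbitEnergy Q P (fun n => D (n + k)) = orbitEnergy Q P D :=
  sum_range_periodic (g := fun n => 1 - Real.cos (2 * Real.pi * D n / Q))
    (fun n => by rw [h.periodic]) k

lemma cos_step (n : ℕ) : Real.cos (2 * Real.pi * D (n + 1) / Q) =
    2 * Real.cos (2 * Real.pi * D n / Q) ^ 2 - 1 := by
  have hQ := h.Q_pos
  rw [← Real.cos_two_mul, h.step]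
  split_ifs with hc
  · congr 1; push_cast; ring
  · have hl := h.lt n
    rw [Nat.cast_sub hl.le]
    have e : 2 * Real.pi * ((Q : ℝ) - (2 * D n : ℕ)) / Q =
        2 * Real.pi - 2 * (2 * Real.pi * D n / Q) := by
      push_cast; field_simp
    rw [e, Real.cos_two_pi_sub]

lemma cos_nonpos_of_peak {n : ℕ} (hn : Q ≤ 4 * D n) : Real.cos (2 * Real.pi * D n / Q) ≤ 0 := by
  have hQ := h.Q_pos
  have hl : (2 * D n : ℝ) < Q := by exact_mod_cast h.lt n
  have hn' : (Q : ℝ) ≤ 4 * D n := by exact_mod_cast hn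
  apply Real.cos_nonpos_of_pi_div_two_le_of_le
  · rw [le_div_iff₀ hQ]; nlinarith [Real.pi_pos]
  · rw [div_le_iff₀ hQ]; nlinarith [Real.pi_pos]

lemma cos_nonneg_of_not_peak {n : ℕ} (hn : ¬ Q ≤ 4 * D n) :
    0 ≤ Real.cos (2 * Real.pi * D n / Q) := by
  have hQ := h.Q_pos
  have hn' : (4 * D n : ℝ) < Q := by exact_mod_cast not_le.1 hn
  apply Real.cos_nonneg_of_neg_pi_div_two_le_of_le
  · have : 0 ≤ 2 * Real.pi * D n / Q := by positivity
    linarith [Real.pi_pos]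
  · rw [div_le_iff₀ hQ]; nlinarith [Real.pi_pos]

/-- With `s = sin²(πD/Q)` the doubling becomes `s ↦ 4s(1-s)`, and peaks are the times with `s ≥
1/2`. Over a period the increments of the potential cancel. -/
theorem three_halves_mul_card_peaks_le : 3 / 2 * ((peaks Q P D).card : ℝ) ≤ orbitEnergy Q P D := by
  set s : ℕ → ℝ := fun n => (1 - Real.cos (2 * Real.pi * D n / Q)) / 2 with hs
  have hstep : ∀ n, s (n + 1) = 4 * s n * (1 - s n) := by
    intro n; simp only [hs, h.cos_step]; ring
  have h0 : ∀ n, 0 ≤ s n := fun n => by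
    have := Real.cos_le_one (2 * Real.pi * D n / Q); simp only [hs]; linarith
  have h1 : ∀ n, s n ≤ 1 := fun n => by
    have := Real.neg_one_le_cos (2 * Real.pi * D n / Q); simp only [hs]; linarith
  have hle : ∀ n, (if Q ≤ 4 * D n then (3 / 2 : ℝ) else 0) ≤
      2 * s n + (tentPotential (s (n + 1)) - tentPotential (s n)) := by
    intro n
    rw [hstep]
    split_ifs with hn
    · have : 1 / 2 ≤ s n := by have := h.cos_nonpos_of_peak hn; simp only [hs]; linarith
      have := potential_upper this (h1 n)
      linarith
    · have : s n ≤ 1 / 2 := by have := h.cos_nonneg_of_not_peak hn; simp only [hs]; linarith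
      have := potential_lower (h0 n) this
      linarith
  have hsum := Finset.sum_le_sum fun n (_ : n ∈ Finset.range P) => hle n
  have hper : s P = s 0 := by
    have := h.periodic 0
    rw [zero_add] at this
    simp only [hs, this]
  rw [Finset.sum_add_distrib, Finset.sum_range_sub (fun n => tentPotential (s n)), hper, sub_self,
    add_zero, ← Finset.sum_filter, Finset.sum_const, nsmul_eq_mul] at hsum
  calc 3 / 2 * ((peaks Q P D).card : ℝ) = (peaks Q P D).card * (3 / 2) := mul_comm _ _
    _ ≤ _ := hsum
    _ = orbitEnergy Q P D := Finset.sum_congr rfl fun n _ => by simp only [hs]; ring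

/-- Modulo `Q` every step doubles, and exactly the peaks reverse the sign. -/
lemma dvd_signed_sub (n : ℕ) : (Q : ℤ) ∣ 2 ^ n * D 0 - (-1) ^ (peaks Q n D).card * D n := by
  induction n with
  | zero => simp [peaks]
  | succ n ih =>
    have hl := h.lt n
    have hst := h.step n
    have hp : (peaks Q (n + 1) D).card = (peaks Q n D).card + if Q ≤ 4 * D n then 1 else 0 := by
      rw [peaks, Finset.range_add_one, Finset.filter_insert]
      split_ifs
      · rw [Finset.card_insert_of_notMem (by simp)]; rfl
      · rfl
    rw [hp]
    obtain ⟨k, hk⟩ := ih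
    by_cases hc : 4 * D n < Q
    · rw [if_pos hc] at hst
      rw [if_neg (by omega), hst, add_zero]
      exact ⟨2 * k, by push_cast; linear_combination 2 * hk⟩
    · rw [if_neg hc] at hst
      rw [if_pos (by omega), hst, pow_succ, Nat.cast_sub hl.le]
      exact ⟨2 * k + (-1) ^ (peaks Q n D).card, by push_cast; linear_combination 2 * hk⟩

/-- An odd number of sign reversals in a period would give `D 0 ≡ -D 0` modulo `Q`, impossible for
`0 < 2 * D 0 < Q`. -/
lemma even_card_peaks (hP : Q ∣ 2 ^ P - 1) : Even (peaks Q P D).card := by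
  by_contra ho
  rw [Nat.not_even_iff_odd] at ho
  have h1 := h.dvd_signed_sub P
  have hper := h.periodic 0
  rw [zero_add] at hper
  rw [ho.neg_one_pow, hper] at h1
  obtain ⟨k, hk⟩ := hP
  have h2 : ((2 : ℤ) ^ P) = Q * k + 1 := by
    have : 1 ≤ 2 ^ P := Nat.one_le_two_pow
    have : 2 ^ P = Q * k + 1 := by omega
    exact_mod_cast this
  have h3 : (Q : ℤ) ∣ ((2 * D 0 : ℕ) : ℤ) := by
    have : (((2 * D 0 : ℕ)) : ℤ) = (2 ^ P * D 0 - -1 * D 0) - Q * (k * D 0) := by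
      rw [h2]; push_cast; ring
    rw [this]
    exact dvd_sub h1 (dvd_mul_right _ _)
  have h4 := Int.natCast_dvd_natCast.1 h3
  have := Nat.le_of_dvd (by have := h.pos 0; omega) h4
  have := h.lt 0
  omega

lemma apply_add_of_not_peak {k : ℕ} (n : ℕ) (hn : ∀ j < n, 4 * D (k + j) < Q) :
    D (k + n) = 2 ^ n * D k := by
  induction n with
  | zero => simp
  | succ n ih =>
    rw [← add_assoc, h.step, if_pos (hn n (by omega)), ih fun j hj => hn j (by omega), pow_succ]
    ring

lemma exists_peak : ∃ n, Q ≤ 4 * D n := by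
  by_contra! hne
  have h1 := h.apply_add_of_not_peak (k := 0) Q fun j _ => hne _
  have h2 := h.lt (0 + Q)
  have h3 := h.pos 0
  have h4 : Q < 2 ^ Q := Nat.lt_two_pow_self
  nlinarith

lemma exists_peak_lt (hP : 0 < P) : ∃ n < P, Q ≤ 4 * D n := by
  obtain ⟨n, hn⟩ := h.exists_peak
  have : ∀ k n, D (n + P * k) = D n := by
    intro k
    induction k with
    | zero => simp
    | succ k ih => intro n; rw [mul_add, mul_one, ← add_assoc, h.periodic, ih]
  refine ⟨n % P, Nat.mod_lt _ hP, ?_⟩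
  rwa [← this (n / P), Nat.mod_add_div]

lemma two_le_card_peaks (hP : Q ∣ 2 ^ P - 1) (hP0 : 0 < P) :
    2 ≤ (peaks Q P D).card := by
  obtain ⟨k, hk⟩ := h.even_card_peaks hP
  obtain ⟨n, hn, hn'⟩ := h.exists_peak_lt hP0
  have : 0 < (peaks Q P D).card :=
    Finset.card_pos.2 ⟨n, Finset.mem_filter.2 ⟨Finset.mem_range.2 hn, hn'⟩⟩
  omega

end IsTentOrbit

end Tent

/-! ### Orbits with exactly two peaks -/

noncomputable section ClockGap

/-- These are the last three angles of a climb to a peak, close to `π/4`, `π/2`, `π`. At `η = 0` the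
sum is `4 - √2/2`, and the range of `η` keeps it above 3. -/
lemma three_le_peak_energy {φ η : ℝ} (hη0 : 0 ≤ η) (hη : η ≤ Real.pi / 64)
    (hφ : φ = Real.pi / 4 - η) :
    3 ≤ (1 - Real.cos φ) + (1 - Real.cos (2 * φ)) + (1 - Real.cos (4 * φ)) := by
  have hpi := Real.pi_lt_d2
  have h2 : Real.cos (2 * φ) = Real.sin (2 * η) := by
    rw [hφ, ← Real.cos_pi_div_two_sub]; congr 1; ring
  have h4 : Real.cos (4 * φ) = 2 * Real.cos (2 * φ) ^ 2 - 1 := by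
    rw [← Real.cos_two_mul]; congr 1; ring
  have ha0 : 0 ≤ Real.sin (2 * η) := Real.sin_nonneg_of_nonneg_of_le_pi (by linarith) (by linarith)
  have ha1 : Real.sin (2 * η) ≤ 2 * η := Real.sin_le (by linarith)
  have hc := Real.cos_two_mul φ
  rw [h4, h2]
  rw [h2] at hc
  generalize Real.sin (2 * η) = a at *
  have ha : a ≤ 1 / 10 := by linarith
  have hcos : Real.cos φ ≤ 3 / 4 := by
    by_contra! hlt
    nlinarith
  nlinarith

lemma clockOrder_mul_four_succ (N : ℕ) : clockOrder (N + 1) = 4 * clockOrder N + 1 := by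
  have h1 := three_mul_clockOrder_add_one N
  have h2 := three_mul_clockOrder_add_one (N + 1)
  rw [pow_succ] at h2
  omega

lemma odd_clockOrder {N : ℕ} (hN : 0 < N) : Odd (clockOrder N) := by
  obtain ⟨n, rfl⟩ := Nat.exists_eq_add_of_lt hN
  rw [zero_add, clockOrder_mul_four_succ]
  exact ⟨2 * clockOrder n, by ring⟩

lemma clockOrder_dvd (N : ℕ) : clockOrder N ∣ 2 ^ (2 * N) - 1 := by
  rw [pow_mul]
  exact ⟨3, by have := three_mul_clockOrder N; norm_num; omega⟩

lemma five_le_clockOrder {N : ℕ} (hN : 2 ≤ N) : 5 ≤ clockOrder N := by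
  have h1 := three_mul_clockOrder_add_one N
  have h2 : 4 ^ 2 ≤ 4 ^ N := Nat.pow_le_pow_right (by norm_num) hN
  omega

/-- Only `b = 0` and `b = 2` are possible below 4, with `u = 0` and `u = 1`. The conclusion gives
both climbs room for three separate steps. -/
lemma two_pow_eq_three_mul_add_one {b u : ℕ} (h : 2 ^ b = 3 * u + 1) (hu : 2 ≤ u) : 4 ≤ b := by
  by_contra! hb
  interval_cases b <;> omega

namespace IsTentOrbit

variable {N : ℕ} {D : ℕ → ℕ}

/-- Let `u` and `u'` be the values just after the peaks at times `0` and `g`. Elsewhere the orbit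
doubles, so `u' + 2^g u = Q = u + 2^{2N-g} u'`, and hence `2^{2N-g} = 3u + 1`, `2^g = 3u' + 1`. If
neither value is 1, both exponents are at least 4 and each climb contributes 3. -/
lemma energy_of_two_peaks (h : IsTentOrbit (clockOrder N) (2 * N) D)
    (hc : (peaks (clockOrder N) (2 * N) D).card = 2) (h0 : clockOrder N ≤ 4 * D 0) :
    (∃ k, D k = 1) ∨ 6 ≤ orbitEnergy (clockOrder N) (2 * N) D := by
  have hQp := h.Q_pos
  have hQ3 := three_mul_clockOrder_add_one N
  set Q := clockOrder N with hQ
  have hN : 0 < 2 * N := by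
    rcases Nat.eq_zero_or_pos (2 * N) with h' | h'
    · rw [h'] at hc; simp [peaks] at hc
    · exact h'
  have hm0 : 0 ∈ peaks Q (2 * N) D := Finset.mem_filter.2 ⟨Finset.mem_range.2 hN, h0⟩
  obtain ⟨g, hg0, hpk⟩ : ∃ g, g ≠ 0 ∧ peaks Q (2 * N) D = {0, g} := by
    obtain ⟨a, b, hab, he⟩ := Finset.card_eq_two.1 hc
    rw [he, Finset.mem_insert, Finset.mem_singleton] at hm0
    rcases hm0 with rfl | rfl
    · exact ⟨b, hab.symm, he⟩
    · exact ⟨a, hab, by rw [he, Finset.pair_comm]⟩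
  have hgm : g ∈ peaks Q (2 * N) D := by rw [hpk]; simp
  obtain ⟨hgr, hgp⟩ := Finset.mem_filter.1 hgm
  rw [Finset.mem_range] at hgr
  have hnp : ∀ n < 2 * N, n ≠ 0 → n ≠ g → 4 * D n < Q := by
    intro n hn h1 h2
    by_contra! hle
    have : n ∈ peaks Q (2 * N) D := Finset.mem_filter.2 ⟨Finset.mem_range.2 hn, hle⟩
    rw [hpk] at this
    simp [h1, h2] at this
  have hu : D 1 + 2 * D 0 = Q := by
    have := h.step 0
    rw [if_neg (by omega), zero_add] at this
    have := h.lt 0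
    omega
  have hu' : D (g + 1) + 2 * D g = Q := by
    have := h.step g
    rw [if_neg (by omega)] at this
    have := h.lt g
    omega
  have r1 : ∀ j, j + 1 ≤ g → D (1 + j) = 2 ^ j * D 1 := fun j hj =>
    h.apply_add_of_not_peak j fun i hi => hnp _ (by omega) (by omega) (by omega)
  have r2 : ∀ j, g + 1 + j ≤ 2 * N → D (g + 1 + j) = 2 ^ j * D (g + 1) := fun j hj =>
    h.apply_add_of_not_peak j fun i hi => hnp _ (by omega) (by omega) (by omega)
  have hper := h.periodic 0
  rw [zero_add] at hper
  set u := D 1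
  set u' := D (g + 1)
  have hA : u' + 2 ^ g * u = Q := by
    have := r1 (g - 1) (by omega)
    rw [show 1 + (g - 1) = g by omega] at this
    rw [← hu', this, ← mul_assoc, ← pow_succ', show g - 1 + 1 = g by omega]
  have hB : u + 2 ^ (2 * N - g) * u' = Q := by
    have := r2 (2 * N - g - 1) (by omega)
    rw [show g + 1 + (2 * N - g - 1) = 2 * N by omega, hper] at this
    rw [← hu, this, ← mul_assoc, ← pow_succ', show 2 * N - g - 1 + 1 = 2 * N - g by omega]
  have hAB : 2 ^ g * 2 ^ (2 * N - g) = 3 * Q + 1 := by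
    rw [← pow_add, show g + (2 * N - g) = 2 * N by omega, pow_mul, hQ3, show 2 ^ 2 = 4 by norm_num]
  have hQ0 : 0 < Q := by exact_mod_cast hQp
  -- Multiply `hA` by `2^{2N-g}`, eliminate `u'` by `hB` and cancel `Q`.
  have hBu : 2 ^ (2 * N - g) = 3 * u + 1 := by
    apply Nat.eq_of_mul_eq_mul_right hQ0
    generalize 2 ^ g = A at *
    generalize 2 ^ (2 * N - g) = B at *
    zify at hA hB hAB ⊢
    linear_combination -(B * hA) + hB + u * hAB
  have hAu : 2 ^ g = 3 * u' + 1 := by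
    apply Nat.eq_of_mul_eq_mul_right hQ0
    generalize 2 ^ g = A at *
    generalize 2 ^ (2 * N - g) = B at *
    zify at hA hB hAB ⊢
    linear_combination -(A * hB) + hA + u' * hAB
  by_cases hu1 : u = 1
  · exact Or.inl ⟨1, hu1⟩
  by_cases hu1' : u' = 1
  · exact Or.inl ⟨g + 1, hu1'⟩
  right
  have hup : 0 < u := h.pos 1
  have hup' : 0 < u' := h.pos (g + 1)
  have hb := two_pow_eq_three_mul_add_one hBu (by omega)
  have ha := two_pow_eq_three_mul_add_one hAu (by omega)
  -- Here `y` is the orbit two steps before a peak and `v` the value just after it. The angle of `y`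
  -- is `π/4 - πv/(4Q)`, and `16v ≤ Q` is the bound on `η`.
  have key : ∀ y v : ℕ, 8 * y + v = Q → 16 * v ≤ Q →
      3 ≤ (1 - Real.cos (2 * Real.pi * y / Q)) + (1 - Real.cos (2 * Real.pi * (2 * y : ℕ) / Q)) +
        (1 - Real.cos (2 * Real.pi * (4 * y : ℕ) / Q)) := by
    intro y v hy hv
    have hy' : (8 * y + v : ℝ) = Q := by exact_mod_cast hy
    have hv' : (16 * v : ℝ) ≤ Q := by exact_mod_cast hv
    have := three_le_peak_energy (φ := 2 * Real.pi * y / Q) (η := Real.pi * v / (4 * Q))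
      (by positivity) (by rw [div_le_div_iff₀ (by positivity) (by positivity)]
                          nlinarith [Real.pi_pos])
      (by field_simp; linear_combination hy')
    have e2 : 2 * (2 * Real.pi * y / Q) = 2 * Real.pi * (2 * y : ℕ) / Q := by push_cast; ring
    have e4 : 4 * (2 * Real.pi * y / Q) = 2 * Real.pi * (4 * y : ℕ) / Q := by push_cast; ring
    rwa [e2, e4] at this
  have hpow : ∀ b, 4 ≤ b → 2 ^ b = 8 * 2 ^ (b - 3) ∧ 16 ≤ 2 ^ b := by
    intro b hb
    obtain ⟨c, rfl⟩ := Nat.exists_eq_add_of_le hb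
    refine ⟨?_, ?_⟩
    · rw [show 4 + c - 3 = c + 1 by omega, pow_add, pow_add]; ring
    · rw [pow_add]; nlinarith [Nat.one_le_two_pow (n := c)]
  obtain ⟨hA8, hA16⟩ := hpow g ha
  obtain ⟨hB8, hB16⟩ := hpow (2 * N - g) hb
  have k1 := key (2 ^ (g - 3) * u) u' (by rw [← hA, hA8]; ring) (by nlinarith)
  have k2 := key (2 ^ (2 * N - g - 3) * u') u (by rw [← hB, hB8]; ring) (by nlinarith)
  have d1 : D (g - 2) = 2 ^ (g - 3) * u := by
    rw [← r1 (g - 3) (by omega)]; congr 1; omega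
  have d2 : D (g - 1) = 2 * (2 ^ (g - 3) * u) := by
    rw [← mul_assoc, ← pow_succ', ← r1 (g - 3 + 1) (by omega)]; congr 1; omega
  have d3 : D g = 4 * (2 ^ (g - 3) * u) := by
    rw [show 4 * (2 ^ (g - 3) * u) = 2 ^ (g - 3 + 2) * u by rw [pow_add]; ring,
      ← r1 (g - 3 + 2) (by omega)]
    congr 1; omega
  have e1 : D (2 * N - 2) = 2 ^ (2 * N - g - 3) * u' := by
    rw [← r2 (2 * N - g - 3) (by omega)]; congr 1; omega
  have e2 : D (2 * N - 1) = 2 * (2 ^ (2 * N - g - 3) * u') := by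
    rw [← mul_assoc, ← pow_succ', ← r2 (2 * N - g - 3 + 1) (by omega)]; congr 1; omega
  have e3 : D 0 = 4 * (2 ^ (2 * N - g - 3) * u') := by
    rw [show 4 * (2 ^ (2 * N - g - 3) * u') = 2 ^ (2 * N - g - 3 + 2) * u' by rw [pow_add]; ring,
      ← r2 (2 * N - g - 3 + 2) (by omega), ← hper]
    congr 1; omega
  rw [← d3, ← d2, ← d1] at k1
  rw [← e3, ← e2, ← e1] at k2
  -- The two climbs use disjoint times; the second one ends at time `2N`, counted as `0`.
  have hsub : ({g - 2, g - 1, g, 2 * N - 2, 2 * N - 1, 0} : Finset ℕ) ⊆ Finset.range (2 * N) := by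
    intro n hn
    simp only [Finset.mem_insert, Finset.mem_singleton] at hn
    rw [Finset.mem_range]
    omega
  have hle := Finset.sum_le_sum_of_subset_of_nonneg
    (f := fun n => 1 - Real.cos (2 * Real.pi * D n / Q)) hsub
    (fun n _ _ => by have := Real.cos_le_one (2 * Real.pi * D n / Q); linarith)
  rw [Finset.sum_insert (by simp only [Finset.mem_insert, Finset.mem_singleton]; omega),
    Finset.sum_insert (by simp only [Finset.mem_insert, Finset.mem_singleton]; omega),
    Finset.sum_insert (by simp only [Finset.mem_insert, Finset.mem_singleton]; omega),
    Finset.sum_insert (by simp only [Finset.mem_insert, Finset.mem_singleton]; omega),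
    Finset.sum_insert (by simp only [Finset.mem_singleton]; omega),
    Finset.sum_singleton] at hle
  unfold orbitEnergy
  linarith

/-- The number of peaks is even and positive, so it is 2 or at least 4, and four peaks cost at least
`4 * (3/2)`. The orbit is first shifted to start at a peak. -/
lemma exists_eq_one_or_energy (h : IsTentOrbit (clockOrder N) (2 * N) D) (hN : 0 < N) :
    (∃ k, D k = 1) ∨ 6 ≤ orbitEnergy (clockOrder N) (2 * N) D := by
  obtain ⟨k, hk⟩ := h.exists_peak
  have hs := h.shift k
  obtain ⟨r, hr⟩ := hs.even_card_peaks (clockOrder_dvd N)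
  have h2 := hs.two_le_card_peaks (clockOrder_dvd N) (by omega)
  rw [← h.orbitEnergy_shift k]
  by_cases hc : (peaks (clockOrder N) (2 * N) fun n => D (n + k)).card = 2
  · rcases hs.energy_of_two_peaks hc (by simpa using hk) with ⟨j, hj⟩ | h6
    · exact Or.inl ⟨j + k, hj⟩
    · exact Or.inr h6
  · right
    have h4 : (4 : ℝ) ≤ (peaks (clockOrder N) (2 * N) fun n => D (n + k)).card := by
      have : 4 ≤ (peaks (clockOrder N) (2 * N) fun n => D (n + k)).card := by omega
      exact_mod_cast this
    have := hs.three_halves_mul_card_peaks_le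
    linarith

end IsTentOrbit

end ClockGap

/-! ### From clock excitations to tent orbits, and the comparison with `m = 1` -/

noncomputable section ClockGapBounds

/-- The orbit of the tent map through the distance of `m / Q` to the nearest integer. -/
def tentOrbit (Q m : ℕ) : ℕ → ℕ
  | 0 => min m (Q - m)
  | n + 1 => if 4 * tentOrbit Q m n < Q then 2 * tentOrbit Q m n else Q - 2 * tentOrbit Q m n

/-- Period `0` makes periodicity vacuous, so the cosine lemmas apply before the true period is
established. Oddness of `Q` excludes `4D = Q`, which would lead to `2D = Q`. -/
lemma isTentOrbit_zero {Q m : ℕ} (hQ : Odd Q) (hm0 : 0 < m) (hm : m < Q) :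
    IsTentOrbit Q 0 (tentOrbit Q m) := by
  obtain ⟨q, hq⟩ := hQ
  have key : ∀ n, 0 < tentOrbit Q m n ∧ 2 * tentOrbit Q m n < Q := by
    intro n
    induction n with
    | zero => simp only [tentOrbit]; omega
    | succ n ih => simp only [tentOrbit]; split_ifs <;> omega
  exact ⟨fun n => (key n).1, fun n => (key n).2, fun n => rfl, fun n => rfl⟩

lemma IsTentOrbit.cos_eq {Q P m : ℕ} {D : ℕ → ℕ} (h : IsTentOrbit Q P D)
    (h0 : Real.cos (2 * Real.pi * D 0 / Q) = Real.cos (2 * Real.pi * m / Q)) (n : ℕ) :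
    Real.cos (2 * Real.pi * D n / Q) = Real.cos (2 ^ n * (2 * Real.pi * m) / Q) := by
  induction n with
  | zero => simpa using h0
  | succ n ih =>
    rw [h.cos_step, ih, ← Real.cos_two_mul]
    congr 1; ring

lemma cos_tentOrbit {Q m : ℕ} (hQ : Odd Q) (hm0 : 0 < m) (hm : m < Q) (n : ℕ) :
    Real.cos (2 * Real.pi * tentOrbit Q m n / Q) = Real.cos (2 ^ n * (2 * Real.pi * m) / Q) := by
  have h := isTentOrbit_zero hQ hm0 hm
  have hQp := h.Q_pos
  refine h.cos_eq ?_ n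
  rw [tentOrbit]
  rcases le_total m (Q - m) with hle | hle
  · rw [min_eq_left hle]
  · rw [min_eq_right hle, Nat.cast_sub hm.le]
    have e : 2 * Real.pi * ((Q : ℝ) - m) / Q = 2 * Real.pi - 2 * Real.pi * m / Q := by
      field_simp
    rw [e, Real.cos_two_pi_sub]

/-- `4^N = 3Q + 1` returns the doubled angle to itself modulo `2π`, and the cosine is injective on
`[0, π]`, where the orbit angles lie. -/
lemma isTentOrbit_tentOrbit {N m : ℕ} (hN : 0 < N) (hm0 : 0 < m) (hm : m < clockOrder N) :
    IsTentOrbit (clockOrder N) (2 * N) (tentOrbit (clockOrder N) m) := by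
  have hQ := odd_clockOrder hN
  have h := isTentOrbit_zero hQ hm0 hm
  have hQp := h.Q_pos
  refine ⟨h.pos, h.lt, h.step, fun n => ?_⟩
  have hper : Real.cos (2 * Real.pi * tentOrbit (clockOrder N) m (n + 2 * N) / clockOrder N) =
      Real.cos (2 * Real.pi * tentOrbit (clockOrder N) m n / clockOrder N) := by
    have hQ3 : (3 * clockOrder N + 1 : ℝ) = 4 ^ N := by
      exact_mod_cast three_mul_clockOrder_add_one N
    have e : (2 : ℝ) ^ (n + 2 * N) * (2 * Real.pi * m) / clockOrder N =
        2 ^ n * (2 * Real.pi * m) / clockOrder N + ((3 * 2 ^ n * m : ℕ) : ℝ) * (2 * Real.pi) := by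
      rw [pow_add, pow_mul, show (2 : ℝ) ^ 2 = 4 by norm_num, ← hQ3]
      push_cast; field_simp; ring
    rw [cos_tentOrbit hQ hm0 hm, cos_tentOrbit hQ hm0 hm, e, Real.cos_add_nat_mul_two_pi]
  have hmem : ∀ k, 2 * Real.pi * tentOrbit (clockOrder N) m k / clockOrder N ∈
      Set.Icc 0 Real.pi := by
    intro k
    have hl : (2 * tentOrbit (clockOrder N) m k : ℝ) < clockOrder N := by exact_mod_cast h.lt k
    refine ⟨by positivity, ?_⟩
    rw [div_le_iff₀ hQp]; nlinarith [Real.pi_pos]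
  have := Real.injOn_cos (hmem _) (hmem _) hper
  field_simp at this
  exact_mod_cast this

lemma clockGap_eq (N m : ℕ) : clockGap N m =
    ∑ n ∈ Finset.range (2 * N), (1 - Real.cos (2 ^ n * (2 * Real.pi * m) / clockOrder N)) := by
  simp only [clockGap, energy, Finset.sum_sub_distrib]
  simp
  ring

lemma clockGap_eq_orbitEnergy {N m : ℕ} {D : ℕ → ℕ} (h : IsTentOrbit (clockOrder N) (2 * N) D)
    (h0 : Real.cos (2 * Real.pi * D 0 / clockOrder N) = Real.cos (2 * Real.pi * m / clockOrder N)) :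
    clockGap N m = orbitEnergy (clockOrder N) (2 * N) D := by
  rw [clockGap_eq, orbitEnergy]
  exact Finset.sum_congr rfl fun n _ => by rw [h.cos_eq h0]

lemma clockGap_eq_tentOrbit {N m : ℕ} (hN : 0 < N) (hm0 : 0 < m) (hm : m < clockOrder N) :
    clockGap N m = orbitEnergy (clockOrder N) (2 * N) (tentOrbit (clockOrder N) m) :=
  clockGap_eq_orbitEnergy (isTentOrbit_tentOrbit hN hm0 hm) (by
    have := cos_tentOrbit (odd_clockOrder hN) hm0 hm 0
    simpa using this)

theorem three_le_clockGap {N m : ℕ} (hN : 0 < N) (hm0 : 0 < m) (hm : m < clockOrder N) :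
    3 ≤ clockGap N m := by
  have h := isTentOrbit_tentOrbit hN hm0 hm
  rw [clockGap_eq_tentOrbit hN hm0 hm]
  have h1 := h.three_halves_mul_card_peaks_le
  have h2 : (2 : ℝ) ≤ (peaks (clockOrder N) (2 * N) (tentOrbit (clockOrder N) m)).card := by
    exact_mod_cast h.two_le_card_peaks (clockOrder_dvd N) (by omega)
  linarith

lemma sum_geometric_quadratic (x : ℝ) (M : ℕ) :
    ∑ n ∈ Finset.range M, (1 - Real.cos (2 ^ n * x)) ≤ (2 ^ M * x) ^ 2 / 6 := by
  have h : ∀ n, 1 - Real.cos (2 ^ n * x) ≤ x ^ 2 / 2 * 4 ^ n := by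
    intro n
    have := Real.one_sub_sq_div_two_le_cos (x := 2 ^ n * x)
    have e : (2 ^ n * x) ^ 2 = x ^ 2 * 4 ^ n := by
      rw [mul_pow, ← pow_mul, mul_comm n, pow_mul]; norm_num; ring
    rw [e] at this
    linarith
  have h1 := Finset.sum_le_sum fun n (_ : n ∈ Finset.range M) => h n
  have h2 : ∑ n ∈ Finset.range M, (4 : ℝ) ^ n = (4 ^ M - 1) / 3 := by
    rw [geom_sum_eq (by norm_num)]; norm_num
  rw [← Finset.mul_sum, h2] at h1
  have e : (2 ^ M * x) ^ 2 = x ^ 2 * 4 ^ M := by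
    rw [mul_pow, ← pow_mul, mul_comm M, pow_mul]; norm_num; ring
  rw [e]
  nlinarith [sq_nonneg x]

/-- The four largest angles are estimated separately and the smaller ones by `1 - cos x ≤ x²/2`. The
slack below 6 allows a bound uniform in `N ≥ 2`. -/
lemma clockGap_one_le_six {N : ℕ} (hN : 2 ≤ N) : clockGap N 1 ≤ 6 := by
  obtain ⟨M, hM⟩ : ∃ M, 2 * N = M + 4 := ⟨2 * N - 4, by omega⟩
  have hQ5 : (5 : ℝ) ≤ clockOrder N := by exact_mod_cast five_le_clockOrder hN
  have hQp : (0 : ℝ) < clockOrder N := by linarith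
  have hQ3 : (2 : ℝ) ^ M * 16 = 3 * clockOrder N + 1 := by
    have : (3 * clockOrder N + 1 : ℝ) = 4 ^ N := by exact_mod_cast three_mul_clockOrder_add_one N
    rw [this, show (4 : ℝ) = 2 ^ 2 by norm_num, ← pow_mul, hM, pow_add]; norm_num
  set x : ℝ := 2 * Real.pi / clockOrder N with hx
  set X : ℝ := 2 ^ M * x with hX
  -- From `16 * 2^M = 4^N = 3Q + 1`; then `Q ≥ 5` yields `X ≤ 3π/8 + π/40 = 2π/5`.
  have hXe : X = 3 * Real.pi / 8 + Real.pi / (8 * clockOrder N) := by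
    rw [hX, hx]; field_simp; linear_combination hQ3
  have hd0 : 0 ≤ Real.pi / (8 * clockOrder N) := by positivity
  have hd1 : Real.pi / (8 * clockOrder N) ≤ Real.pi / 40 := by
    rw [div_le_div_iff₀ (by positivity) (by norm_num)]; nlinarith [Real.pi_pos]
  have hpi := Real.pi_lt_d2
  have hpi' := Real.pi_gt_d2
  have hX0 : 0 ≤ X := by rw [hXe]; positivity
  have hX1 : X ≤ 2 * Real.pi / 5 := by rw [hXe]; linarith
  have hsum : clockGap N 1 = (∑ n ∈ Finset.range M, (1 - Real.cos (2 ^ n * x))) +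
      (1 - Real.cos X) + (1 - Real.cos (2 * X)) + (1 - Real.cos (4 * X)) +
      (1 - Real.cos (8 * X)) := by
    have e : ∀ n, (2 : ℝ) ^ n * (2 * Real.pi * (1 : ℕ)) / clockOrder N = 2 ^ n * x := by
      intro n; rw [hx]; push_cast; ring
    rw [clockGap_eq, hM]
    simp only [e]
    rw [Finset.sum_range_succ, Finset.sum_range_succ, Finset.sum_range_succ, Finset.sum_range_succ,
      ← hX, show (2 : ℝ) ^ (M + 1) * x = 2 * X by rw [hX, pow_succ]; ring,
      show (2 : ℝ) ^ (M + 2) * x = 4 * X by rw [hX, pow_add]; ring,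
      show (2 : ℝ) ^ (M + 3) * x = 8 * X by rw [hX, pow_add]; ring]
  have hlow := sum_geometric_quadratic x M
  rw [← hX] at hlow
  have hcX : 3 / 10 ≤ Real.cos X := by
    have h1 : Real.cos (2 * Real.pi / 5) ≤ Real.cos X :=
      Real.cos_le_cos_of_nonneg_of_le_pi hX0 (by linarith) hX1
    have h2 : Real.cos (2 * Real.pi / 5) = Real.sin (Real.pi / 10) := by
      rw [← Real.cos_pi_div_two_sub]; congr 1; ring
    have h3 := Real.sin_gt_sub_cube (x := Real.pi / 10) (by linarith)
    have h4 : (Real.pi / 10) ^ 3 ≤ (315 / 1000 : ℝ) ^ 3 :=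
      pow_le_pow_left₀ (by linarith) (by linarith) 3
    have h5 : ((315 : ℝ) / 1000) ^ 3 ≤ 1 / 25 := by norm_num
    have h6 : (0 : ℝ) ≤ (Real.pi / 10) ^ 3 := by positivity
    linarith
  have h2X := Real.cos_two_mul X
  have h4X : 0 ≤ Real.cos (4 * X) := by
    have e : 4 * X = Real.pi / 2 + Real.pi + 4 * (Real.pi / (8 * clockOrder N)) := by
      rw [hXe]; ring
    rw [e, ← Real.cos_sub_two_pi, show Real.pi / 2 + Real.pi + 4 * (Real.pi / (8 * clockOrder N)) -
      2 * Real.pi = -(Real.pi / 2 - 4 * (Real.pi / (8 * clockOrder N))) by ring, Real.cos_neg,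
      Real.cos_pi_div_two_sub]
    exact Real.sin_nonneg_of_nonneg_of_le_pi (by linarith) (by linarith)
  have h8X := Real.neg_one_le_cos (8 * X)
  have hXsq : X ^ 2 ≤ (126 / 100 : ℝ) ^ 2 := pow_le_pow_left₀ hX0 (by linarith) 2
  rw [hsum, h2X]
  nlinarith

/-- An orbit through 1 is, up to a time shift, the orbit of `m = 1` and has its energy; any other
orbit costs at least 6. -/
theorem clockGap_one_le {N m : ℕ} (hN : 0 < N) (hm0 : m ≠ 0) (hm : m < clockOrder N) :
    clockGap N 1 ≤ clockGap N m := by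
  have hN2 : 2 ≤ N := by
    by_contra hlt
    have hN1 : N = 1 := by omega
    have : clockOrder 1 = 1 := by decide
    rw [hN1, this] at hm
    omega
  have hmp : 0 < m := Nat.pos_of_ne_zero hm0
  have h := isTentOrbit_tentOrbit hN hmp hm
  rw [clockGap_eq_tentOrbit hN hmp hm]
  rcases h.exists_eq_one_or_energy hN with ⟨k, hk⟩ | h6
  · rw [← h.orbitEnergy_shift k]
    exact (clockGap_eq_orbitEnergy (h.shift k) (by simp [hk])).le
  · exact (clockGap_one_le_six hN2).trans h6

end ClockGapBounds

/-! ### The thermodynamic limit of the lowest clock excitation -/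

noncomputable section Limit

/-- Counted from the largest angle, `2^{2N-1-k} 2π / Q = (π / 2^k)(3Q + 1) / Q`, so that each term
has a limit for fixed `k`. -/
lemma clockGap_one_eq_reflect {N : ℕ} (hN : 0 < N) : clockGap N 1 =
    ∑ k ∈ Finset.range (2 * N),
      (1 - Real.cos (3 * Real.pi / 2 ^ k * (1 + (3 * clockOrder N : ℝ)⁻¹))) := by
  have hQ : (0 : ℝ) < clockOrder N := by
    have : NeZero N := ⟨hN.ne'⟩
    exact_mod_cast clockOrder_pos (N := N)
  have hQ3 : (3 * clockOrder N + 1 : ℝ) = 2 ^ (2 * N) := by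
    rw [pow_mul, show (2 : ℝ) ^ 2 = 4 by norm_num]
    exact_mod_cast three_mul_clockOrder_add_one N
  rw [clockGap_eq, ← Finset.sum_range_reflect]
  refine Finset.sum_congr rfl fun k hk => ?_
  have hk' := Finset.mem_range.1 hk
  congr 2
  have e : (2 : ℝ) ^ (2 * N) = 2 ^ (2 * N - 1 - k) * 2 ^ k * 2 := by
    rw [← pow_add, ← pow_succ]; congr 1; omega
  rw [e] at hQ3
  have h2 : (0 : ℝ) < 2 ^ k := by positivity
  field_simp
  push_cast
  linear_combination -hQ3

/-- The range of `c` contains every factor `1 + 1/(3Q)` with `Q ≥ 1`, so the bound dominates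
uniformly in `N`. -/
lemma one_sub_cos_le {c : ℝ} (hc0 : 0 ≤ c) (hc : c ≤ 4 / 3) (k : ℕ) :
    1 - Real.cos (3 * Real.pi / 2 ^ k * c) ≤ (4 * Real.pi) ^ 2 / 2 * (1 / 4) ^ k := by
  have h := Real.one_sub_sq_div_two_le_cos (x := 3 * Real.pi / 2 ^ k * c)
  have h1 : 3 * Real.pi / 2 ^ k * c ≤ 4 * Real.pi / 2 ^ k := by
    rw [div_mul_eq_mul_div]
    exact div_le_div_of_nonneg_right (by nlinarith [Real.pi_pos]) (by positivity)
  have h2 : (3 * Real.pi / 2 ^ k * c) ^ 2 ≤ (4 * Real.pi / 2 ^ k) ^ 2 :=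
    pow_le_pow_left₀ (by positivity) h1 2
  have e : (4 * Real.pi / 2 ^ k) ^ 2 = (4 * Real.pi) ^ 2 * (1 / 4) ^ k := by
    rw [div_pow, ← pow_mul, mul_comm k, pow_mul, div_pow, one_pow]; norm_num; ring
  linarith

lemma summable_bound : Summable fun k : ℕ => (4 * Real.pi) ^ 2 / 2 * (1 / 4 : ℝ) ^ k :=
  (summable_geometric_of_lt_one (by norm_num) (by norm_num)).mul_left _

lemma summable_one_sub_cos : Summable fun n : ℕ => 1 - Real.cos (3 * Real.pi / 2 ^ n) :=
  Summable.of_nonneg_of_le (fun n => by have := Real.cos_le_one (3 * Real.pi / 2 ^ n); linarith)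
    (fun n => by simpa using one_sub_cos_le (c := 1) (by norm_num) (by norm_num) n) summable_bound

theorem tendsto_clockGap_one : Filter.Tendsto (fun N : ℕ => clockGap N 1) Filter.atTop
    (𝓝 (∑' n : ℕ, (1 - Real.cos (3 * Real.pi / 2 ^ n)))) := by
  -- Extension by zero turns the finite sums into series over a fixed index set.
  let f : ℕ → ℕ → ℝ := fun N k => if k < 2 * N then
    1 - Real.cos (3 * Real.pi / 2 ^ k * (1 + (3 * clockOrder N : ℝ)⁻¹)) else 0
  have hQ : ∀ N : ℕ, (N : ℝ) ≤ clockOrder N := by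
    intro N
    have : N ≤ clockOrder N := by
      induction N with
      | zero => simp
      | succ N ih => rw [clockOrder_mul_four_succ]; omega
    exact_mod_cast this
  have hlim : Filter.Tendsto (fun N : ℕ => (1 + (3 * clockOrder N : ℝ)⁻¹)) Filter.atTop (𝓝 1) := by
    have h1 : Filter.Tendsto (fun N : ℕ => (3 * clockOrder N : ℝ)) Filter.atTop Filter.atTop :=
      (Filter.tendsto_atTop_mono hQ tendsto_natCast_atTop_atTop).const_mul_atTop (by norm_num)
    simpa using (tendsto_const_nhds (x := (1 : ℝ))).add h1.inv_tendsto_atTop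
  have key : Filter.Tendsto (fun N => ∑' k, f N k) Filter.atTop
      (𝓝 (∑' n : ℕ, (1 - Real.cos (3 * Real.pi / 2 ^ n)))) := by
    refine tendsto_tsum_of_dominated_convergence summable_bound (fun k => ?_) ?_
    · have h1 : Filter.Tendsto (fun N : ℕ =>
          1 - Real.cos (3 * Real.pi / 2 ^ k * (1 + (3 * clockOrder N : ℝ)⁻¹))) Filter.atTop
          (𝓝 (1 - Real.cos (3 * Real.pi / 2 ^ k * 1))) :=
        tendsto_const_nhds.sub ((Real.continuous_cos.tendsto _).comp (hlim.const_mul _))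
      rw [mul_one] at h1
      refine h1.congr' ?_
      filter_upwards [Filter.eventually_ge_atTop (k + 1)] with N hN
      simp only [f]
      rw [if_pos (by omega)]
    · filter_upwards [Filter.eventually_ge_atTop 1] with N hN k
      have hN' : (1 : ℝ) ≤ clockOrder N := le_trans (by exact_mod_cast hN) (hQ N)
      have hinv : (3 * clockOrder N : ℝ)⁻¹ ≤ 1 / 3 := by
        rw [inv_eq_one_div]
        exact one_div_le_one_div_of_le (by norm_num) (by linarith)
      simp only [f]
      split_ifs
      · rw [Real.norm_of_nonneg (sub_nonneg.2 (Real.cos_le_one _))]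
        exact one_sub_cos_le (by positivity) (by linarith) k
      · rw [norm_zero]; positivity
  refine key.congr' ?_
  filter_upwards [Filter.eventually_ge_atTop 1] with N hN
  rw [clockGap_one_eq_reflect (by omega), tsum_eq_sum (s := Finset.range (2 * N))]
  · exact Finset.sum_congr rfl fun k hk => if_pos (Finset.mem_range.1 hk)
  · intro k hk
    exact if_neg (by simpa using hk)

/-- Rational bounds for the cosine of half an angle. -/
lemma half_angle_bounds {x a b l u : ℝ} (h : Real.cos (2 * x) ∈ Set.Icc a b)
    (hx : 0 ≤ Real.cos x) (hl : 2 * l ^ 2 - 1 ≤ a) (hu0 : 0 ≤ u) (hu : b ≤ 2 * u ^ 2 - 1) :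
    Real.cos x ∈ Set.Icc l u := by
  rw [Real.cos_two_mul] at h
  constructor
  · exact le_of_not_gt fun hlt => by nlinarith [h.1]
  · exact le_of_not_gt fun hlt => by nlinarith [h.2]

theorem abs_tsum_sub_le : |(∑' n : ℕ, (1 - Real.cos (3 * Real.pi / 2 ^ n))) - 5.55| < 0.005 := by
  have hpi := Real.pi_lt_d2
  have hpi0 := Real.pi_pos
  have c0 : Real.cos (3 * Real.pi / 2 ^ 0) = -1 := by
    rw [pow_zero, div_one, show 3 * Real.pi = Real.pi + 2 * Real.pi by ring, Real.cos_add_two_pi,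
      Real.cos_pi]
  have c1 : Real.cos (3 * Real.pi / 2 ^ 1) = 0 := by
    rw [show 3 * Real.pi / 2 ^ 1 = Real.pi / 2 + Real.pi by ring, Real.cos_add_pi,
      Real.cos_pi_div_two, neg_zero]
  have c2 : Real.cos (3 * Real.pi / 2 ^ 2) = -(√2 / 2) := by
    rw [show 3 * Real.pi / 2 ^ 2 = Real.pi - Real.pi / 4 by ring, Real.cos_pi_sub,
      Real.cos_pi_div_four]
  have hs0 : 0 ≤ √2 := Real.sqrt_nonneg 2
  have hs : √2 ^ 2 = 2 := Real.sq_sqrt (by norm_num)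
  have b2 : Real.cos (3 * Real.pi / 2 ^ 2) ∈ Set.Icc (-0.70711 : ℝ) (-0.7071) := by
    rw [c2]; constructor <;> nlinarith
  have step : ∀ {k : ℕ} {a b l u : ℝ}, 2 ≤ k → Real.cos (3 * Real.pi / 2 ^ k) ∈ Set.Icc a b →
      2 * l ^ 2 - 1 ≤ a → 0 ≤ u → b ≤ 2 * u ^ 2 - 1 →
      Real.cos (3 * Real.pi / 2 ^ (k + 1)) ∈ Set.Icc l u := by
    intro k a b l u hk h hl hu0 hu
    refine half_angle_bounds ?_ ?_ hl hu0 hu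
    · rwa [show 2 * (3 * Real.pi / 2 ^ (k + 1)) = 3 * Real.pi / 2 ^ k by rw [pow_succ]; field_simp]
    · have h8 : (8 : ℝ) ≤ 2 ^ (k + 1) := by
        calc (8 : ℝ) = 2 ^ 3 := by norm_num
          _ ≤ 2 ^ (k + 1) := pow_le_pow_right₀ (by norm_num) (by omega)
      apply Real.cos_nonneg_of_neg_pi_div_two_le_of_le
      · have : 0 ≤ 3 * Real.pi / 2 ^ (k + 1) := by positivity
        linarith
      · rw [div_le_div_iff₀ (by positivity) (by norm_num)]; nlinarith
  -- The rational endpoints are rounded outwards so that `2l² - 1` and `2u² - 1` enclose the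
  -- previous interval.
  have b3 := step (l := 0.38267) (u := 0.3827) le_rfl b2 (by norm_num) (by norm_num) (by norm_num)
  have b4 := step (l := 0.83145) (u := 0.8315) (by norm_num) b3 (by norm_num) (by norm_num) (by norm_num)
  have b5 := step (l := 0.9569) (u := 0.957) (by norm_num) b4 (by norm_num) (by norm_num) (by norm_num)
  have b6 := step (l := 0.98916) (u := 0.9892) (by norm_num) b5 (by norm_num) (by norm_num) (by norm_num)
  -- Seven terms suffice: the remainder is below `(3π)²/2 · 4⁻⁷ · 4/3 < 0.00362`.
  have hsplit := summable_one_sub_cos.sum_add_tsum_nat_add 7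
  have hsum' : Summable fun n : ℕ => 1 - Real.cos (3 * Real.pi / 2 ^ (n + 7)) :=
    (summable_nat_add_iff 7).2 summable_one_sub_cos
  have htail0 : 0 ≤ ∑' n : ℕ, (1 - Real.cos (3 * Real.pi / 2 ^ (n + 7))) :=
    tsum_nonneg fun n => sub_nonneg.2 (Real.cos_le_one _)
  have htail : ∑' n : ℕ, (1 - Real.cos (3 * Real.pi / 2 ^ (n + 7))) ≤ 0.00362 := by
    have hg := (hasSum_geometric_of_lt_one (r := (1 / 4 : ℝ)) (by norm_num) (by norm_num)).mul_left
      ((3 * Real.pi) ^ 2 / 2 / 4 ^ 7)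
    have hle : ∀ n : ℕ, 1 - Real.cos (3 * Real.pi / 2 ^ (n + 7)) ≤
        (3 * Real.pi) ^ 2 / 2 / 4 ^ 7 * (1 / 4) ^ n := by
      intro n
      have h := Real.one_sub_sq_div_two_le_cos (x := 3 * Real.pi / 2 ^ (n + 7))
      have e : (3 * Real.pi / 2 ^ (n + 7)) ^ 2 = (3 * Real.pi) ^ 2 / 4 ^ 7 * (1 / 4) ^ n := by
        rw [div_pow, ← pow_mul, mul_comm (n + 7), pow_mul, pow_add, div_pow, one_pow]
        norm_num; field_simp
      rw [e] at h
      linarith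
    have h1 := hsum'.tsum_le_tsum hle hg.summable
    rw [hg.tsum_eq] at h1
    have h2 : Real.pi ^ 2 ≤ 3.1416 ^ 2 := pow_le_pow_left₀ hpi0.le Real.pi_lt_d4.le 2
    refine h1.trans ?_
    norm_num at h2 ⊢
    nlinarith
  simp only [Finset.sum_range_succ, Finset.sum_range_zero, zero_add] at hsplit
  rw [c0, c1] at hsplit
  rw [Set.mem_Icc] at b2 b3 b4 b5 b6
  norm_num at b2 b3 b4 b5 b6 hsplit htail ⊢
  rw [abs_lt]
  constructor <;> linarith

end Limit

/-! ### Excitation energies above the ground state -/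

noncomputable section Energies

variable {N : ℕ}

lemma energy_eq (N m : ℕ) (σ : Fin N → ℤˣ) :
    energy N m σ = energy N 0 1 + clockGap N m + ∑ i, (1 - (((σ i : ℤˣ) : ℤ) : ℝ)) := by
  rw [clockGap, Finset.sum_sub_distrib, energy, energy, energy]
  simp only [Pi.one_apply, Units.val_one, Int.cast_one]
  ring

lemma clockGap_zero (N : ℕ) : clockGap N 0 = 0 := sub_self _

lemma units_cast_eq (s : ℤˣ) : ((s : ℤ) : ℝ) = 1 ∨ ((s : ℤ) : ℝ) = -1 := by
  rcases Int.units_eq_one_or s with rfl | rfl <;> simp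

lemma sum_one_sub_nonneg (σ : Fin N → ℤˣ) : 0 ≤ ∑ i, (1 - (((σ i : ℤˣ) : ℤ) : ℝ)) :=
  Finset.sum_nonneg fun i _ => by rcases units_cast_eq (σ i) with h | h <;> rw [h] <;> norm_num

lemma energy_flip (j : Fin N) : energy N 0 (Function.update 1 j (-1)) - energy N 0 1 = 2 := by
  rw [energy_eq N 0 (Function.update 1 j (-1)), clockGap_zero, Finset.sum_eq_single j]
  · simp only [Function.update_self, Units.val_neg, Units.val_one]; norm_num
  · intro i _ hi
    rw [Function.update_of_ne hi]; simp
  · simp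

/-- Spin and clock costs add and neither is negative. A nontrivial label has a flipped spin, costing
2, or `m ≠ 0`, costing at least 3. -/
lemma energy_add_two_le {m : ℕ} (hN : 0 < N) (hm : m < clockOrder N) {σ : Fin N → ℤˣ}
    (h : ¬ (m = 0 ∧ σ = 1)) : energy N 0 1 + 2 ≤ energy N m σ := by
  rw [energy_eq N m σ]
  have h1 := sum_one_sub_nonneg σ
  by_cases hm0 : m = 0
  · subst hm0
    obtain ⟨j, hj⟩ := Function.ne_iff.1 fun hσ => h ⟨rfl, hσ⟩
    have h2 := Finset.single_le_sum (f := fun i => 1 - (((σ i : ℤˣ) : ℤ) : ℝ))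
      (fun i _ => by rcases units_cast_eq (σ i) with h | h <;> rw [h] <;> norm_num)
      (Finset.mem_univ j)
    have h3 : σ j = -1 := (Int.units_eq_one_or _).resolve_left hj
    simp only [h3, Units.val_neg, Units.val_one] at h2
    norm_num at h2 h1
    rw [clockGap_zero]
    norm_num
    linarith
  · have := three_le_clockGap hN (Nat.pos_of_ne_zero hm0) hm
    linarith

end Energies

/-! ### Operator identities, ground state and gap of the Hamiltonian -/

noncomputable section Gap

variable {N : ℕ} [NeZero N] {V : Type*} [NormedAddCommGroup V] [InnerProductSpace ℂ V]
  [FiniteDimensional ℂ V]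

namespace EdgeTheory

variable (𝓔 : EdgeTheory 1 9 N V)

lemma K_commute (i j : ZMod (2 * N)) : Commute (𝓔.K i) (𝓔.K j) := by
  rw [K_eq_clock, K_eq_clock]
  exact (𝓔.clock_commute i j).map (unitary (Module.End ℂ V)).subtype

lemma K_commute_L (i : ZMod (2 * N)) (j : Fin N) : Commute (𝓔.K i) (𝓔.L j) := by
  rw [K_eq_clock, L_eq_spin]
  exact (𝓔.spin_commute_clock _ i).symm.map (unitary (Module.End ℂ V)).subtype

lemma L_commute (i j : Fin N) : Commute (𝓔.L i) (𝓔.L j) := by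
  rw [L_eq_spin, L_eq_spin]
  refine (𝓔.spin_commute_spin ?_).map (unitary (Module.End ℂ V)).subtype
  simp only [siteSign_natCast, pow_succ, pow_mul]; simp

lemma K_sq (i : ZMod (2 * N)) : 𝓔.K i ^ 2 = 𝓔.K (i - 1) := by
  rw [K_eq_clock, K_eq_clock, ← clock_sq, SubmonoidClass.coe_pow]

lemma K_pow_clockOrder : 𝓔.K ((2 * N : ℕ) : ZMod (2 * N)) ^ clockOrder N = 1 := by
  rw [K_eq_clock, ZMod.natCast_self, ← SubmonoidClass.coe_pow, clock_pow_clockOrder, OneMemClass.coe_one]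

lemma L_sq (j : Fin N) : 𝓔.L j ^ 2 = 1 := by
  rw [L_eq_spin, ← SubmonoidClass.coe_pow, spin_sq, OneMemClass.coe_one]

lemma K_apply {m : ℕ} {σ : Fin N → ℤˣ} {v : V} (hv : v ∈ 𝓔.jointEigenspace m σ) {n : ℕ}
    (hn : n < 2 * N) : 𝓔.K ((2 * N - n : ℕ) : ZMod (2 * N)) v =
      exp (I * (2 ^ n * (2 * Real.pi * m) / clockOrder N)) • v := by
  rw [K_eq_clock, Nat.cast_sub hn.le, ZMod.natCast_self, zero_sub, 𝓔.clock_apply hv]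
  push_cast; rfl

theorem hasEigenvalue_H_iff (μ : ℂ) : 𝓔.H.HasEigenvalue μ ↔
    ∃ m < clockOrder N, ∃ σ : Fin N → ℤˣ, μ = (energy N m σ : ℂ) := by
  obtain ⟨b, hb⟩ := 𝓔.exists_eigenbasis
  rw [hasEigenvalue_iff_of_eigenbasis b (E := fun p => (energy N p.1 p.2 : ℂ))
    fun p => 𝓔.H_apply (hb p.1 p.2)]
  constructor
  · rintro ⟨p, hp⟩
    exact ⟨p.1, p.1.2, p.2, hp⟩
  · rintro ⟨m, hm, σ, h⟩
    exact ⟨(⟨m, hm⟩, σ), h⟩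

theorem eigenspace_H_ground :
    𝓔.H.eigenspace (energy N 0 1 : ℂ) = 𝓔.jointEigenspace 0 1 := by
  obtain ⟨b, hb⟩ := 𝓔.exists_eigenbasis
  refine le_antisymm (fun v hv => ?_) fun v hv =>
    Module.End.mem_eigenspace_iff.2 (𝓔.H_apply hv)
  have hv' := eigenspace_le_span_of_eigenbasis b (E := fun p => (energy N p.1 p.2 : ℂ))
    (fun p => 𝓔.H_apply (hb p.1 p.2)) (k := (⟨0, clockOrder_pos⟩, 1))
    (fun p hp he => ?_) (Module.End.mem_eigenspace_iff.1 hv)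
  · rw [hv']
    exact Submodule.smul_mem _ _ (hb ⟨0, clockOrder_pos⟩ 1)
  · have h1 : energy N p.1 p.2 = energy N 0 1 := by exact_mod_cast he
    have h2 := energy_add_two_le (Nat.pos_of_ne_zero (NeZero.ne N)) p.1.2 (σ := p.2)
      fun h => hp (Prod.ext (Fin.ext h.1) h.2)
    linarith

/-- A single flip attains the value, and it exists for every `N`, including `N = 1`, where `Q = 1`
leaves no clock excitation. -/
theorem isLeast_gap :
    IsLeast {δ : ℝ | 0 < δ ∧ 𝓔.H.HasEigenvalue ((energy N 0 1 + δ : ℝ) : ℂ)} 2 := by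
  have hN : 0 < N := Nat.pos_of_ne_zero (NeZero.ne N)
  constructor
  · refine ⟨two_pos, (𝓔.hasEigenvalue_H_iff _).2
      ⟨0, clockOrder_pos, Function.update 1 ⟨0, hN⟩ (-1), ?_⟩⟩
    rw [← energy_flip (⟨0, hN⟩ : Fin N), add_sub_cancel]
  · rintro δ ⟨hδ, h⟩
    obtain ⟨m, hm, σ, he⟩ := (𝓔.hasEigenvalue_H_iff _).1 h
    have he' : energy N 0 1 + δ = energy N m σ := by exact_mod_cast he
    have h2 := energy_add_two_le hN hm (σ := σ) (by rintro ⟨rfl, rfl⟩; linarith)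
    linarith

end EdgeTheory

end Gap

end ImpurityEdge

theorem mainTheorem4 :
    -- every (1, 9) edge theory with 2N impurities
    (∀ (N : ℕ) [NeZero N] (V : Type*) [NormedAddCommGroup V] [InnerProductSpace ℂ V]
      [FiniteDimensional ℂ V] (𝓔 : EdgeTheory 1 9 N V),
      -- commutation relations
      (∀ i j, Commute (𝓔.K i) (𝓔.K j)) ∧ (∀ i j, Commute (𝓔.K i) (𝓔.L j)) ∧
      (∀ i j, Commute (𝓔.L i) (𝓔.L j)) ∧
      -- K_i ^ 2 = K_{i-1}, K_{2N} ^ Q = 1 with Q = (4 ^ N - 1) / 3, L_i ^ 2 = 1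
      (∀ i, 𝓔.K i ^ 2 = 𝓔.K (i - 1)) ∧
      3 * clockOrder N = 4 ^ N - 1 ∧
      𝓔.K ((2 * N : ℕ) : ZMod (2 * N)) ^ clockOrder N = 1 ∧
      (∀ j, 𝓔.L j ^ 2 = 1) ∧
      -- every joint eigenspace is one-dimensional
      (∀ m < clockOrder N, ∀ σ : Fin N → ℤˣ, Module.finrank ℂ (𝓔.jointEigenspace m σ) = 1) ∧
      -- the joint eigenvectors form an orthonormal basis of the Hilbert space
      (∃ b : OrthonormalBasis (Fin (clockOrder N) × (Fin N → ℤˣ)) ℂ V,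
        ∀ (m : Fin (clockOrder N)) (σ : Fin N → ℤˣ), b (m, σ) ∈ 𝓔.jointEigenspace m σ) ∧
      -- K_{2N-n} has eigenvalue e^{i 2^n 2πm/Q}, and H_gap has energy E(m, σ)
      (∀ m < clockOrder N, ∀ σ : Fin N → ℤˣ, ∀ v ∈ 𝓔.jointEigenspace m σ,
        (∀ n < 2 * N, 𝓔.K ((2 * N - n : ℕ) : ZMod (2 * N)) v =
          exp (I * (2 ^ n * (2 * Real.pi * m) / clockOrder N)) • v) ∧
        𝓔.H v = (energy N m σ : ℂ) • v) ∧
      -- the spectrum of H_gap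
      (∀ μ : ℂ, 𝓔.H.HasEigenvalue μ ↔
        ∃ m < clockOrder N, ∃ σ : Fin N → ℤˣ, μ = (energy N m σ : ℂ)) ∧
      -- the ground state is unique: m = 0 and all σ_i = +1
      (∀ m < clockOrder N, ∀ σ : Fin N → ℤˣ, ¬ (m = 0 ∧ σ = 1) → energy N 0 1 < energy N m σ) ∧
      𝓔.H.eigenspace (energy N 0 1 : ℂ) = 𝓔.jointEigenspace 0 1 ∧
      Module.finrank ℂ (𝓔.H.eigenspace (energy N 0 1 : ℂ)) = 1 ∧
      -- a single spin flip costs energy 2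
      (∀ j, energy N 0 (Function.update 1 j (-1)) - energy N 0 1 = 2) ∧
      -- the clock excitation energies, the lowest of which occurs at m = 1
      (∀ m < clockOrder N, clockGap N m =
        ∑ n ∈ Finset.range (2 * N), (1 - Real.cos (2 ^ n * (2 * Real.pi * m) / clockOrder N))) ∧
      (∀ m < clockOrder N, m ≠ 0 → clockGap N 1 ≤ clockGap N m) ∧
      -- the energy gap of H_gap is min (Δ_flip, Δ_clock(1)) = 2
      (2 ≤ N → min 2 (clockGap N 1) = 2) ∧
      IsLeast {δ : ℝ | 0 < δ ∧ 𝓔.H.HasEigenvalue ((energy N 0 1 + δ : ℝ) : ℂ)} 2) ∧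
    -- the thermodynamic limit of the lowest clock excitation energy
    (∃ S : ℝ, HasSum (fun n : ℕ => 1 - Real.cos (3 * Real.pi / 2 ^ n)) S ∧
      Filter.Tendsto (fun N : ℕ => clockGap N 1) Filter.atTop (𝓝 S) ∧ |S - 5.55| < 0.005) := by
  refine ⟨?_, _, summable_one_sub_cos.hasSum, tendsto_clockGap_one, abs_tsum_sub_le⟩
  intro N _ V _ _ _ 𝓔
  have hN : 0 < N := Nat.pos_of_ne_zero (NeZero.ne N)
  refine ⟨𝓔.K_commute, 𝓔.K_commute_L, 𝓔.L_commute, 𝓔.K_sq, three_mul_clockOrder N,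
    𝓔.K_pow_clockOrder, 𝓔.L_sq, fun m _ σ => 𝓔.finrank_jointEigenspace m σ, 𝓔.exists_eigenbasis,
    fun m _ σ v hv => ⟨fun n hn => 𝓔.K_apply hv hn, 𝓔.H_apply hv⟩, 𝓔.hasEigenvalue_H_iff,
    fun m hm σ h => ?_, 𝓔.eigenspace_H_ground, ?_, energy_flip, fun m _ => clockGap_eq N m,
    fun m hm hm0 => clockGap_one_le hN hm0 hm, fun h2 => min_eq_left ?_, 𝓔.isLeast_gap⟩
  · linarith [energy_add_two_le hN hm h]
  · rw [𝓔.eigenspace_H_ground, 𝓔.finrank_jointEigenspace]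
  · have := five_le_clockOrder h2
    have := three_le_clockGap hN one_pos (show 1 < clockOrder N by omega)
    linarith
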